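/- Let $K\ge 1$, $[K]=\{1,\dots,K\}$, and let $\zeta=(\zeta^{(i)})_{i\in[K]}$ be probability measures on the set of finite words over $[K]$ (an ordered offspring distribution). Let $\mu^{(i)}$ be the law on $\mathbb Z_+^K$ of the numbers of letters of each type in a $\zeta^{(i)}$-distributed word, and put $m_{ij}=\sum_{\mathbf z}z_j\,\mu^{(i)}(\{\mathbf z\})$, $M=(m_{ij})$, and $Q^{(i)}_{jk}=\frac{\partial^2\varphi^{(i)}}{\partial s_j\partial s_k}(\mathbf 1)\in[0,\infty]$, where $\varphi^{(i)}(\mathbf s)=\sum_{\mathbf z}\mu^{(i)}(\{\mathbf z\})\mathbf s^{\mathbf z}$. Assume (H): for all $i,j$ there is $n\ge 1$ with $(M^n)_{ij}>0$; for some $i$, $\mu^{(i)}(\{\mathbf z:\sum_j z_j\ne 1\})>0$; $M$ has finite entries and spectral radius $1$; and $Q^{(i)}_{jk}<\infty$ for all $i,j,k$. Let $\mathbf a,\mathbf b$ be the left and right eigenvectors of $M$ with eigenvalue $1$ such that $\sum_i a_i=1$ and $\sum_i a_ib_i=1$, and let $\sigma=\sqrt{\sum_i a_i\sum_{j,k}Q^{(i)}_{jk}b_jb_k}$.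 Let $P^{(i)}$ be the law of the $K$-type Galton-Watson tree $T$ with root of type $i$: a finite planar tree $t$ with root of type $i$ has probability $\prod_{u\in t}\zeta^{(e(u))}(\mathbf w_t(u))$, where $e(u)$ is the type of $u$ and $\mathbf w_t(u)$ the word of the types of its children in order. (Under (H) this is a probability measure on finite trees.) For $\mathbf x\in[K]^{\mathbb N}$ let $P^{\mathbf x}$ be the law of the forest $F$ whose tree components $F_1,F_2,\dots$ are independent, $F_n$ with law $P^{(x_n)}$. For a $K$-type forest (or tree) $f$ and $i\in[K]$, let $\Pi^{(i)}(f)$ be the monotype forest whose vertices are the type-$i$ vertices of $f$: its roots are the type-$i$ vertices having no type-$i$ strict ancestor, and the children of a vertex $u$ are the type-$i$ strict descendants of $u$ in $f$ that are separated from $u$ by no other type-$i$ vertex, everything in depth-first order. Let $N^{(i)}(u)$ be the number of vertices deleted between $u$ and its children, that is, of strict descendants $w$ of $u$ in $f$ such that no vertex on the path from $u$ (excluded) to $w$ (included) has type $i$. Let $N^{(i)}_{\rm floor}(n)$ be the number of vertices of the $n$-th component of $f$ which neither have type $i$ nor have an ancestor of type $i$. Let $u(0),u(1),\dots$ be the vertices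 of $\Pi^{(i)}(F)$ in depth-first order. Let $\overline\mu^{(i)}_j$ be the law under $P^{(j)}$ of the number of components of $\Pi^{(i)}(T)$ if $j\neq i$, and of the number of children of the root of the tree $\Pi^{(i)}(T)$ if $j=i$. Then, for all $i\in[K]$ and $\mathbf x\in[K]^{\mathbb N}$: (i) Under $P^{\mathbf x}$, $\Pi^{(i)}(F)$ is a monotype Galton-Watson forest (with infinitely many independent components) with offspring distribution $\overline\mu^{(i)}_i$, which has mean $1$ and variance $\sigma^2/(a_ib_i^2)$. In particular it is critical with finite variance. (ii) Under $P^{\mathbf x}$, the random variables $N^{(i)}(u(n))$, $n\ge0$, and $N^{(i)}_{\rm floor}(n)$, $n\ge1$, are all independent, and the variables $N^{(i)}(u(n))$, $n\ge 0$, are identically distributed, with mean $\frac1{a_i}-1$ and finite variance. The variables $N^{(i)}_{\rm floor}(n)$, $n\ge 1$, and the laws $\overline\mu^{(i)}_j$, $j\in[K]$, have finite variance. (iii) If for some integer $p\ge1$ all the $\mu^{(j)}$ have a finite $p$-th moment (i.e. $\sum_{\mathbf z}|\mathbf z|_1^p\,\mu^{(j)}(\{\mathbf z\})<\infty$), then so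 do the laws $\overline\mu^{(i)}_j$, $j\in[K]$, and the variables $N^{(i)}(u(n))$, $n\ge 0$, and $N^{(i)}_{\rm floor}(n)$, $n\ge1$, under $P^{\mathbf x}$. If there is $\varepsilon>0$ with $\sum_{\mathbf z}e^{\varepsilon|\mathbf z|_1}\mu^{(j)}(\{\mathbf z\})<\infty$ for all $j$, then each of these laws and variables has a finite exponential moment of some positive order. -/

import Mathlib

open MeasureTheory ProbabilityTheory
open scoped ENNReal

namespace MultitypeGW

/-! ### Planar trees -/

/-- Finite planar (ordered) trees whose vertices carry labels in `α`: a root with a label and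
the ordered list of the subtrees rooted at its children.  A `K`-type planar tree is a term of
`PTree (Fin K)`, a monotype planar tree is a term of `PTree (Fin 1)`. -/
inductive PTree (α : Type) : Type
  | node (label : α) (children : List (PTree α)) : PTree α

namespace PTree

variable {α β : Type}

/-- The label of the root. -/
def label : PTree α → α
  | node a _ => a

/-- The subtrees rooted at the children of the root, from left to right. -/
def children : PTree α → List (PTree α)
  | node _ l => l

mutual
/-- The fringe subtrees `t_u`, where `u` runs through the vertices of `t` in depth-first order. -/
def fringe : PTree α → List (PTree α)
  | node a l => node a l :: fringeList l
/-- The same for a list of trees, read from left to right. -/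
def fringeList : List (PTree α) → List (PTree α)
  | [] => []
  | t :: l => fringe t ++ fringeList l
end

/-- The labels of the vertices of `t` in depth-first order. -/
def labels (t : PTree α) : List α := t.fringe.map label

mutual
/-- Change of labels. -/
def relabel (g : α → β) : PTree α → PTree β
  | node a l => node (g a) (relabelList g l)
/-- The same for a list of trees. -/
def relabelList (g : α → β) : List (PTree α) → List (PTree β)
  | [] => []
  | t :: l => relabel g t :: relabelList g l
end

end PTree

/-- The set of finite trees (with countably many labels) is countable: all subsets are
measurable. -/
instance instMeasurableSpacePTree {α : Type} : MeasurableSpace (PTree α) := ⊤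

/-- `none` stands for an absent tree component. -/
instance instMeasurableSpaceOptionPTree {α : Type} : MeasurableSpace (Option (PTree α)) := ⊤

/-! ### Offspring distributions -/

section Offspring

variable {K : ℕ}

/-- The numbers of letters of each type in a word. -/
def typeCount (w : List (Fin K)) : Fin K → ℕ := fun j => w.count j

/-- The unordered offspring distribution `μ = p_* ζ` of an ordered offspring distribution `ζ`. -/
noncomputable def unordered (ζ : Fin K → PMF (List (Fin K))) : Fin K → PMF (Fin K → ℕ) :=
  fun i => (ζ i).map typeCount

variable (μ : Fin K → PMF (Fin K → ℕ))

/-- Some type has, with positive probability, a number of children different from one. -/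
def IsNondegenerate : Prop :=
  ∃ i, 0 < (μ i).toOuterMeasure {z | ∑ j, z j ≠ 1}

/-- The mean matrix, with entries in `[0, ∞]`. -/
noncomputable def meanMatrix : Matrix (Fin K) (Fin K) ℝ≥0∞ :=
  Matrix.of fun i j => ∑' z : Fin K → ℕ, (z j : ℝ≥0∞) * μ i z

/-- The mean matrix as a real matrix (meaningful when all the means are finite). -/
noncomputable def realMeanMatrix : Matrix (Fin K) (Fin K) ℝ :=
  (meanMatrix μ).map ENNReal.toReal

/-- For all types `i, j` some power `M ^ n`, `n ≥ 1`, of the mean matrix has a positive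
`(i, j)` entry. -/
def IsIrreducible : Prop :=
  ∀ i j, ∃ n : ℕ, 1 ≤ n ∧ 0 < (meanMatrix μ ^ n) i j

/-- The means are finite and the maximal modulus of a (complex) eigenvalue of the mean matrix
is `1`. -/
def IsCritical : Prop :=
  (∀ i j, meanMatrix μ i j ≠ ∞) ∧
    spectralRadius ℂ ((realMeanMatrix μ).map (algebraMap ℝ ℂ)) = 1

/-- The second derivatives `Q^{(i)}_{jk}` at `(1, …, 1)` of the generating functions
`∑ z, μ i z * s ^ z`, in `[0, ∞]`: differentiating `s ^ z` twice gives `z j * z k` if `j ≠ k`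
and `z j * (z j - 1)` if `j = k`. -/
noncomputable def secondDeriv (i j k : Fin K) : ℝ≥0∞ :=
  ∑' z : Fin K → ℕ, ((z j * (z k - if j = k then 1 else 0) : ℕ) : ℝ≥0∞) * μ i z

/-- All the second derivatives of the generating functions are finite. -/
def HasFiniteVariance : Prop :=
  ∀ i j k, secondDeriv μ i j k ≠ ∞

/-- The quadratic form `Q^{(i)}(s)`. -/
noncomputable def quadForm (i : Fin K) (s : Fin K → ℝ) : ℝ :=
  ∑ j, ∑ k, (secondDeriv μ i j k).toReal * s j * s k

/-- `σ = √(∑ i, a i * Q^{(i)}(b))`. -/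
noncomputable def sigma (a b : Fin K → ℝ) : ℝ :=
  Real.sqrt (∑ i, a i * quadForm μ i b)

/-- The basic assumption (H). -/
structure BasicAssumption : Prop where
  irreducible : IsIrreducible μ
  nondegenerate : IsNondegenerate μ
  critical : IsCritical μ
  finiteVariance : HasFiniteVariance μ

/-- The total number of children has a finite `p`-th moment, for every type of the parent. -/
def HasMoment (p : ℕ) : Prop :=
  ∀ i, ∑' z : Fin K → ℕ, ((∑ j, z j : ℕ) : ℝ≥0∞) ^ p * μ i z < ∞

/-- The total number of children has a finite exponential moment, for every type of the
parent. -/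
def HasExpMoment : Prop :=
  ∃ ε : ℝ, 0 < ε ∧
    ∀ i, ∑' z : Fin K → ℕ, ENNReal.ofReal (Real.exp (ε * ((∑ j, z j : ℕ) : ℝ))) * μ i z < ∞

end Offspring

/-! ### Galton-Watson trees and forests -/

section GW

variable {K : ℕ} (ζ : Fin K → PMF (List (Fin K)))

/-- The product over the vertices `u` of `t` of `ζ^{(e(u))}(w_t(u))`, where `e(u)` is the type of
`u` and `w_t(u)` is the word of the types of its children. -/
noncomputable def gwWeight (t : PTree (Fin K)) : ℝ≥0∞ :=
  (t.fringe.map fun s => ζ s.label (s.children.map PTree.label)).prod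

/-- The law `P^{(i)}` on finite `K`-type trees with root of type `i`: the tree `t` has mass
`gwWeight ζ t`. -/
noncomputable def treeLaw (i : Fin K) : Measure (PTree (Fin K)) :=
  Measure.sum fun t => (if t.label = i then gwWeight ζ t else 0) • Measure.dirac t

open Classical in
/-- The law `P^x` of a forest with infinitely many independent components, the `n`-th of them
with law `P^{(x n)}`.  (The laws `P^{(i)}` have total mass one as soon as the trees are almost
surely finite; otherwise the law of the forest is not defined and `0` is a default value.) -/
noncomputable def forestLaw (x : ℕ → Fin K) : Measure (ℕ → PTree (Fin K)) :=
  if h : ∀ n, IsProbabilityMeasure (treeLaw ζ (x n)) then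
    haveI := h
    Measure.infinitePi fun n => treeLaw ζ (x n)
  else 0

/-- The ordered one-type offspring distribution for which the number of children has law `ν`. -/
noncomputable def monotypeOffspring (ν : PMF ℕ) : Fin 1 → PMF (List (Fin 1)) :=
  fun _ => ν.map fun n => List.replicate n 0

/-- The law of a monotype Galton-Watson forest with infinitely many components and offspring
distribution `ν`, as a law on finite or infinite sequences of trees. -/
noncomputable def monotypeForestLaw (ν : PMF ℕ) : Measure (ℕ → Option (PTree (Fin 1))) :=
  (forestLaw (monotypeOffspring ν) fun _ => 0).map fun f n => some (f n)

end GW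

/-! ### Keeping the vertices of one type -/

/-- The concatenation of the lists `L 0, L 1, L 2, …`, as a finite or infinite sequence: its
`k`-th term, or `none` if the concatenation has at most `k` terms. -/
noncomputable def concat {α : Type} (L : ℕ → List α) (k : ℕ) : Option α :=
  ((List.range (sInf {N | k < ((List.range N).flatMap L).length})).flatMap L)[k]?

/-- The labels of the vertices `u(0), u(1), …` of a forest in depth-first order. -/
noncomputable def forestLabels {α : Type} (f : ℕ → Option (PTree α)) : ℕ → Option α :=
  concat fun k => (f k).elim [] PTree.labels

section Reduction

variable {K : ℕ} (i : Fin K)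

mutual
/-- The reduced forest of a `K`-type tree `t`.  Its roots correspond to the type-`i` vertices of
`t` with no type-`i` strict ancestor, and the children of the vertex `u`, corresponding to the
type-`i` vertex `v_u` of `t`, correspond to the type-`i` strict descendants of `v_u` that are
separated from `v_u` by no type-`i` vertex; everything is in depth-first order.  The label of `u`
in the reduced forest is the fringe subtree of `t` at `v_u`. -/
def reduceTree : PTree (Fin K) → List (PTree (PTree (Fin K)))
  | .node j l => if j = i then [.node (.node j l) (reduceList l)] else reduceList l
/-- The same for a list of trees, read from left to right. -/
def reduceList : List (PTree (Fin K)) → List (PTree (PTree (Fin K)))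
  | [] => []
  | t :: l => reduceTree t ++ reduceList l
end

mutual
/-- The number of vertices `v` of `t` such that neither `v` nor any ancestor of `v` has
type `i`. -/
def floorTree : PTree (Fin K) → ℕ
  | .node j l => if j = i then 0 else 1 + floorList l
/-- The same for a list of trees. -/
def floorList : List (PTree (Fin K)) → ℕ
  | [] => 0
  | t :: l => floorTree t + floorList l
end

/-- For a tree `s` with root `v` of type `i`, the number of vertices deleted between `v` and the
nearest type-`i` vertices below it: the number of vertices `w ≠ v` of `s` such that no vertex on
the path from `v` (excluded) to `w` (included) has type `i`. -/
def deletedBelow (s : PTree (Fin K)) : ℕ := floorList i s.children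

/-- The reduced forest of a `K`-type forest, with the labels described above. -/
noncomputable def labelledReduction (f : ℕ → PTree (Fin K)) :
    ℕ → Option (PTree (PTree (Fin K))) :=
  concat fun n => reduceTree i (f n)

/-- The monotype forest `Π^{(i)}(f)`. -/
noncomputable def reduction (f : ℕ → PTree (Fin K)) : ℕ → Option (PTree (Fin 1)) :=
  fun k => (labelledReduction i f k).map (PTree.relabel fun _ => 0)

/-- `N^{(i)}(u(n))`, the number of vertices deleted between the vertex `u(n)` of `Π^{(i)}(f)` and
its children, where `u(0), u(1), …` are the vertices of `Π^{(i)}(f)` in depth-first order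
(by convention `0` if `Π^{(i)}(f)` has at most `n` vertices). -/
noncomputable def deletedCount (n : ℕ) (f : ℕ → PTree (Fin K)) : ℕ :=
  (forestLabels (labelledReduction i f) n).elim 0 (deletedBelow i)

/-- The number of vertices of the `n`-th component (`n = 0, 1, …`) that lie below the first layer
of type-`i` vertices, i.e. are not of type `i` and have no type-`i` ancestor. -/
def floorCount (n : ℕ) (f : ℕ → PTree (Fin K)) : ℕ := floorTree i (f n)

/-- The number `c_{Π^{(i)}(t)}(∅)` for a `K`-type tree `t`: the number of children of the root of
the reduced tree if the root of `t` has type `i`, the number of components of the reduced forest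
otherwise. -/
def reducedRootCount (t : PTree (Fin K)) : ℕ :=
  if t.label = i then
    match reduceTree i t with
    | s :: _ => s.children.length
    | [] => 0
  else (reduceTree i t).length

/-- The law of `c_{Π^{(i)}(T)}(∅)` under `P^{(j)}`. -/
noncomputable def reducedOffspring (ζ : Fin K → PMF (List (Fin K))) (i j : Fin K) : Measure ℕ :=
  (treeLaw ζ j).map (reducedRootCount i)

end Reduction

/-! ### Moments of integer-valued random variables -/

section Moments

variable {Ω : Type} [MeasurableSpace Ω]

/-- `E[X ^ p] < ∞`. -/
def FiniteMoment (X : Ω → ℕ) (P : Measure Ω) (p : ℕ) : Prop :=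
  ∫⁻ ω, (X ω : ℝ≥0∞) ^ p ∂P < ∞

/-- `E[exp (ε X)] < ∞` for some `ε > 0`. -/
def FiniteExpMoment (X : Ω → ℕ) (P : Measure Ω) : Prop :=
  ∃ ε : ℝ, 0 < ε ∧ ∫⁻ ω, ENNReal.ofReal (Real.exp (ε * (X ω : ℝ))) ∂P < ∞

end Moments

end MultitypeGW

open MultitypeGW

/-!
The reduction `Π^{(i)}` is governed by the branching property `lintegral_treeLaw`: given the word
of the types of the children of the root, the subtrees at these children are independent.
Exploring a tree until its first type-`i` vertices shows that the subtrees at these vertices are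
independent trees with law `P^{(i)}`, independent of the explored part. In terms of the marked
reduction, in which a vertex of the reduced forest is labelled by the number of vertices deleted
below it, this says that the components are, given their number and the number of vertices of the
floor, independent trees whose pairs (mark, number of children) are independent and identically
distributed. This is `treeLaw_markedReduction`, an identity between probabilities of single values
which is proved by induction on the size of the reduction.

To pass to infinite forests, the reduced forest is realized by cutting one sequence of independent
marked trees into chunks whose lengths are the numbers of type-`i` roots in the components of the
original forest (`map_chunk_eq_infinitePi`). Concatenating the chunks gives back the sequence, as
infinitely many components contain type-`i` vertices, so the reduced forest is a Galton-Watson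
forest independent of the floors (`map_floor_markedForest`). The marks in depth-first order are
independent because the law of a Galton-Watson forest is invariant under grafting a new root with
an independent number of children on its first trees (`map_graft_eq`): this exposes one mark at a
time.

The assumption of criticality enters through linear algebra. By Perron-Frobenius
(`eigenvectors_pos`) the eigenvectors `a` and `b` are positive. Pairing inequalities for vectors
indexed by the types with `a` yields the almost sure finiteness of the trees
(`isProbabilityMeasure_treeLaw`), and the finiteness of the Green function `v` of the mean matrix
killed at `i` (`exists_killed_supersolution`). The size of a tree pruned at its first type-`i`
vertices bounds all the variables under consideration. Its moments satisfy recursions whose linear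
part is the killed mean matrix, so multiples of `v`, or exponentials of small multiples of `v`,
bound them (`lintegral_prunedSize_pow_ne_top`, `exists_lintegral_exp_prunedBelow_ne_top`).

Once everything is finite, the means and the variance follow from one identity: if `y = M x + s`,
and if `x` and `y` agree except at `i`, then pairing with `a` gives `a i * y i = a i * x i + ∑ j,
a j * s j` (`mul_eq_of_leftEigenvector`). The variance involves in addition the means of the
numbers of first type-`i` vertices, which are `b j / b i`, since they form a positive right
eigenvector equal to one at `i`.
-/

namespace MultitypeGW

/-! ### Planar trees: induction, heights and countability -/

namespace PTree

variable {α β : Type}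

/-- Induction on planar trees: the property passes from all the subtrees at the children of the
root to the tree. -/
theorem induct {p : PTree α → Prop} (h : ∀ a l, (∀ t ∈ l, p t) → p (node a l)) : ∀ t, p t
  | node a l => h a l fun t _ => induct h t
termination_by t => sizeOf t
decreasing_by
  have := List.sizeOf_lt_of_mem ‹t ∈ l›
  simp only [node.sizeOf_spec]
  omega

@[simp] theorem label_node (a : α) (l : List (PTree α)) : (node a l).label = a := rfl

@[simp] theorem children_node (a : α) (l : List (PTree α)) : (node a l).children = l := rfl

theorem node_label_children (t : PTree α) : node t.label t.children = t := by
  cases t; rfl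

theorem fringeList_eq (l : List (PTree α)) : fringeList l = l.flatMap fringe := by
  induction l with
  | nil => simp [fringeList]
  | cons t l ih => simp [fringeList, ih]

theorem fringe_node (a : α) (l : List (PTree α)) :
    (node a l).fringe = node a l :: l.flatMap fringe := by
  simp [fringe, fringeList_eq]

theorem labels_node (a : α) (l : List (PTree α)) :
    (node a l).labels = a :: l.flatMap labels := by
  simp [labels, fringe_node, List.map_flatMap]
  rfl

theorem relabelList_eq (g : α → β) (l : List (PTree α)) :
    relabelList g l = l.map (relabel g) := by
  induction l with
  | nil => simp [relabelList]
  | cons t l ih => simp [relabelList, ih]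

theorem relabel_node (g : α → β) (a : α) (l : List (PTree α)) :
    (node a l).relabel g = node (g a) (l.map (relabel g)) := by
  simp [relabel, relabelList_eq]

theorem labels_relabel (g : α → β) (t : PTree α) : (t.relabel g).labels = t.labels.map g := by
  induction t using induct with
  | h a l ih =>
    simp only [relabel_node, labels_node, List.flatMap_map, List.map_cons, List.map_flatMap]
    rw [List.flatMap_congr ih]

/-- The tree has height smaller than `n` (a single vertex has height `0`). -/
def HeightLT : ℕ → PTree α → Prop
  | 0, _ => False
  | n + 1, t => ∀ s ∈ t.children, HeightLT n s

theorem HeightLT.succ {n : ℕ} {t : PTree α} (h : HeightLT n t) : HeightLT (n + 1) t := by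
  induction n generalizing t with
  | zero => exact h.elim
  | succ n ih => exact fun s hs => ih (h s hs)

theorem HeightLT.mono {n m : ℕ} (hnm : n ≤ m) {t : PTree α} (h : HeightLT n t) :
    HeightLT m t := by
  induction hnm with
  | refl => exact h
  | step _ ih => exact ih.succ

theorem exists_heightLT (t : PTree α) : ∃ n, HeightLT n t := by
  induction t using induct with
  | h a l ih =>
    suffices ∃ n, ∀ t ∈ l, HeightLT n t from this.imp' Nat.succ fun n hn => hn
    induction l with
    | nil => simp
    | cons t l ihl =>
      obtain ⟨n, hn⟩ := ih t (by simp)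
      obtain ⟨m, hm⟩ := ihl fun s hs => ih s (by simp [hs])
      refine ⟨max n m, fun s hs => ?_⟩
      rcases List.mem_cons.1 hs with rfl | hs
      · exact hn.mono (le_max_left _ _)
      · exact (hm s hs).mono (le_max_right _ _)

instance instCountable [Countable α] : Countable (PTree α) := by
  have h : ∀ n, {t : PTree α | HeightLT n t}.Countable := by
    intro n
    induction n with
    | zero => simp [HeightLT]
    | succ n ih =>
      have : {l : List (PTree α) | ∀ t ∈ l, t ∈ {t | HeightLT n t}}.Countable := by
        have := ih.to_subtype
        rw [← Set.range_list_map_coe]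
        exact Set.countable_range _
      refine ((Set.countable_univ (α := α)).image2 this node).mono fun t ht => ?_
      exact ⟨t.label, Set.mem_univ _, t.children, ht, node_label_children t⟩
  rw [← Set.countable_univ_iff]
  refine (Set.countable_iUnion h).mono fun t _ => ?_
  simpa using exists_heightLT t

end PTree

/-- All sets of lists of trees are measurable. -/
instance instMeasurableSpaceListPTree {α : Type} : MeasurableSpace (List (PTree α)) := ⊤

instance instDiscretePTree {α : Type} : DiscreteMeasurableSpace (PTree α) := ⟨fun _ => trivial⟩

instance instDiscreteOptionPTree {α : Type} : DiscreteMeasurableSpace (Option (PTree α)) :=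
  ⟨fun _ => trivial⟩

instance instDiscreteListPTree {α : Type} : DiscreteMeasurableSpace (List (PTree α)) :=
  ⟨fun _ => trivial⟩

/-! ### The branching property of the Galton-Watson laws -/

section Branching

variable {K : ℕ} (ζ : Fin K → PMF (List (Fin K)))

theorem gwWeight_node (a : Fin K) (l : List (PTree (Fin K))) :
    gwWeight ζ (.node a l) = ζ a (l.map PTree.label) * (l.map (gwWeight ζ)).prod := by
  simp only [gwWeight, PTree.fringe_node, List.map_cons, List.prod_cons, PTree.label_node,
    PTree.children_node, List.map_flatMap]
  congr 1
  induction l with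
  | nil => simp
  | cons t l ih => simp [ih, gwWeight]

theorem treeLaw_singleton (j : Fin K) (t : PTree (Fin K)) :
    treeLaw ζ j {t} = if t.label = j then gwWeight ζ t else 0 := by
  classical
  rw [treeLaw, Measure.sum_apply _ (MeasurableSet.of_discrete), tsum_eq_single t]
  · split_ifs <;> simp
  · intro s hs
    split_ifs <;> simp [hs]

/-- The law of a list of independent Galton-Watson trees whose roots have the types prescribed
by a word. -/
noncomputable def listLaw : List (Fin K) → Measure (List (PTree (Fin K)))
  | [] => Measure.dirac []
  | j :: w => (treeLaw ζ j).bind fun t => (listLaw w).map (List.cons t)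

@[simp] theorem lintegral_listLaw_nil (f : List (PTree (Fin K)) → ℝ≥0∞) :
    ∫⁻ l, f l ∂(listLaw ζ []) = f [] := by
  simp [listLaw]

theorem lintegral_listLaw_cons (j : Fin K) (w : List (Fin K))
    (f : List (PTree (Fin K)) → ℝ≥0∞) :
    ∫⁻ l, f l ∂(listLaw ζ (j :: w)) =
      ∫⁻ t, ∫⁻ l, f (t :: l) ∂(listLaw ζ w) ∂(treeLaw ζ j) := by
  rw [listLaw, Measure.lintegral_bind (Measurable.of_discrete.aemeasurable) (by fun_prop)]
  refine lintegral_congr fun t => ?_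
  rw [lintegral_map (by fun_prop) (by fun_prop)]

theorem listLaw_singleton (w : List (Fin K)) (l : List (PTree (Fin K))) :
    listLaw ζ w {l} = if l.map PTree.label = w then (l.map (gwWeight ζ)).prod else 0 := by
  classical
  induction w generalizing l with
  | nil =>
    cases l <;> simp [listLaw]
  | cons j w ih =>
    rw [← lintegral_indicator_one MeasurableSet.of_discrete, lintegral_listLaw_cons]
    cases l with
    | nil => simp [Set.indicator]
    | cons t₀ l₀ =>
      have : ∀ t, ∫⁻ l, ({t₀ :: l₀} : Set (List (PTree (Fin K)))).indicator 1 (t :: l)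
          ∂(listLaw ζ w) = ({t₀} : Set (PTree (Fin K))).indicator 1 t * listLaw ζ w {l₀} := by
        intro t
        rw [← lintegral_indicator_one MeasurableSet.of_discrete,
          ← lintegral_const_mul _ (by fun_prop)]
        refine lintegral_congr fun l => ?_
        by_cases h1 : t = t₀ <;> by_cases h2 : l = l₀ <;> simp [Set.indicator, h1, h2]
      simp only [this]
      rw [lintegral_mul_const _ (by fun_prop), lintegral_indicator_one MeasurableSet.of_discrete,
        treeLaw_singleton, ih]
      by_cases h1 : t₀.label = j <;> by_cases h2 : l₀.map PTree.label = w <;> simp [h1, h2]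

/-- The branching property: the list of the subtrees at the children of the root is, given the
word `w` of their types, a list of independent trees with root types `w`. -/
theorem lintegral_treeLaw (j : Fin K) (f : PTree (Fin K) → ℝ≥0∞) :
    ∫⁻ t, f t ∂(treeLaw ζ j) = ∑' w, ζ j w * ∫⁻ l, f (.node j l) ∂(listLaw ζ w) := by
  classical
  have h : treeLaw ζ j = Measure.sum fun w => ζ j w • (listLaw ζ w).map (PTree.node j) := by
    rw [Measure.ext_iff_singleton]
    rintro ⟨a, l⟩
    rw [Measure.sum_apply _ MeasurableSet.of_discrete, treeLaw_singleton, gwWeight_node,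
      PTree.label_node]
    have : ∀ w, (ζ j w • (listLaw ζ w).map (PTree.node j)) {PTree.node a l} =
        if a = j ∧ l.map PTree.label = w then ζ j w * (l.map (gwWeight ζ)).prod else 0 := by
      intro w
      rw [Measure.smul_apply, Measure.map_apply (by fun_prop) MeasurableSet.of_discrete]
      by_cases ha : a = j
      · have : PTree.node j ⁻¹' {PTree.node a l} = {l} := by
          ext l'; simp [ha]
        rw [this, listLaw_singleton]
        by_cases hw : l.map PTree.label = w <;> simp [ha, hw]
      · have : PTree.node j ⁻¹' {PTree.node a l} = ∅ := by
          ext l'; simp [Ne.symm ha]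
        simp [this, ha]
    simp only [this]
    rw [tsum_eq_single (l.map PTree.label)]
    · by_cases ha : a = j <;> simp [ha]
    · intro w hw
      simp [Ne.symm hw]
  rw [h, lintegral_sum_measure]
  refine tsum_congr fun w => ?_
  rw [lintegral_smul_measure, lintegral_map (by fun_prop) (by fun_prop), smul_eq_mul]

theorem lintegral_listLaw_prod (f : PTree (Fin K) → ℝ≥0∞) (w : List (Fin K)) :
    ∫⁻ l, (l.map f).prod ∂(listLaw ζ w) =
      (w.map fun j => ∫⁻ t, f t ∂(treeLaw ζ j)).prod := by
  induction w with
  | nil => simp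
  | cons j w ih =>
    rw [lintegral_listLaw_cons]
    simp only [List.map_cons, List.prod_cons, ← ih]
    rw [← lintegral_mul_const _ (by fun_prop)]
    exact lintegral_congr fun t => lintegral_const_mul _ .of_discrete

open Classical in
/-- Integrals over the law of a tree are limits of integrals over trees of bounded height. -/
theorem lintegral_treeLaw_le_of_heightLT (j : Fin K) (f : PTree (Fin K) → ℝ≥0∞) (C : ℝ≥0∞)
    (h : ∀ n, ∫⁻ t, (if t.HeightLT n then f t else 0) ∂(treeLaw ζ j) ≤ C) :
    ∫⁻ t, f t ∂(treeLaw ζ j) ≤ C := by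
  have hf : ∀ t, f t = ⨆ n, if t.HeightLT n then f t else 0 := by
    intro t
    obtain ⟨n, hn⟩ := t.exists_heightLT
    refine le_antisymm ?_ (iSup_le fun n => by split_ifs <;> simp)
    exact le_iSup_of_le n (by simp [hn])
  rw [lintegral_congr hf, lintegral_iSup (fun _ => .of_discrete)]
  · exact iSup_le h
  · intro n m hnm t
    dsimp only
    split_ifs with h1 h2
    · exact le_rfl
    · exact absurd (h1.mono hnm) h2
    · exact zero_le
    · exact le_rfl

open Classical in
/-- Integrals over trees of height less than `n + 1`, in terms of the list of the subtrees at the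
children of the root. -/
theorem lintegral_treeLaw_heightLT_succ (j : Fin K) (f : PTree (Fin K) → ℝ≥0∞) (n : ℕ) :
    ∫⁻ t, (if t.HeightLT (n + 1) then f t else 0) ∂(treeLaw ζ j) =
      ∑' w, ζ j w * ∫⁻ l, (if ∀ t ∈ l, t.HeightLT n then f (.node j l) else 0)
        ∂(listLaw ζ w) := by
  rw [lintegral_treeLaw]
  refine tsum_congr fun w => congrArg _ (lintegral_congr fun l => ?_)
  exact if_congr Iff.rfl rfl rfl

theorem listLaw_univ (w : List (Fin K)) :
    listLaw ζ w Set.univ = (w.map fun k => treeLaw ζ k Set.univ).prod := by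
  simpa using lintegral_listLaw_prod ζ (fun _ => 1) w

theorem treeLaw_univ_le_one (j : Fin K) : treeLaw ζ j Set.univ ≤ 1 := by
  classical
  rw [← lintegral_one]
  refine lintegral_treeLaw_le_of_heightLT ζ j _ _ fun n => ?_
  induction n generalizing j with
  | zero => simp [PTree.HeightLT]
  | succ n ih =>
    rw [lintegral_treeLaw_heightLT_succ]
    refine le_trans (ENNReal.tsum_le_tsum fun w => mul_le_of_le_one_right' ?_)
      (PMF.tsum_coe (ζ j)).le
    calc ∫⁻ l, (if ∀ t ∈ l, t.HeightLT n then 1 else 0) ∂(listLaw ζ w)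
        ≤ ∫⁻ l, (l.map fun t => if t.HeightLT n then 1 else 0).prod ∂(listLaw ζ w) := by
          gcongr with l
          split_ifs with h
          · rw [List.map_congr_left (g := fun _ => 1) fun t ht => by simp [h t ht]]
            simp
          · exact zero_le
      _ ≤ 1 := by
          rw [lintegral_listLaw_prod]
          exact (List.prod_le_pow_card _ 1 (by simpa using fun k _ => ih k)).trans_eq (one_pow _)

/-- Let `f` be a functional of trees which, for each type of the root, is either bounded by a
constant `g j` or submultiplicative with respect to the subtrees at the children of the root.
If `g` is a supersolution of the corresponding recursion, then it dominates the integrals of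
`f`. -/
theorem lintegral_treeLaw_le_of_supersolution (f : PTree (Fin K) → ℝ≥0∞) (c g : Fin K → ℝ≥0∞)
    (hf : ∀ j, (∀ l, f (.node j l) ≤ g j) ∨ ((∀ l, f (.node j l) ≤ c j * (l.map f).prod) ∧
      c j * ∑' w, ζ j w * (w.map g).prod ≤ g j)) (j : Fin K) :
    ∫⁻ t, f t ∂(treeLaw ζ j) ≤ g j := by
  classical
  refine lintegral_treeLaw_le_of_heightLT ζ j f _ fun n => ?_
  induction n generalizing j with
  | zero => simp [PTree.HeightLT]
  | succ n ih =>
    rw [lintegral_treeLaw_heightLT_succ]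
    rcases hf j with hf | ⟨hf, hg⟩
    · calc ∑' w, ζ j w * ∫⁻ l, (if ∀ t ∈ l, t.HeightLT n then f (.node j l) else 0)
            ∂(listLaw ζ w)
          ≤ ∑' w, ζ j w * g j := by
            refine ENNReal.tsum_le_tsum fun w => mul_le_mul_right ?_ _
            calc ∫⁻ l, (if ∀ t ∈ l, t.HeightLT n then f (.node j l) else 0) ∂(listLaw ζ w)
                ≤ ∫⁻ _, g j ∂(listLaw ζ w) := by
                  gcongr with l
                  split_ifs
                  · exact hf l
                  · exact zero_le
              _ ≤ g j := by
                  rw [lintegral_const, listLaw_univ]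
                  exact mul_le_of_le_one_right' ((List.prod_le_pow_card _ 1 (by
                    simpa using fun k _ => treeLaw_univ_le_one ζ k)).trans_eq (one_pow _))
        _ = g j := by rw [ENNReal.tsum_mul_right, PMF.tsum_coe, one_mul]
    refine le_trans ?_ hg
    rw [← ENNReal.tsum_mul_left]
    refine ENNReal.tsum_le_tsum fun w => ?_
    calc ζ j w * ∫⁻ l, (if ∀ t ∈ l, t.HeightLT n then f (.node j l) else 0) ∂(listLaw ζ w)
        ≤ ζ j w * ∫⁻ l, c j * (l.map fun t => if t.HeightLT n then f t else 0).prod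
            ∂(listLaw ζ w) := by
          gcongr with l
          split_ifs with h
          · rw [List.map_congr_left (g := f) fun t ht => by simp [h t ht]]
            exact hf l
          · exact zero_le
      _ = c j * (ζ j w * (w.map fun k => ∫⁻ t, (if t.HeightLT n then f t else 0)
            ∂(treeLaw ζ k)).prod) := by
          rw [lintegral_const_mul _ .of_discrete, lintegral_listLaw_prod]
          ring
      _ ≤ _ := by
          gcongr
          exact List.prod_le_prod' (by simpa using fun k _ => ih k)

end Branching

/-! ### Perron-Frobenius theory for the eigenvalue one -/

section PerronFrobenius

theorem mulVec_mono {ι : Type} [Fintype ι] {M : Matrix ι ι ℝ}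
    (hM : ∀ i j, 0 ≤ M i j) {u v : ι → ℝ} (h : u ≤ v) :
    M.mulVec u ≤ M.mulVec v := fun i =>
  Finset.sum_le_sum fun j _ => mul_le_mul_of_nonneg_left (h j) (hM i j)

variable {ι : Type} [Fintype ι] [DecidableEq ι]

open Filter Topology in
/-- By Gelfand's formula, the powers of a matrix of spectral radius at most one grow
subexponentially. -/
theorem eventually_pow_le_of_spectralRadius_le_one (M : Matrix ι ι ℝ)
    (h : spectralRadius ℂ (M.map (algebraMap ℝ ℂ)) ≤ 1) {r : ℝ} (hr : 1 < r) :
    ∀ᶠ n : ℕ in atTop, ∀ i j, (M ^ n) i j ≤ r ^ n := by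
  let _ : NormedRing (Matrix ι ι ℂ) := Matrix.linftyOpNormedRing
  let _ : NormedAlgebra ℂ (Matrix ι ι ℂ) := Matrix.linftyOpNormedAlgebra
  have _ : CompleteSpace (Matrix ι ι ℂ) := FiniteDimensional.complete ℂ _
  set A : Matrix ι ι ℂ := M.map (algebraMap ℝ ℂ) with hA
  have hlim := spectrum.pow_nnnorm_pow_one_div_tendsto_nhds_spectralRadius A
  have hlt : spectralRadius ℂ A < ENNReal.ofReal r :=
    h.trans_lt (by
      rw [← ENNReal.ofReal_one]
      exact (ENNReal.ofReal_lt_ofReal_iff (by linarith)).2 hr)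
  filter_upwards [hlim.eventually (gt_mem_nhds hlt), eventually_ge_atTop 1] with n hn hn1 i j
  have hn0 : (n : ℝ) ≠ 0 := by positivity
  have h1 : (‖A ^ n‖₊ : ℝ≥0∞) ≤ ENNReal.ofReal (r ^ n) := by
    have h2 := ENNReal.rpow_le_rpow hn.le (z := n) (by positivity)
    rw [← ENNReal.rpow_mul, one_div, inv_mul_cancel₀ hn0, ENNReal.rpow_one,
      ENNReal.rpow_natCast] at h2
    rwa [ENNReal.ofReal_pow (by linarith)]
  have h3 : ‖A ^ n‖ ≤ r ^ n := by
    rw [← ENNReal.ofReal_le_ofReal_iff (by positivity)]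
    rwa [← enorm_eq_nnnorm, ← ofReal_norm] at h1
  have h4 : (A ^ n) i j = ((M ^ n) i j : ℂ) := by
    rw [hA, ← Matrix.map_pow]; rfl
  have h5 : ‖(A ^ n) i j‖ ≤ ‖A ^ n‖ := by
    rw [Matrix.linfty_opNorm_def]
    have h6 : ∑ k, ‖(A ^ n) i k‖₊ ≤ Finset.univ.sup fun i => ∑ k, ‖(A ^ n) i k‖₊ :=
      Finset.le_sup (f := fun i => ∑ k, ‖(A ^ n) i k‖₊) (Finset.mem_univ i)
    have h7 : ‖(A ^ n) i j‖₊ ≤ ∑ k, ‖(A ^ n) i k‖₊ :=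
      Finset.single_le_sum (f := fun k => ‖(A ^ n) i k‖₊) (fun _ _ => zero_le) (Finset.mem_univ j)
    exact_mod_cast h7.trans h6
  rw [h4, Complex.norm_real] at h5
  exact (le_abs_self _).trans (h5.trans h3)

theorem pow_nonneg_of_nonneg {M : Matrix ι ι ℝ} (hM : ∀ i j, 0 ≤ M i j) (n : ℕ) (i j : ι) :
    0 ≤ (M ^ n) i j := by
  induction n generalizing i j with
  | zero => rw [pow_zero, Matrix.one_apply]; split_ifs <;> norm_num
  | succ n ih =>
    rw [pow_succ, Matrix.mul_apply]
    exact Finset.sum_nonneg fun k _ => mul_nonneg (ih i k) (hM k j)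

theorem pow_mulVec_of_mulVec_eq {M : Matrix ι ι ℝ} {u : ι → ℝ} (h : M.mulVec u = u) (n : ℕ) :
    (M ^ n).mulVec u = u := by
  induction n with
  | zero => simp
  | succ n ih => rw [pow_succ, ← Matrix.mulVec_mulVec, h, ih]

/-- A nonnegative nonzero vector fixed by an irreducible nonnegative matrix is positive. -/
theorem pos_of_mulVec_eq {M : Matrix ι ι ℝ} (hM : ∀ i j, 0 ≤ M i j)
    (hirr : ∀ i j, ∃ n : ℕ, 1 ≤ n ∧ 0 < (M ^ n) i j) {u : ι → ℝ} (hu : 0 ≤ u)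
    (hu0 : u ≠ 0) (h : M.mulVec u = u) (i : ι) : 0 < u i := by
  obtain ⟨j, hj⟩ := Function.ne_iff.1 hu0
  obtain ⟨n, -, hn⟩ := hirr i j
  have h1 : (M ^ n) i j * u j ≤ u i := by
    conv_rhs => rw [← pow_mulVec_of_mulVec_eq h n]
    exact Finset.single_le_sum (f := fun k => (M ^ n) i k * u k)
      (fun k _ => mul_nonneg (pow_nonneg_of_nonneg hM n i k) (hu k)) (Finset.mem_univ j)
  exact (mul_pos hn (lt_of_le_of_ne (hu j) (Ne.symm hj))).trans_le h1

open Filter in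
/-- An irreducible nonnegative matrix with subexponentially growing powers does not expand any
nonnegative vector by a factor larger than one, coordinate by coordinate. -/
theorem not_expanding {M : Matrix ι ι ℝ} (hM : ∀ i j, 0 ≤ M i j)
    (hgrow : ∀ r : ℝ, 1 < r → ∀ᶠ n : ℕ in atTop, ∀ i j, (M ^ n) i j ≤ r ^ n)
    {u : ι → ℝ} (hu : 0 ≤ u) {ε : ℝ} (hε : 0 < ε) (h : (1 + ε) • u ≤ M.mulVec u) : u = 0 := by
  by_contra hu0
  obtain ⟨j, hj⟩ := Function.ne_iff.1 hu0
  have hj : 0 < u j := lt_of_le_of_ne (hu j) (Ne.symm hj)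
  have hpow : ∀ n : ℕ, (1 + ε) ^ n • u ≤ (M ^ n).mulVec u := by
    intro n
    induction n with
    | zero => simp
    | succ n ih =>
      calc (1 + ε) ^ (n + 1) • u = (1 + ε) ^ n • ((1 + ε) • u) := by rw [smul_smul, pow_succ]
        _ ≤ (1 + ε) ^ n • M.mulVec u := smul_le_smul_of_nonneg_left h (by positivity)
        _ = M.mulVec ((1 + ε) ^ n • u) := (Matrix.mulVec_smul _ _ _).symm
        _ ≤ M.mulVec ((M ^ n).mulVec u) := mulVec_mono hM ih
        _ = _ := by rw [Matrix.mulVec_mulVec, pow_succ']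
  have hr : 1 < (1 + ε) / (1 + ε / 2) := by
    rw [one_lt_div (by positivity)]; linarith
  have hlim := tendsto_pow_atTop_atTop_of_one_lt hr
  obtain ⟨n, hn1, hn2⟩ := ((hgrow (1 + ε / 2) (by linarith)).and
    (hlim.eventually_gt_atTop ((∑ k, u k) / u j))).exists
  have h1 : (1 + ε) ^ n * u j ≤ (1 + ε / 2) ^ n * ∑ k, u k := by
    refine (hpow n j).trans ?_
    rw [Finset.mul_sum]
    exact Finset.sum_le_sum fun k _ => mul_le_mul_of_nonneg_right (hn1 j k) (hu k)
  rw [div_pow, div_lt_div_iff₀ hj (by positivity)] at hn2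
  linarith

open Filter in
/-- Under subexponential growth of the powers of an irreducible nonnegative matrix, subinvariant
nonnegative vectors are invariant: otherwise a positive combination of powers of the matrix would
turn the vector into one which is expanded by a factor larger than one. -/
theorem mulVec_eq_of_le {M : Matrix ι ι ℝ} (hM : ∀ i j, 0 ≤ M i j)
    (hirr : ∀ i j, ∃ n : ℕ, 1 ≤ n ∧ 0 < (M ^ n) i j)
    (hgrow : ∀ r : ℝ, 1 < r → ∀ᶠ n : ℕ in atTop, ∀ i j, (M ^ n) i j ≤ r ^ n)
    {u : ι → ℝ} (hu : 0 ≤ u) (h : u ≤ M.mulVec u) : M.mulVec u = u := by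
  by_contra hne
  choose n _ hn using hirr
  set N := (∑ i, ∑ j, n i j) + 1 with hN
  have hnN : ∀ i j, n i j ∈ Finset.range N := by
    intro i j
    have h1 : n i j ≤ ∑ j, n i j :=
      Finset.single_le_sum (f := fun j => n i j) (fun _ _ => Nat.zero_le _) (Finset.mem_univ j)
    have h2 : ∑ j, n i j ≤ ∑ i, ∑ j, n i j :=
      Finset.single_le_sum (f := fun i => ∑ j, n i j) (fun _ _ => Nat.zero_le _) (Finset.mem_univ i)
    simp only [Finset.mem_range, hN]
    omega
  -- A sum of powers of `M` all of whose entries are positive; `S u` is strictly expanded by `M`.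
  set S : Matrix ι ι ℝ := ∑ k ∈ Finset.range N, M ^ k with hS
  have hSpos : ∀ i j, 0 < S i j := by
    intro i j
    rw [hS, Matrix.sum_apply]
    exact (hn i j).trans_le (Finset.single_le_sum (f := fun k => (M ^ k) i j)
      (fun k _ => pow_nonneg_of_nonneg hM k i j) (hnN i j))
  set d : ι → ℝ := M.mulVec u - u with hd
  have hd0 : 0 ≤ d := sub_nonneg.2 h
  obtain ⟨j₀, hj₀⟩ := Function.ne_iff.1 (sub_ne_zero.2 hne)
  have hSd : ∀ i, 0 < S.mulVec d i := fun i =>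
    Finset.sum_pos' (fun k _ => mul_nonneg (hSpos i k).le (hd0 k))
      ⟨j₀, Finset.mem_univ _, mul_pos (hSpos i j₀) (lt_of_le_of_ne (hd0 j₀) (Ne.symm hj₀))⟩
  have hcomm : M * S = S * M := by
    rw [hS, Finset.mul_sum, Finset.sum_mul]
    exact Finset.sum_congr rfl fun k _ => by rw [← pow_succ, ← pow_succ']
  have hMS : M.mulVec (S.mulVec u) = S.mulVec u + S.mulVec d := by
    rw [Matrix.mulVec_mulVec, hcomm, ← Matrix.mulVec_mulVec, ← Matrix.mulVec_add, hd]
    congr 1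
    abel
  have hSu : 0 ≤ S.mulVec u := fun i =>
    Finset.sum_nonneg fun k _ => mul_nonneg (hSpos i k).le (hu k)
  have hne : Nonempty ι := ⟨j₀⟩
  obtain ⟨i₁, hi₁⟩ := Finite.exists_min (S.mulVec d)
  obtain ⟨i₂, hi₂⟩ := Finite.exists_max (S.mulVec u)
  have hε : 0 < S.mulVec d i₁ / (S.mulVec u i₂ + 1) := by
    have := hSu i₂
    have := hSd i₁
    simp only [Pi.zero_apply] at *
    positivity
  have h0 := not_expanding hM hgrow hSu hε fun i => by
    rw [hMS]
    simp only [Pi.smul_apply, smul_eq_mul, Pi.add_apply, add_mul, one_mul]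
    have h1 : S.mulVec d i₁ / (S.mulVec u i₂ + 1) * S.mulVec u i ≤ S.mulVec d i₁ := by
      rw [div_mul_eq_mul_div, div_le_iff₀ (by
        have := hSu i₂; simp only [Pi.zero_apply] at this; linarith)]
      have := hi₂ i
      have := hSd i₁
      nlinarith
    linarith [hi₁ i]
  have h2 := congrFun hMS i₁
  rw [h0] at h2
  simp only [Matrix.mulVec_zero, Pi.zero_apply, Pi.add_apply, zero_add] at h2
  exact (hSd i₁).ne h2

open Filter in
/-- Perron-Frobenius: an eigenvector for the eigenvalue one is positive up to sign. -/
theorem pos_or_neg_of_mulVec_eq {M : Matrix ι ι ℝ} (hM : ∀ i j, 0 ≤ M i j)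
    (hirr : ∀ i j, ∃ n : ℕ, 1 ≤ n ∧ 0 < (M ^ n) i j)
    (hgrow : ∀ r : ℝ, 1 < r → ∀ᶠ n : ℕ in atTop, ∀ i j, (M ^ n) i j ≤ r ^ n)
    {u : ι → ℝ} (hu0 : u ≠ 0) (h : M.mulVec u = u) : (∀ i, 0 < u i) ∨ ∀ i, u i < 0 := by
  have habs : M.mulVec |u| = |u| := by
    refine mulVec_eq_of_le hM hirr hgrow (abs_nonneg u) fun i => ?_
    calc |u| i = |M.mulVec u i| := by rw [h]; rfl
      _ ≤ ∑ j, |M i j * u j| := Finset.abs_sum_le_sum_abs _ _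
      _ = _ := Finset.sum_congr rfl fun j _ => by rw [abs_mul, abs_of_nonneg (hM i j)]; rfl
  by_cases h1 : |u| + u = 0
  · right
    have hpos := pos_of_mulVec_eq hM hirr (abs_nonneg u) (by simpa using hu0) habs
    intro i
    have h2 := congrFun h1 i
    have h3 := hpos i
    simp only [Pi.add_apply, Pi.zero_apply] at h2
    linarith
  by_cases h2 : |u| - u = 0
  · left
    have hpos := pos_of_mulVec_eq hM hirr (abs_nonneg u) (by simpa using hu0) habs
    intro i
    have h4 := congrFun h2 i
    have h3 := hpos i
    simp only [Pi.sub_apply, Pi.zero_apply] at h4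
    linarith
  · left
    intro i
    have h3 := pos_of_mulVec_eq hM hirr (u := |u| + u)
      (fun i => by
        have := neg_abs_le (u i)
        simp only [Pi.zero_apply, Pi.add_apply, Pi.abs_apply]
        linarith)
      h1 (by rw [Matrix.mulVec_add, habs, h]) i
    have h4 := pos_of_mulVec_eq hM hirr (u := |u| - u)
      (fun i => by
        have := le_abs_self (u i)
        simp only [Pi.zero_apply, Pi.sub_apply, Pi.abs_apply]
        linarith)
      h2 (by rw [Matrix.mulVec_sub, habs, h]) i
    simp only [Pi.add_apply, Pi.sub_apply, Pi.abs_apply] at h3 h4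
    rcases abs_cases (u i) with ⟨h5, _⟩ | ⟨h5, _⟩ <;> linarith

/-- Perron-Frobenius theorem for a pair of left and right eigenvectors for the eigenvalue one,
with the normalization `∑ a = ∑ a b = 1`. -/
theorem eigenvectors_pos {M : Matrix ι ι ℝ} (hM : ∀ i j, 0 ≤ M i j)
    (hirr : ∀ i j, ∃ n : ℕ, 1 ≤ n ∧ 0 < (M ^ n) i j)
    (hrad : spectralRadius ℂ (M.map (algebraMap ℝ ℂ)) ≤ 1) {a b : ι → ℝ}
    (ha : Matrix.vecMul a M = a) (hb : M.mulVec b = b) (ha1 : ∑ j, a j = 1)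
    (hab : ∑ j, a j * b j = 1) : (∀ i, 0 < a i) ∧ ∀ i, 0 < b i := by
  have hgrow := fun r (hr : (1 : ℝ) < r) => eventually_pow_le_of_spectralRadius_le_one M hrad hr
  have hapos : ∀ i, 0 < a i := by
    have ha0 : a ≠ 0 := by rintro rfl; simp at ha1
    rcases pos_or_neg_of_mulVec_eq (M := M.transpose) (fun i j => hM j i)
      (fun i j => by simpa [← Matrix.transpose_pow] using hirr j i)
      (fun r hr => (hgrow r hr).mono fun n hn i j => by simpa [← Matrix.transpose_pow] using hn j i)
      ha0 (by rw [Matrix.mulVec_transpose, ha]) with h | h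
    · exact h
    · have := Finset.sum_nonpos fun i (_ : i ∈ Finset.univ) => (h i).le
      linarith
  refine ⟨hapos, ?_⟩
  have hb0 : b ≠ 0 := by rintro rfl; simp at hab
  rcases pos_or_neg_of_mulVec_eq hM hirr hgrow hb0 hb with h | h
  · exact h
  · have := Finset.sum_nonpos fun i (_ : i ∈ Finset.univ) =>
      mul_nonpos_of_nonneg_of_nonpos (hapos i).le (h i).le
    linarith

end PerronFrobenius

/-! ### The mean matrix -/

section MeanMatrix

variable {K : ℕ} (ζ : Fin K → PMF (List (Fin K)))

theorem tsum_mul_map {α β : Type} (p : PMF α) (f : α → β) (F : β → ℝ≥0∞) :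
    ∑' y, F y * p.map f y = ∑' x, p x * F (f x) := by
  classical
  simp only [PMF.map_apply, ← ENNReal.tsum_mul_left]
  rw [ENNReal.tsum_comm]
  refine tsum_congr fun x => ?_
  rw [tsum_eq_single (f x)]
  · simp [mul_comm]
  · intro y hy
    simp [hy]

theorem tsum_mul_unordered (i : Fin K) (F : (Fin K → ℕ) → ℝ≥0∞) :
    ∑' z, F z * unordered ζ i z = ∑' w, ζ i w * F (typeCount w) :=
  tsum_mul_map (ζ i) typeCount F

theorem sum_typeCount_mul (w : List (Fin K)) (g : Fin K → ℝ≥0∞) :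
    ∑ k, (typeCount w k : ℝ≥0∞) * g k = (w.map g).sum := by
  induction w with
  | nil => simp [typeCount]
  | cons j w ih =>
    simp only [typeCount, List.count_cons] at ih ⊢
    simp [add_mul, Finset.sum_add_distrib, ih, add_comm]

theorem sum_typeCount (w : List (Fin K)) : ∑ k, typeCount w k = w.length := by
  have := sum_typeCount_mul w (fun _ => 1)
  simp only [mul_one, List.map_const', List.sum_replicate, nsmul_eq_mul] at this
  exact_mod_cast this

theorem tsum_mul_sum_map (j : Fin K) (g : Fin K → ℝ≥0∞) :
    ∑' w, ζ j w * (w.map g).sum = ∑ k, meanMatrix (unordered ζ) j k * g k := by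
  simp only [← sum_typeCount_mul]
  rw [← tsum_mul_unordered ζ j fun z => ∑ k, (z k : ℝ≥0∞) * g k]
  simp only [Finset.sum_mul, meanMatrix, Matrix.of_apply, ← ENNReal.tsum_mul_right]
  rw [Summable.tsum_finsetSum fun _ _ => ENNReal.summable]
  refine Finset.sum_congr rfl fun k _ => tsum_congr fun z => by ring

theorem tsum_mul_length (j : Fin K) :
    ∑' w, ζ j w * (w.length : ℝ≥0∞) = ∑ k, meanMatrix (unordered ζ) j k := by
  have := tsum_mul_sum_map ζ j fun _ => 1
  simpa using this

/-- A property of types which passes from `j` to all the types of possible children of `j`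
holds for all types if it holds for one, by irreducibility. -/
theorem forall_of_irreducible {m : Matrix (Fin K) (Fin K) ℝ≥0∞}
    (hirr : ∀ i j, ∃ n : ℕ, 1 ≤ n ∧ 0 < (m ^ n) i j) {P : Fin K → Prop} {i : Fin K} (hi : P i)
    (hP : ∀ j k, P j → m j k ≠ 0 → P k) (k : Fin K) : P k := by
  obtain ⟨n, -, hn⟩ := hirr i k
  suffices ∀ n k, (m ^ n) i k ≠ 0 → P k from this n k hn.ne'
  intro n
  induction n with
  | zero =>
    intro k hk
    rw [pow_zero, Matrix.one_apply] at hk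
    split_ifs at hk with h
    · exact h ▸ hi
    · exact absurd rfl hk
  | succ n ih =>
    intro k hk
    rw [pow_succ, Matrix.mul_apply] at hk
    obtain ⟨l, -, hl⟩ := Finset.exists_ne_zero_of_sum_ne_zero hk
    exact hP l k (ih l (left_ne_zero_of_mul hl)) (right_ne_zero_of_mul hl)

theorem sum_mul_mulVec {m : Matrix (Fin K) (Fin K) ℝ≥0∞} {A : Fin K → ℝ≥0∞}
    (hA : ∀ k, ∑ j, A j * m j k = A k) (g : Fin K → ℝ≥0∞) :
    ∑ j, A j * ∑ k, m j k * g k = ∑ k, A k * g k := by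
  simp only [Finset.mul_sum]
  rw [Finset.sum_comm]
  refine Finset.sum_congr rfl fun k _ => ?_
  rw [← hA k, Finset.sum_mul]
  exact Finset.sum_congr rfl fun j _ => by ring

end MeanMatrix

/-! ### Almost sure finiteness of the trees -/

section Extinction

variable {K : ℕ} (ζ : Fin K → PMF (List (Fin K)))

theorem treeLaw_univ_eq (j : Fin K) :
    treeLaw ζ j Set.univ = ∑' w, ζ j w * (w.map fun k => treeLaw ζ k Set.univ).prod := by
  have h := lintegral_treeLaw ζ j fun _ => 1
  simp only [lintegral_one] at h
  rw [h]
  exact tsum_congr fun w => by rw [listLaw_univ]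

/-- The Weierstrass product inequality, which is strict as soon as there are two factors. -/
theorem one_le_sum_add_prod {d : Fin K → ℝ} (hd0 : ∀ k, 0 ≤ d k) (hd1 : ∀ k, d k ≤ 1)
    (w : List (Fin K)) :
    1 ≤ (w.map d).sum + (w.map fun k => 1 - d k).prod ∧ (w.map fun k => 1 - d k).prod ≤ 1 ∧
      0 ≤ (w.map fun k => 1 - d k).prod ∧
      ((∀ k, 0 < d k) → 2 ≤ w.length → 1 < (w.map d).sum + (w.map fun k => 1 - d k).prod) ∧
      ((∀ k, 0 < d k) → 1 ≤ w.length → (w.map fun k => 1 - d k).prod < 1) := by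
  induction w with
  | nil => simp
  | cons k w ih =>
    obtain ⟨h1, h2, h3, h4, h5⟩ := ih
    simp only [List.map_cons, List.sum_cons, List.prod_cons, List.length_cons]
    have := hd0 k
    have := hd1 k
    refine ⟨by nlinarith, by nlinarith, by nlinarith, fun hp hw => ?_, fun hp _ => ?_⟩
    · have := h5 hp (by omega)
      have := hp k
      nlinarith
    · have := hp k
      nlinarith

/-- A nondegenerate irreducible Galton-Watson tree whose mean matrix has a positive left
eigenvector for the eigenvalue one is almost surely finite: the measures `P^{(j)}` have total
mass one. If `d j` is the defect of the total mass, then `d ≤ M d` by the Weierstrass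
inequality, and pairing with the left eigenvector gives equality everywhere. -/
theorem isProbabilityMeasure_treeLaw
    (hirr : IsIrreducible (unordered ζ)) (hnd : IsNondegenerate (unordered ζ))
    {A : Fin K → ℝ≥0∞} (hA : ∀ k, ∑ j, A j * meanMatrix (unordered ζ) j k = A k)
    (hA0 : ∀ j, A j ≠ 0) (hAt : ∀ j, A j ≠ ∞) (j : Fin K) :
    IsProbabilityMeasure (treeLaw ζ j) := by
  set m := meanMatrix (unordered ζ) with hm
  set q : Fin K → ℝ≥0∞ := fun j => treeLaw ζ j Set.univ with hq
  have hq1 : ∀ j, q j ≤ 1 := treeLaw_univ_le_one ζ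
  have hqt : ∀ j, q j ≠ ∞ := fun j => ((hq1 j).trans_lt ENNReal.one_lt_top).ne
  set d : Fin K → ℝ≥0∞ := fun j => 1 - q j with hd
  have hdt : ∀ j, d j ≠ ∞ := fun j => by simp [hd]
  have hdr : ∀ j, (q j).toReal = 1 - (d j).toReal := fun j => by
    rw [hd, ENNReal.toReal_sub_of_le (hq1 j) ENNReal.one_ne_top]; simp
  -- The excess in the Weierstrass inequality for the word `w`.
  set e : List (Fin K) → ℝ≥0∞ := fun w => (w.map d).sum + (w.map q).prod - 1 with he
  have hsum : ∀ w : List (Fin K),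
      (w.map d).sum = ENNReal.ofReal (w.map fun k => (d k).toReal).sum := by
    intro w
    induction w with
    | nil => simp
    | cons k w ih =>
      simp only [List.map_cons, List.sum_cons, ih]
      rw [ENNReal.ofReal_add ENNReal.toReal_nonneg (List.sum_nonneg (by simp)),
        ENNReal.ofReal_toReal (hdt k)]
  have hprod : ∀ w : List (Fin K),
      (w.map q).prod = ENNReal.ofReal (w.map fun k => 1 - (d k).toReal).prod := by
    intro w
    induction w with
    | nil => simp
    | cons k w ih =>
      simp only [List.map_cons, List.prod_cons, ih]
      rw [ENNReal.ofReal_mul (by rw [← hdr]; exact ENNReal.toReal_nonneg), ← hdr,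
        ENNReal.ofReal_toReal (hqt k)]
  have hW := one_le_sum_add_prod (d := fun k => (d k).toReal) (fun k => ENNReal.toReal_nonneg)
    (fun k => by have := hdr k; have : 0 ≤ (q k).toReal := ENNReal.toReal_nonneg; linarith)
  have hsp : ∀ w : List (Fin K), (w.map d).sum + (w.map q).prod = ENNReal.ofReal
      ((w.map fun k => (d k).toReal).sum + (w.map fun k => 1 - (d k).toReal).prod) := by
    intro w
    rw [hsum, hprod, ENNReal.ofReal_add (List.sum_nonneg (by simp)) (hW w).2.2.1]
  have hle : ∀ w : List (Fin K), 1 ≤ (w.map d).sum + (w.map q).prod := by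
    intro w
    rw [hsp, ENNReal.one_le_ofReal]
    exact (hW w).1
  have h1e : ∀ w : List (Fin K), 1 + e w = (w.map d).sum + (w.map q).prod := fun w =>
    add_tsub_cancel_of_le (hle w)
  have hdq : ∀ j, d j + q j = 1 := fun j => tsub_add_cancel_of_le (hq1 j)
  set E : Fin K → ℝ≥0∞ := fun j => ∑' w, ζ j w * e w with hE
  have hdE : ∀ j, d j + E j = ∑ k, m j k * d k := by
    intro j
    have h1 : ∑' w, ζ j w * (1 + e w) = ∑' w, ζ j w * ((w.map d).sum + (w.map q).prod) := by
      simp only [h1e]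
    simp only [mul_add, mul_one, ENNReal.tsum_add, PMF.tsum_coe] at h1
    rw [tsum_mul_sum_map, ← treeLaw_univ_eq, ← hdq j, add_right_comm] at h1
    exact (ENNReal.add_left_inj (hqt j)).1 h1
  have hE0 : ∀ j, E j = 0 := by
    have h1 := sum_mul_mulVec hA d
    simp only [← hdE, mul_add, Finset.sum_add_distrib] at h1
    have h2 : ∑ j, A j * d j ≠ ∞ :=
      ENNReal.sum_ne_top.2 fun j _ => ENNReal.mul_ne_top (hAt j) (hdt j)
    have h3 : ∑ j, A j * E j = 0 := by
      rw [← ENNReal.add_right_inj h2, h1, add_zero]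
    intro j
    have := (Finset.sum_eq_zero_iff.1 h3) j (Finset.mem_univ j)
    exact (mul_eq_zero.1 this).resolve_left (hA0 j)
  have hd_all : ∀ j, d j = 0 → ∀ k, d k = 0 := by
    intro j hj
    refine forall_of_irreducible hirr (P := fun k => d k = 0) hj fun k l hk hkl => ?_
    have := hdE k
    rw [hk, hE0, add_zero] at this
    have := (Finset.sum_eq_zero_iff.1 this.symm) l (Finset.mem_univ l)
    exact (mul_eq_zero.1 this).resolve_left hkl
  constructor
  by_contra hj
  have hdj : d j ≠ 0 := fun h => hj (by have := hdq j; rwa [h, zero_add] at this)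
  have hdpos : ∀ k, 0 < (d k).toReal := fun k =>
    ENNReal.toReal_pos (fun h => hdj (hd_all k h j)) (hdt k)
  have hlen : ∀ j w, ζ j w ≠ 0 → w.length ≤ 1 := by
    intro j w hw
    by_contra hlt
    have h1 := (hW w).2.2.2.1 hdpos (by omega)
    have h2 : e w = 0 := by
      have := hE0 j
      rw [hE, ENNReal.tsum_eq_zero] at this
      exact (mul_eq_zero.1 (this w)).resolve_left hw
    have h3 := h1e w
    rw [h2, add_zero, hsp, eq_comm, ENNReal.ofReal_eq_one] at h3
    linarith
  -- The word of the children has at most one letter, so exactly one by criticality.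
  have hrow : ∀ j, ∑ k, m j k + ∑' w, ζ j w * (1 - w.length : ℝ≥0∞) = 1 := by
    intro j
    rw [← tsum_mul_length, ← ENNReal.tsum_add]
    refine Eq.trans (tsum_congr fun w => ?_) (PMF.tsum_coe (ζ j))
    by_cases hw : ζ j w = 0
    · simp [hw]
    · rw [← mul_add, add_tsub_cancel_of_le (by exact_mod_cast hlen j w hw), mul_one]
  have hzero : ∀ j, ∑' w, ζ j w * (1 - w.length : ℝ≥0∞) = 0 := by
    have h1 := sum_mul_mulVec hA fun _ => 1
    simp only [mul_one] at h1
    have h2 : ∑ j, A j ≠ ∞ := ENNReal.sum_ne_top.2 fun j _ => hAt j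
    have h3 : ∑ j, A j * ∑' w, ζ j w * (1 - w.length : ℝ≥0∞) = 0 := by
      rw [← ENNReal.add_right_inj h2, add_zero]
      nth_rewrite 1 [← h1]
      rw [← Finset.sum_add_distrib]
      simp only [← mul_add, hrow, mul_one]
    intro j
    have := (Finset.sum_eq_zero_iff.1 h3) j (Finset.mem_univ j)
    exact (mul_eq_zero.1 this).resolve_left (hA0 j)
  obtain ⟨i, hi⟩ := hnd
  refine hi.ne' ?_
  rw [PMF.toOuterMeasure_apply_eq_zero_iff, Set.disjoint_left]
  intro z hz hz1
  rw [unordered, PMF.mem_support_map_iff] at hz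
  obtain ⟨w, hw, rfl⟩ := hz
  rw [PMF.mem_support_iff] at hw
  have hz1 : w.length ≠ 1 := by rw [← sum_typeCount]; exact hz1
  have h1 := ENNReal.tsum_eq_zero.1 (hzero i) w
  have h2 := (mul_eq_zero.1 h1).resolve_left hw
  have h3 : 1 ≤ w.length := by exact_mod_cast tsub_eq_zero_iff_le.1 h2
  have := hlen i w hw
  omega

end Extinction

/-! ### Recursive description of the reduction -/

section Recursion

variable {K : ℕ} (i : Fin K)

theorem floorList_eq (l : List (PTree (Fin K))) : floorList i l = (l.map (floorTree i)).sum := by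
  induction l with
  | nil => simp [floorList]
  | cons t l ih => simp [floorList, ih]

theorem reduceList_eq (l : List (PTree (Fin K))) : reduceList i l = l.flatMap (reduceTree i) := by
  induction l with
  | nil => simp [reduceList]
  | cons t l ih => simp [reduceList, ih]

theorem floorTree_node_self (l : List (PTree (Fin K))) : floorTree i (.node i l) = 0 := by
  simp [floorTree]

theorem floorTree_node_of_ne {j : Fin K} (h : j ≠ i) (l : List (PTree (Fin K))) :
    floorTree i (.node j l) = 1 + (l.map (floorTree i)).sum := by
  simp [floorTree, h, floorList_eq]

theorem reduceTree_node_self (l : List (PTree (Fin K))) :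
    reduceTree i (.node i l) = [.node (.node i l) (reduceList i l)] := by
  simp [reduceTree]

theorem reduceTree_node_of_ne {j : Fin K} (h : j ≠ i) (l : List (PTree (Fin K))) :
    reduceTree i (.node j l) = reduceList i l := by
  simp [reduceTree, h]

/-- The number of components of the reduced forest of a tree. -/
def rootCount (t : PTree (Fin K)) : ℕ := (reduceTree i t).length

theorem length_reduceList (l : List (PTree (Fin K))) :
    (reduceList i l).length = (l.map (rootCount i)).sum := by
  rw [reduceList_eq, List.length_flatMap]
  rfl

theorem rootCount_node_self (l : List (PTree (Fin K))) : rootCount i (.node i l) = 1 := by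
  simp [rootCount, reduceTree_node_self]

theorem rootCount_node_of_ne {j : Fin K} (h : j ≠ i) (l : List (PTree (Fin K))) :
    rootCount i (.node j l) = (l.map (rootCount i)).sum := by
  rw [rootCount, reduceTree_node_of_ne i h, length_reduceList]

theorem deletedBelow_node (j : Fin K) (l : List (PTree (Fin K))) :
    deletedBelow i (.node j l) = (l.map (floorTree i)).sum := by
  simp [deletedBelow, floorList_eq]

theorem reducedRootCount_node (j : Fin K) (l : List (PTree (Fin K))) :
    reducedRootCount i (.node j l) = (l.map (rootCount i)).sum := by
  by_cases h : j = i
  · subst h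
    simp [reducedRootCount, reduceTree_node_self, length_reduceList]
  · simp [reducedRootCount, h, reduceTree_node_of_ne i h, length_reduceList]

/-- The number of vertices of a tree that remain when everything below the first type-`i`
vertices is removed. -/
def prunedSize (t : PTree (Fin K)) : ℕ := floorTree i t + rootCount i t

theorem prunedSize_node_self (l : List (PTree (Fin K))) : prunedSize i (.node i l) = 1 := by
  simp [prunedSize, rootCount_node_self, floorTree_node_self]

theorem prunedSize_node_of_ne {j : Fin K} (h : j ≠ i) (l : List (PTree (Fin K))) :
    prunedSize i (.node j l) = 1 + (l.map (prunedSize i)).sum := by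
  have : (l.map (prunedSize i)).sum = (l.map (floorTree i)).sum + (l.map (rootCount i)).sum :=
    List.sum_map_add
  rw [this, prunedSize, floorTree_node_of_ne i h, rootCount_node_of_ne i h, add_assoc]

/-- The number of vertices strictly below the root that remain when everything below the first
type-`i` vertices other than the root is removed. -/
def prunedBelow (t : PTree (Fin K)) : ℕ := (t.children.map (prunedSize i)).sum

theorem deletedBelow_le (t : PTree (Fin K)) : deletedBelow i t ≤ prunedBelow i t := by
  rw [← t.node_label_children, deletedBelow_node]
  exact List.sum_le_sum fun _ _ => Nat.le_add_right _ _

theorem reducedRootCount_le (t : PTree (Fin K)) : reducedRootCount i t ≤ prunedBelow i t := by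
  rw [← t.node_label_children, reducedRootCount_node]
  exact List.sum_le_sum fun _ _ => Nat.le_add_left _ _

theorem prunedSize_le (t : PTree (Fin K)) : prunedSize i t ≤ 1 + prunedBelow i t := by
  rw [← t.node_label_children]
  by_cases h : t.label = i
  · rw [h, prunedSize_node_self]; omega
  · rw [prunedSize_node_of_ne i h]; rfl

theorem floorTree_le (t : PTree (Fin K)) : floorTree i t ≤ 1 + prunedBelow i t :=
  (Nat.le_add_right _ _).trans (prunedSize_le i t)

theorem rootCount_le (t : PTree (Fin K)) : rootCount i t ≤ 1 + prunedBelow i t :=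
  (Nat.le_add_left _ _).trans (prunedSize_le i t)

theorem cast_sum_map {α : Type} (l : List α) (f : α → ℕ) :
    (((l.map f).sum : ℕ) : ℝ≥0∞) = (l.map fun t => (f t : ℝ≥0∞)).sum := by
  rw [Nat.cast_list_sum, List.map_map]; rfl

end Recursion

/-! ### Vectors which are supersolutions of the recursion killed at type `i` -/

section Killed

variable {K : ℕ}

/-- The Green function of the mean matrix killed at `i` is finite: there is a finite vector `v`
with `v j = 1 + ∑ k ≠ i, m j k * v k`.  Pairing the partial sums with the left eigenvector `A`
shows that `A i * v i ≤ 1`, and finiteness propagates by irreducibility. -/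
theorem exists_killed_supersolution {m : Matrix (Fin K) (Fin K) ℝ≥0∞}
    (hirr : ∀ i j, ∃ n : ℕ, 1 ≤ n ∧ 0 < (m ^ n) i j) (hm : ∀ i j, m i j ≠ ∞)
    {A : Fin K → ℝ≥0∞} (hA : ∀ k, ∑ j, A j * m j k = A k)
    (hA0 : ∀ j, A j ≠ 0) (hA1 : ∑ j, A j = 1) (i : Fin K) :
    ∃ v : Fin K → ℝ≥0∞, (∀ j, v j ≠ ∞) ∧
      ∀ j, v j = 1 + ∑ k, m j k * (if k = i then 0 else v k) := by
  -- The partial sums of the Green function, obtained by iterating the recursion from zero.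
  obtain ⟨u, hu0, hu⟩ : ∃ u : ℕ → Fin K → ℝ≥0∞, u 0 = (fun _ => 0) ∧
      ∀ n j, u (n + 1) j = 1 + ∑ k, m j k * (if k = i then 0 else u n k) :=
    ⟨fun n => Nat.rec (fun _ => 0)
      (fun _ u j => 1 + ∑ k, m j k * (if k = i then 0 else u k)) n, rfl, fun _ _ => rfl⟩
  have hAt : ∀ j, A j ≠ ∞ := fun j h => by
    have := Finset.single_le_sum (f := A) (fun _ _ => zero_le) (Finset.mem_univ j)
    rw [hA1, h] at this
    simp at this
  have hmono : Monotone u := by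
    refine monotone_nat_of_le_succ fun n => ?_
    induction n with
    | zero => rw [hu0]; exact fun j => zero_le
    | succ n ih =>
      intro j
      rw [hu, hu]
      gcongr with k
      split_ifs
      · exact le_rfl
      · exact ih k
  have hfin : ∀ n j, u n j ≠ ∞ := by
    intro n
    induction n with
    | zero => rw [hu0]; exact fun j => ENNReal.zero_ne_top
    | succ n ih =>
      intro j
      rw [hu]
      refine ENNReal.add_ne_top.2 ⟨ENNReal.one_ne_top, ENNReal.sum_ne_top.2 fun k _ =>
        ENNReal.mul_ne_top (hm j k) ?_⟩
      split_ifs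
      · exact ENNReal.zero_ne_top
      · exact ih k
  have hui : ∀ n, A i * u n i ≤ 1 := by
    intro n
    have h1 : ∑ j, A j * u (n + 1) j = 1 + ∑ k, A k * (if k = i then 0 else u n k) := by
      rw [← sum_mul_mulVec hA fun k => if k = i then 0 else u n k]
      simp only [hu, mul_add, mul_one, Finset.sum_add_distrib, hA1]
    have h2 : ∑ k, A k * (if k = i then 0 else u n k) ≤
        ∑ k ∈ Finset.univ.erase i, A k * u (n + 1) k := by
      rw [← Finset.add_sum_erase _ _ (Finset.mem_univ i)]
      simp only [if_true, mul_zero, zero_add]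
      refine Finset.sum_le_sum fun k hk => ?_
      rw [if_neg (Finset.ne_of_mem_erase hk)]
      gcongr
      exact hmono (Nat.le_succ n) k
    rw [← Finset.add_sum_erase _ _ (Finset.mem_univ i)] at h1
    have h3 : ∑ k ∈ Finset.univ.erase i, A k * u (n + 1) k ≠ ∞ :=
      ENNReal.sum_ne_top.2 fun k _ => ENNReal.mul_ne_top (hAt k) (hfin _ k)
    have h4 : A i * u (n + 1) i ≤ 1 := by
      rw [← ENNReal.add_le_add_iff_right h3, h1]
      gcongr
    exact le_trans (by gcongr; exact hmono (Nat.le_succ n) i) h4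
  set v : Fin K → ℝ≥0∞ := fun j => ⨆ n, u n j with hv
  have hveq : ∀ j, v j = 1 + ∑ k, m j k * (if k = i then 0 else v k) := by
    intro j
    have h1 : v j = ⨆ n, u (n + 1) j :=
      (Monotone.iSup_nat_add (f := fun n => u n j) (fun a b h => hmono h j) 1).symm
    rw [h1]
    simp only [hu]
    rw [← ENNReal.add_iSup, ← ENNReal.finsetSum_iSup_of_monotone]
    · congr 1
      refine Finset.sum_congr rfl fun k _ => ?_
      rw [← ENNReal.mul_iSup]
      split_ifs <;> simp [hv]
    · intro k a b hab
      dsimp only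
      gcongr
      split_ifs
      · exact le_rfl
      · exact hmono hab k
  refine ⟨v, ?_, hveq⟩
  refine forall_of_irreducible hirr (P := fun j => v j ≠ ∞) (i := i) ?_ fun j k hj hjk => ?_
  · have : A i * v i ≤ 1 := by
      rw [hv, ENNReal.mul_iSup]
      exact iSup_le hui
    intro h
    rw [h, ENNReal.mul_top (hA0 i)] at this
    simp at this
  · by_cases hk : k = i
    · subst hk
      have : A k * v k ≤ 1 := by
        rw [hv, ENNReal.mul_iSup]
        exact iSup_le hui
      intro h
      rw [h, ENNReal.mul_top (hA0 k)] at this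
      simp at this
    · intro h
      apply hj
      rw [hveq j, ENNReal.add_eq_top]
      right
      rw [ENNReal.sum_eq_top]
      exact ⟨k, Finset.mem_univ k, by rw [if_neg hk, h, ENNReal.mul_top hjk]⟩

end Killed

/-! ### Integer moments -/

section IntegerMoments

variable {K : ℕ} (ζ : Fin K → PMF (List (Fin K)))

theorem lintegral_listLaw_sum (hP : ∀ j, IsProbabilityMeasure (treeLaw ζ j))
    (f : PTree (Fin K) → ℝ≥0∞) (w : List (Fin K)) :
    ∫⁻ l, (l.map f).sum ∂(listLaw ζ w) = (w.map fun j => ∫⁻ t, f t ∂(treeLaw ζ j)).sum := by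
  have hL : ∀ w, listLaw ζ w Set.univ = 1 := fun w => by
    rw [listLaw_univ]; simp [measure_univ]
  induction w with
  | nil => simp
  | cons j w ih =>
    rw [lintegral_listLaw_cons]
    simp only [List.map_cons, List.sum_cons]
    have : ∀ t, ∫⁻ l, (f t + (l.map f).sum) ∂(listLaw ζ w) =
        f t + (w.map fun j => ∫⁻ t, f t ∂(treeLaw ζ j)).sum := by
      intro t
      rw [lintegral_add_left .of_discrete, lintegral_const, hL, mul_one, ih]
    simp only [this]
    rw [lintegral_add_left .of_discrete, lintegral_const, measure_univ, mul_one]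

/-- Moments of sums over lists of independent trees: if the moments of `f` of order less than `p`
are bounded, then the `p`-th moment of the sum is at most the sum of the `p`-th moments, up to an
error term of order `(length) ^ p`.  The `1 +` accounts for the root of the tree whose children
are listed. -/
theorem exists_moment_bound (hP : ∀ j, IsProbabilityMeasure (treeLaw ζ j)) (B : ℝ≥0∞)
    (hB : B ≠ ∞) (p : ℕ) :
    ∃ C : ℝ≥0∞, C ≠ ∞ ∧ ∀ f : PTree (Fin K) → ℝ≥0∞,
      (∀ r < p, ∀ j, ∫⁻ t, f t ^ r ∂(treeLaw ζ j) ≤ B) → ∀ w,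
      ∫⁻ l, (1 + (l.map f).sum) ^ p ∂(listLaw ζ w) ≤
        (w.map fun j => ∫⁻ t, f t ^ p ∂(treeLaw ζ j)).sum + C * (w.length + 1) ^ p := by
  have hL : ∀ w, listLaw ζ w Set.univ = 1 := fun w => by
    rw [listLaw_univ]; simp [measure_univ]
  induction p using Nat.strong_induction_on with
  | _ p IH =>
    rcases p with _ | n
    · refine ⟨1, ENNReal.one_ne_top, fun f _ w => ?_⟩
      simp [hL]
    choose! C hC hCb using IH
    -- A common constant for the moments of orders `1, …, n`.
    set D : ℝ≥0∞ := ∑ r ∈ Finset.range (n + 1), (B + C r) with hD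
    have hDt : D ≠ ∞ := ENNReal.sum_ne_top.2 fun r hr =>
      ENNReal.add_ne_top.2 ⟨hB, hC r (Finset.mem_range.1 hr)⟩
    set E : ℝ≥0∞ := ∑ q ∈ Finset.range n, B * D * ((n + 1).choose (q + 1) : ℝ≥0∞) with hE
    have hEt : E ≠ ∞ := ENNReal.sum_ne_top.2 fun q _ =>
      ENNReal.mul_ne_top (ENNReal.mul_ne_top hB hDt) (ENNReal.natCast_ne_top _)
    refine ⟨E + 1, ENNReal.add_ne_top.2 ⟨hEt, ENNReal.one_ne_top⟩, fun f hf w => ?_⟩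
    have hlow : ∀ r, 1 ≤ r → r ≤ n → ∀ w, ∫⁻ l, (1 + (l.map f).sum) ^ r ∂(listLaw ζ w) ≤
        D * (w.length + 1) ^ r := by
      intro r hr hrn w
      refine (hCb r (by omega) f (fun s hs => hf s (by omega)) w).trans ?_
      have h1 : (w.map fun j => ∫⁻ t, f t ^ r ∂(treeLaw ζ j)).sum ≤ B * (w.length + 1) ^ r := by
        calc (w.map fun j => ∫⁻ t, f t ^ r ∂(treeLaw ζ j)).sum
            ≤ (w.map fun _ => B).sum := List.sum_le_sum fun j _ => hf r (by omega) j
          _ = B * w.length := by simp [mul_comm]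
          _ ≤ B * (w.length + 1) ^ r := by
            gcongr
            exact (le_self_add).trans (le_self_pow₀ (by simp) (by omega))
      calc _ ≤ B * (w.length + 1) ^ r + C r * (w.length + 1) ^ r := by gcongr
        _ = (B + C r) * (w.length + 1) ^ r := by ring
        _ ≤ D * (w.length + 1) ^ r := by
          gcongr
          exact Finset.single_le_sum (f := fun r => B + C r) (fun _ _ => zero_le)
            (Finset.mem_range.2 (by omega))
    induction w with
    | nil => simp
    | cons j w ihw =>
      rw [lintegral_listLaw_cons]
      simp only [List.map_cons, List.sum_cons, List.length_cons, Nat.cast_add, Nat.cast_one]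
      have hexp : ∀ (x S : ℝ≥0∞), (1 + (x + S)) ^ (n + 1) =
          ∑ q ∈ Finset.range n, x ^ (q + 1) * (1 + S) ^ (n - q) *
            ((n + 1).choose (q + 1) : ℝ≥0∞) + (1 + S) ^ (n + 1) + x ^ (n + 1) := by
        intro x S
        rw [show 1 + (x + S) = x + (1 + S) by ring, add_pow, Finset.sum_range_succ,
          Finset.sum_range_succ']
        simp
      simp only [hexp]
      have hin : ∀ t, ∫⁻ l, (∑ q ∈ Finset.range n, f t ^ (q + 1) * (1 + (l.map f).sum) ^ (n - q) *
            ((n + 1).choose (q + 1) : ℝ≥0∞) + (1 + (l.map f).sum) ^ (n + 1) + f t ^ (n + 1))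
            ∂(listLaw ζ w) ≤
          ∑ q ∈ Finset.range n, f t ^ (q + 1) * (D * (w.length + 1) ^ n) *
            ((n + 1).choose (q + 1) : ℝ≥0∞) +
          ((w.map fun j => ∫⁻ t, f t ^ (n + 1) ∂(treeLaw ζ j)).sum +
            (E + 1) * (w.length + 1) ^ (n + 1)) + f t ^ (n + 1) := by
        intro t
        rw [lintegral_add_right _ .of_discrete, lintegral_add_right _ .of_discrete,
          lintegral_finsetSum _ fun _ _ => .of_discrete, lintegral_const, hL, mul_one]
        refine add_le_add (add_le_add (Finset.sum_le_sum fun q hq => ?_) ihw) le_rfl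
        rw [lintegral_mul_const _ .of_discrete, lintegral_const_mul _ .of_discrete]
        gcongr
        have hq' := Finset.mem_range.1 hq
        refine (hlow (n - q) (by omega) (by omega) w).trans ?_
        gcongr
        · simp
        · omega
      refine (lintegral_mono hin).trans ?_
      rw [lintegral_add_right _ .of_discrete, lintegral_add_right _ .of_discrete,
        lintegral_finsetSum _ fun _ _ => .of_discrete, lintegral_const, measure_univ, mul_one]
      have h2 : ∑ q ∈ Finset.range n, ∫⁻ t, f t ^ (q + 1) * (D * (w.length + 1) ^ n) *
            ((n + 1).choose (q + 1) : ℝ≥0∞) ∂(treeLaw ζ j) ≤ (E + 1) * (w.length + 1) ^ n := by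
        calc _ ≤ ∑ q ∈ Finset.range n, (B * D * ((n + 1).choose (q + 1) : ℝ≥0∞)) *
                (w.length + 1) ^ n := by
              refine Finset.sum_le_sum fun q hq => ?_
              rw [lintegral_mul_const _ .of_discrete, lintegral_mul_const _ .of_discrete]
              calc _ ≤ B * (D * (w.length + 1) ^ n) * ((n + 1).choose (q + 1) : ℝ≥0∞) := by
                    gcongr
                    exact hf (q + 1) (by have := Finset.mem_range.1 hq; omega) j
                _ = _ := by ring
          _ = E * (w.length + 1) ^ n := by rw [← Finset.sum_mul]
          _ ≤ _ := by gcongr; exact le_self_add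
      set I := ∫⁻ t, f t ^ (n + 1) ∂(treeLaw ζ j)
      set J := (w.map fun j => ∫⁻ t, f t ^ (n + 1) ∂(treeLaw ζ j)).sum
      set N : ℝ≥0∞ := (w.length : ℝ≥0∞)
      calc _ ≤ (E + 1) * (N + 1) ^ n + (J + (E + 1) * (N + 1) ^ (n + 1)) + I := by gcongr
        _ = I + J + (E + 1) * ((N + 1) ^ n * (N + 1 + 1)) := by ring
        _ ≤ I + J + (E + 1) * (N + 1 + 1) ^ (n + 1) := by
          rw [pow_succ]
          gcongr
          exact le_self_add

end IntegerMoments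

/-! ### Moments of the pruned tree -/

section PrunedMoments

variable {K : ℕ} (ζ : Fin K → PMF (List (Fin K)))

theorem tsum_mul_length_add_one_pow_ne_top {p : ℕ} (h : HasMoment (unordered ζ) p) (j : Fin K) :
    ∑' w, ζ j w * ((w.length : ℝ≥0∞) + 1) ^ p ≠ ∞ := by
  have h1 := (h j).ne
  rw [tsum_mul_unordered ζ j fun z => ((∑ j, z j : ℕ) : ℝ≥0∞) ^ p] at h1
  simp only [sum_typeCount] at h1
  have h2 : ∀ n : ℕ, ((n : ℝ≥0∞) + 1) ^ p ≤ 2 ^ p * ((n : ℝ≥0∞) ^ p + 1) := by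
    intro n
    rcases n with _ | n
    · simpa using (one_le_pow₀ (by norm_num : (1 : ℝ≥0∞) ≤ 2)).trans le_add_self |>.trans_eq
        (by ring : (0 : ℝ≥0∞) ^ p * 2 ^ p + 2 ^ p = 2 ^ p * (0 ^ p + 1))
    · calc (((n + 1 : ℕ) : ℝ≥0∞) + 1) ^ p ≤ (2 * ((n + 1 : ℕ) : ℝ≥0∞)) ^ p := by
            gcongr
            rw [two_mul]
            gcongr
            exact_mod_cast Nat.le_add_left 1 n
        _ ≤ _ := by rw [mul_pow]; gcongr; exact le_self_add
  refine ne_top_of_le_ne_top ?_ (ENNReal.tsum_le_tsum fun w => mul_le_mul_right (h2 w.length) _)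
  have h3 : ∀ w : List (Fin K), ζ j w * (2 ^ p * ((w.length : ℝ≥0∞) ^ p + 1)) =
      2 ^ p * (ζ j w * (w.length : ℝ≥0∞) ^ p + ζ j w) := fun w => by ring
  simp only [h3, ENNReal.tsum_mul_left, ENNReal.tsum_add, PMF.tsum_coe]
  exact ENNReal.mul_ne_top (by simp) (ENNReal.add_ne_top.2 ⟨h1, ENNReal.one_ne_top⟩)

/-- The integer moments of the offspring distributions are inherited by the number of vertices of
the tree pruned at its first type-`i` vertices. -/
theorem lintegral_prunedSize_pow_ne_top (hP : ∀ j, IsProbabilityMeasure (treeLaw ζ j))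
    (hm : ∀ j k, meanMatrix (unordered ζ) j k ≠ ∞) (i : Fin K) {v : Fin K → ℝ≥0∞}
    (hvt : ∀ j, v j ≠ ∞)
    (hv : ∀ j, v j = 1 + ∑ k, meanMatrix (unordered ζ) j k * (if k = i then 0 else v k))
    (p : ℕ) (hmom : ∀ j, ∑' w, ζ j w * ((w.length : ℝ≥0∞) + 1) ^ p ≠ ∞) (j : Fin K) :
    ∫⁻ t, (prunedSize i t : ℝ≥0∞) ^ p ∂(treeLaw ζ j) ≠ ∞ := by
  classical
  have hL : ∀ w, listLaw ζ w Set.univ = 1 := fun w => by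
    rw [listLaw_univ]; simp [measure_univ]
  induction p using Nat.strong_induction_on generalizing j with
  | _ p IH =>
    rcases Nat.eq_zero_or_pos p with rfl | hp
    · simp
    set m := meanMatrix (unordered ζ) with hmdef
    set B : ℝ≥0∞ := ∑ r ∈ Finset.range p, ∑ j,
      ∫⁻ t, (prunedSize i t : ℝ≥0∞) ^ r ∂(treeLaw ζ j) with hB
    have hBt : B ≠ ∞ := by
      refine ENNReal.sum_ne_top.2 fun r hr => ENNReal.sum_ne_top.2 fun j _ =>
        IH r (Finset.mem_range.1 hr) (fun k => ?_) j
      refine ne_top_of_le_ne_top (hmom k) (ENNReal.tsum_le_tsum fun w => ?_)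
      gcongr
      · simp
      · exact (Finset.mem_range.1 hr).le
    obtain ⟨C, hCt, hC⟩ := exists_moment_bound ζ hP B hBt p
    set D : ℝ≥0∞ := ∑ j, (∑ k, m j k + C * ∑' w, ζ j w * ((w.length : ℝ≥0∞) + 1) ^ p) with hD
    have hDt : D ≠ ∞ := ENNReal.sum_ne_top.2 fun j _ => ENNReal.add_ne_top.2
      ⟨ENNReal.sum_ne_top.2 fun k _ => hm j k, ENNReal.mul_ne_top hCt (hmom j)⟩
    -- A multiple of the Green function absorbs the error term `D` of the recursion for the moments.
    set g : Fin K → ℝ≥0∞ := fun j => if j = i then 1 else D * v j with hg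
    have hgt : g j ≠ ∞ := by
      simp only [hg]
      split_ifs
      · exact ENNReal.one_ne_top
      · exact ENNReal.mul_ne_top hDt (hvt j)
    -- The moments of `prunedSize` are not known to be finite yet: the recursion is used for trees
    -- of bounded height.
    refine ne_top_of_le_ne_top hgt (lintegral_treeLaw_le_of_heightLT ζ j _ _ fun n => ?_)
    induction n generalizing j with
    | zero => simp [PTree.HeightLT]
    | succ n ih =>
      rw [lintegral_treeLaw_heightLT_succ]
      by_cases hj : j = i
      · subst hj
        simp only [hg, if_true, prunedSize_node_self, Nat.cast_one, one_pow]
        refine le_trans (ENNReal.tsum_le_tsum fun w => mul_le_of_le_one_right' ?_)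
          (PMF.tsum_coe (ζ j)).le
        refine (lintegral_mono (g := fun _ => 1) fun l => ?_).trans (by simp [hL])
        dsimp only
        split_ifs <;> simp
      set f : PTree (Fin K) → ℝ≥0∞ := fun t => if t.HeightLT n then (prunedSize i t : ℝ≥0∞) else 0
        with hf
      have hfp : ∀ t, f t ^ p = if t.HeightLT n then (prunedSize i t : ℝ≥0∞) ^ p else 0 := by
        intro t
        simp only [hf]
        split_ifs
        · rfl
        · exact zero_pow hp.ne'
      have hfB : ∀ r < p, ∀ j, ∫⁻ t, f t ^ r ∂(treeLaw ζ j) ≤ B := by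
        intro r hr j
        calc ∫⁻ t, f t ^ r ∂(treeLaw ζ j)
            ≤ ∫⁻ t, (prunedSize i t : ℝ≥0∞) ^ r ∂(treeLaw ζ j) := by
              gcongr with t
              simp only [hf]
              split_ifs <;> simp
          _ ≤ ∑ j, ∫⁻ t, (prunedSize i t : ℝ≥0∞) ^ r ∂(treeLaw ζ j) :=
              Finset.single_le_sum
                (f := fun j => ∫⁻ t, (prunedSize i t : ℝ≥0∞) ^ r ∂(treeLaw ζ j))
                (fun _ _ => zero_le) (Finset.mem_univ j)
          _ ≤ B := Finset.single_le_sum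
                (f := fun r => ∑ j, ∫⁻ t, (prunedSize i t : ℝ≥0∞) ^ r ∂(treeLaw ζ j))
                (fun _ _ => zero_le) (Finset.mem_range.2 hr)
      have hstep : ∀ w, ∫⁻ l, (if ∀ t ∈ l, t.HeightLT n then
          (prunedSize i (.node j l) : ℝ≥0∞) ^ p else 0) ∂(listLaw ζ w) ≤
          (w.map g).sum + C * (w.length + 1) ^ p := by
        intro w
        calc _ ≤ ∫⁻ l, (1 + (l.map f).sum) ^ p ∂(listLaw ζ w) := by
              gcongr with l
              split_ifs with h
              · rw [prunedSize_node_of_ne i hj, Nat.cast_add, cast_sum_map,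
                  List.map_congr_left (g := f) fun t ht => by simp [hf, h t ht], Nat.cast_one]
              · exact zero_le
          _ ≤ (w.map fun j => ∫⁻ t, f t ^ p ∂(treeLaw ζ j)).sum + C * (w.length + 1) ^ p :=
              hC f hfB w
          _ ≤ _ := by
              gcongr
              refine List.sum_le_sum fun k _ => ?_
              simp only [hfp]
              refine ih k ?_
              simp only [hg]
              split_ifs
              · exact ENNReal.one_ne_top
              · exact ENNReal.mul_ne_top hDt (hvt k)
      calc _ ≤ ∑' w, ζ j w * ((w.map g).sum + C * (w.length + 1) ^ p) :=
            ENNReal.tsum_le_tsum fun w => mul_le_mul_right (hstep w) _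
        _ = ∑ k, m j k * g k + C * ∑' w, ζ j w * (w.length + 1) ^ p := by
            simp only [mul_add, ENNReal.tsum_add]
            rw [tsum_mul_sum_map, ← ENNReal.tsum_mul_left]
            congr 1
            exact tsum_congr fun w => by ring
        _ ≤ ∑ k, (m j k + D * (m j k * (if k = i then 0 else v k))) +
              C * ∑' w, ζ j w * (w.length + 1) ^ p := by
            gcongr with k
            simp only [hg]
            split_ifs
            · simp
            · exact le_trans (by ring_nf; exact le_rfl) le_add_self
        _ = (∑ k, m j k + C * ∑' w, ζ j w * (w.length + 1) ^ p) +
              D * ∑ k, m j k * (if k = i then 0 else v k) := by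
            rw [Finset.sum_add_distrib, Finset.mul_sum]; ring
        _ ≤ D + D * ∑ k, m j k * (if k = i then 0 else v k) := by
            gcongr
            exact Finset.single_le_sum (f := fun j => ∑ k, m j k + C * ∑' w, ζ j w *
              ((w.length : ℝ≥0∞) + 1) ^ p) (fun _ _ => zero_le) (Finset.mem_univ j)
        _ = g j := by
            simp only [hg, if_neg hj]
            conv_rhs => rw [hv j]
            ring

theorem lintegral_one_add_prunedBelow_pow_ne_top (hP : ∀ j, IsProbabilityMeasure (treeLaw ζ j))
    (hm : ∀ j k, meanMatrix (unordered ζ) j k ≠ ∞) (i : Fin K) {v : Fin K → ℝ≥0∞}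
    (hvt : ∀ j, v j ≠ ∞)
    (hv : ∀ j, v j = 1 + ∑ k, meanMatrix (unordered ζ) j k * (if k = i then 0 else v k))
    {p : ℕ} (hmom : HasMoment (unordered ζ) p) (j : Fin K) :
    ∫⁻ t, (1 + prunedBelow i t : ℝ≥0∞) ^ p ∂(treeLaw ζ j) ≠ ∞ := by
  have hmom' := tsum_mul_length_add_one_pow_ne_top ζ hmom
  have hY : ∀ r ≤ p, ∀ j, ∫⁻ t, (prunedSize i t : ℝ≥0∞) ^ r ∂(treeLaw ζ j) ≠ ∞ := by
    intro r hr j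
    refine lintegral_prunedSize_pow_ne_top ζ hP hm i hvt hv r (fun k => ?_) j
    refine ne_top_of_le_ne_top (hmom' k) (ENNReal.tsum_le_tsum fun w => ?_)
    gcongr
    simp
  obtain ⟨C, hCt, hC⟩ := exists_moment_bound ζ hP (∑ r ∈ Finset.range p, ∑ j,
      ∫⁻ t, (prunedSize i t : ℝ≥0∞) ^ r ∂(treeLaw ζ j))
    (ENNReal.sum_ne_top.2 fun r hr => ENNReal.sum_ne_top.2 fun j _ =>
      hY r (Finset.mem_range.1 hr).le j) p
  rw [lintegral_treeLaw]
  have h1 := fun w => hC (fun t => (prunedSize i t : ℝ≥0∞)) (fun r hr j =>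
    (Finset.single_le_sum (f := fun j => ∫⁻ t, (prunedSize i t : ℝ≥0∞) ^ r ∂(treeLaw ζ j))
      (fun _ _ => zero_le) (Finset.mem_univ j)).trans
    (Finset.single_le_sum (f := fun r => ∑ j, ∫⁻ t, (prunedSize i t : ℝ≥0∞) ^ r ∂(treeLaw ζ j))
      (fun _ _ => zero_le) (Finset.mem_range.2 hr))) w
  simp only [prunedBelow, PTree.children_node, cast_sum_map]
  refine ne_top_of_le_ne_top ?_ (ENNReal.tsum_le_tsum fun w => mul_le_mul_right (h1 w) _)
  simp only [mul_add, ENNReal.tsum_add]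
  rw [tsum_mul_sum_map]
  refine ENNReal.add_ne_top.2 ⟨ENNReal.sum_ne_top.2 fun k _ =>
    ENNReal.mul_ne_top (hm j k) (hY p le_rfl k), ?_⟩
  have h2 : ∀ w, ζ j w * (C * ((w.length : ℝ≥0∞) + 1) ^ p) =
    C * (ζ j w * ((w.length : ℝ≥0∞) + 1) ^ p) := fun w => by ring
  simp only [h2, ENNReal.tsum_mul_left]
  exact ENNReal.mul_ne_top hCt (hmom' j)

end PrunedMoments

/-! ### Exponential moments -/

section ExponentialMoments

/-- Second-order expansion of the exponential at a small multiple `δ` of `x`; the remainder is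
controlled by the exponential of a fixed multiple `κ` of `x`. -/
theorem exp_mul_le {κ δ x : ℝ} (hκ : 0 < κ) (hδ : 0 ≤ δ) (hδκ : δ ≤ κ / 2) (hx : 0 ≤ x) :
    Real.exp (δ * x) ≤ 1 + δ * x + δ ^ 2 * (8 / κ ^ 2) * Real.exp (κ * x) := by
  have h1 : Real.exp (δ * x) ≤ 1 + δ * x + (δ * x) ^ 2 * Real.exp (δ * x) := by
    have hy : 0 ≤ δ * x := mul_nonneg hδ hx
    have h2 := Real.add_one_le_exp (-(δ * x))
    have h3 : Real.exp (-(δ * x)) * Real.exp (δ * x) = 1 := by rw [← Real.exp_add]; simp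
    have h4 := Real.exp_pos (δ * x)
    have h5 : (1 - δ * x) * Real.exp (δ * x) ≤ 1 := by
      rw [← h3]
      exact mul_le_mul_of_nonneg_right (by linarith) h4.le
    nlinarith
  have h6 : x ^ 2 ≤ 8 / κ ^ 2 * Real.exp (κ / 2 * x) := by
    have h7 := Real.quadratic_le_exp_of_nonneg (x := κ / 2 * x) (by positivity)
    have h8 : 0 ≤ κ / 2 * x := by positivity
    rw [div_mul_eq_mul_div, le_div_iff₀ (by positivity)]
    nlinarith
  have h9 : Real.exp (δ * x) ≤ Real.exp (κ / 2 * x) :=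
    Real.exp_le_exp.2 (mul_le_mul_of_nonneg_right hδκ hx)
  have h10 : Real.exp (κ / 2 * x) * Real.exp (κ / 2 * x) = Real.exp (κ * x) := by
    rw [← Real.exp_add]; congr 1; ring
  calc Real.exp (δ * x) ≤ 1 + δ * x + δ ^ 2 * (x ^ 2 * Real.exp (δ * x)) := by
        rw [← mul_assoc, ← mul_pow]; exact h1
    _ ≤ 1 + δ * x + δ ^ 2 * ((8 / κ ^ 2 * Real.exp (κ / 2 * x)) * Real.exp (κ / 2 * x)) := by
        gcongr
    _ = _ := by rw [mul_assoc (8 / κ ^ 2), h10]; ring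

/-- A nonnegative random variable `X` with a finite exponential moment satisfies
`E[exp (δ X)] ≤ exp (δ (E[X] + η))` for all small `δ`. -/
theorem exists_tsum_exp_le {W : Type} (p : PMF W) {X : W → ℝ} (hX : ∀ w, 0 ≤ X w) {κ μ η : ℝ}
    (hκ : 0 < κ) (hμ : 0 ≤ μ) (hη : 0 < η)
    (hexp : ∑' w, p w * ENNReal.ofReal (Real.exp (κ * X w)) ≠ ∞)
    (hmean : ∑' w, p w * ENNReal.ofReal (X w) ≤ ENNReal.ofReal μ) :
    ∃ δ₀ : ℝ, 0 < δ₀ ∧ ∀ δ, 0 < δ → δ ≤ δ₀ →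
      ∑' w, p w * ENNReal.ofReal (Real.exp (δ * X w)) ≤
        ENNReal.ofReal (Real.exp (δ * (μ + η))) := by
  set e : ℝ := (∑' w, p w * ENNReal.ofReal (Real.exp (κ * X w))).toReal with he
  have he0 : 0 ≤ e := ENNReal.toReal_nonneg
  set c : ℝ := 8 / κ ^ 2 with hc
  have hc0 : 0 < c := by positivity
  refine ⟨min (κ / 2) (η / (c * e + 1)), by positivity, fun δ hδ hδ₀ => ?_⟩
  have h1 : δ ≤ κ / 2 := hδ₀.trans (min_le_left _ _)
  have h2 : δ * (c * e + 1) ≤ η := by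
    rw [← le_div_iff₀ (by positivity)]
    exact hδ₀.trans (min_le_right _ _)
  have h3 : ∀ w, ENNReal.ofReal (Real.exp (δ * X w)) ≤ 1 + ENNReal.ofReal δ * ENNReal.ofReal (X w)
      + ENNReal.ofReal (δ ^ 2 * c) * ENNReal.ofReal (Real.exp (κ * X w)) := by
    intro w
    have h4 : 0 ≤ δ * X w := mul_nonneg hδ.le (hX w)
    rw [← ENNReal.ofReal_mul hδ.le, ← ENNReal.ofReal_mul (by positivity), ← ENNReal.ofReal_one,
      ← ENNReal.ofReal_add zero_le_one h4, ← ENNReal.ofReal_add (by linarith) (by positivity)]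
    exact ENNReal.ofReal_le_ofReal (exp_mul_le hκ hδ.le h1 (hX w))
  calc ∑' w, p w * ENNReal.ofReal (Real.exp (δ * X w))
      ≤ ∑' w, p w * (1 + ENNReal.ofReal δ * ENNReal.ofReal (X w)
          + ENNReal.ofReal (δ ^ 2 * c) * ENNReal.ofReal (Real.exp (κ * X w))) :=
        ENNReal.tsum_le_tsum fun w => mul_le_mul_right (h3 w) _
    _ = 1 + ENNReal.ofReal δ * ∑' w, p w * ENNReal.ofReal (X w) + ENNReal.ofReal (δ ^ 2 * c) *
          ∑' w, p w * ENNReal.ofReal (Real.exp (κ * X w)) := by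
        simp only [mul_add, mul_one, ENNReal.tsum_add, PMF.tsum_coe, ← ENNReal.tsum_mul_left,
          mul_left_comm]
    _ ≤ 1 + ENNReal.ofReal δ * ENNReal.ofReal μ + ENNReal.ofReal (δ ^ 2 * c) *
          ENNReal.ofReal e := by
        rw [he, ENNReal.ofReal_toReal hexp]
        gcongr
    _ = ENNReal.ofReal (1 + δ * μ + δ ^ 2 * c * e) := by
        rw [← ENNReal.ofReal_mul hδ.le, ← ENNReal.ofReal_mul (by positivity), ← ENNReal.ofReal_one,
          ← ENNReal.ofReal_add zero_le_one (by positivity),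
          ← ENNReal.ofReal_add (by positivity) (by positivity)]
    _ ≤ _ := by
        refine ENNReal.ofReal_le_ofReal (le_trans ?_ (Real.add_one_le_exp _))
        nlinarith

variable {K : ℕ} (ζ : Fin K → PMF (List (Fin K)))

theorem ofReal_exp_sum {α : Type} (l : List α) (f : α → ℝ) :
    ENNReal.ofReal (Real.exp (l.map f).sum) =
      (l.map fun t => ENNReal.ofReal (Real.exp (f t))).prod := by
  induction l with
  | nil => simp
  | cons t l ih =>
    simp only [List.map_cons, List.sum_cons, List.prod_cons, Real.exp_add, ← ih]
    rw [ENNReal.ofReal_mul (Real.exp_pos _).le]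

/-- The exponential moments of the offspring distributions are inherited by the number of vertices
of the tree pruned at its first type-`i` vertices other than the root.  The exponentials of small
multiples of the Green function `v` provide a supersolution of the recursion. -/
theorem exists_lintegral_exp_prunedBelow_ne_top
    (hm : ∀ j k, meanMatrix (unordered ζ) j k ≠ ∞) (i : Fin K) {v : Fin K → ℝ≥0∞}
    (hvt : ∀ j, v j ≠ ∞)
    (hv : ∀ j, v j = 1 + ∑ k, meanMatrix (unordered ζ) j k * (if k = i then 0 else v k))
    (hexp : HasExpMoment (unordered ζ)) :
    ∃ ε : ℝ, 0 < ε ∧ ∀ j, ∫⁻ t, ENNReal.ofReal (Real.exp (ε * (1 + prunedBelow i t)))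
      ∂(treeLaw ζ j) ≠ ∞ := by
  obtain ⟨ε₀, hε₀, hexp⟩ := hexp
  set m := meanMatrix (unordered ζ) with hmdef
  have hmi : 0 ≤ ∑ j, (m j i).toReal := Finset.sum_nonneg fun _ _ => ENNReal.toReal_nonneg
  -- Each vertex gets the weight `c`, so small that `c + m j i * c ≤ 1 / 2`: the mean increment of
  -- `lam` then stays below `v j - 1 / 2`, which leaves room for the error term in the expansion of
  -- the exponential.
  set c : ℝ := 1 / (2 * (1 + ∑ j, (m j i).toReal)) with hc
  have hc0 : 0 < c := by positivity
  have hcm : ∀ j, c + (m j i).toReal * c ≤ 1 / 2 := by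
    intro j
    have h1 : (m j i).toReal ≤ ∑ j, (m j i).toReal :=
      Finset.single_le_sum (f := fun j => (m j i).toReal) (fun _ _ => ENNReal.toReal_nonneg)
        (Finset.mem_univ j)
    have h2 : c * (2 * (1 + ∑ j, (m j i).toReal)) = 1 := by
      rw [hc, one_div, inv_mul_cancel₀ (by positivity)]
    nlinarith
  set lam : Fin K → ℝ := fun k => if k = i then c else (v k).toReal with hlam
  have hlam0 : ∀ k, 0 ≤ lam k := by
    intro k
    simp only [hlam]
    split_ifs
    · exact hc0.le
    · exact ENNReal.toReal_nonneg
  set X : List (Fin K) → ℝ := fun w => c + (w.map lam).sum with hX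
  have hX0 : ∀ w, 0 ≤ X w := fun w =>
    add_nonneg hc0.le (List.sum_nonneg (by simpa using fun k _ => hlam0 k))
  set L : ℝ := c + ∑ k, lam k with hLdef
  have hL0 : 0 < L := add_pos_of_pos_of_nonneg hc0 (Finset.sum_nonneg fun k _ => hlam0 k)
  have hXL : ∀ w, X w ≤ L * (1 + w.length) := by
    intro w
    have h1 : (w.map lam).sum ≤ L * w.length := by
      have : (w.map lam).sum ≤ (w.map fun _ => L).sum := List.sum_le_sum fun k _ =>
        (Finset.single_le_sum (f := lam) (fun k _ => hlam0 k) (Finset.mem_univ k)).trans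
          (by simp only [hLdef]; linarith)
      refine this.trans_eq ?_
      simp [mul_comm]
    have h2 : c ≤ L := by
      have := Finset.sum_nonneg fun k (_ : k ∈ Finset.univ) => hlam0 k
      simp only [hLdef]; linarith
    simp only [hX]
    linarith
  have hκ : 0 < ε₀ / L := by positivity
  have hXexp : ∀ j, ∑' w, ζ j w * ENNReal.ofReal (Real.exp (ε₀ / L * X w)) ≠ ∞ := by
    intro j
    have h1 := (hexp j).ne
    rw [tsum_mul_unordered ζ j fun z => ENNReal.ofReal (Real.exp (ε₀ * ((∑ j, z j : ℕ) : ℝ)))]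
      at h1
    simp only [sum_typeCount] at h1
    have h2 : ∀ w, ENNReal.ofReal (Real.exp (ε₀ / L * X w)) ≤
        ENNReal.ofReal (Real.exp ε₀) * ENNReal.ofReal (Real.exp (ε₀ * w.length)) := by
      intro w
      rw [← ENNReal.ofReal_mul (Real.exp_pos _).le, ← Real.exp_add]
      refine ENNReal.ofReal_le_ofReal (Real.exp_le_exp.2 ?_)
      calc ε₀ / L * X w ≤ ε₀ / L * (L * (1 + w.length)) := by gcongr; exact hXL w
        _ = ε₀ + ε₀ * w.length := by field_simp
    refine ne_top_of_le_ne_top ?_ (ENNReal.tsum_le_tsum fun w => mul_le_mul_right (h2 w) _)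
    simp only [mul_left_comm (ζ j _), ENNReal.tsum_mul_left]
    exact ENNReal.mul_ne_top ENNReal.ofReal_ne_top h1
  have hv1 : ∀ j, 1 ≤ (v j).toReal := by
    intro j
    have : 1 ≤ v j := by rw [hv j]; exact le_self_add
    rw [← ENNReal.toReal_one]
    exact ENNReal.toReal_mono (hvt j) this
  have hmean : ∀ j, ∑' w, ζ j w * ENNReal.ofReal (X w) ≤
      ENNReal.ofReal ((v j).toReal - 1 / 2) := by
    intro j
    have h1 : ∀ w, ENNReal.ofReal (X w) =
        ENNReal.ofReal c + (w.map fun k => ENNReal.ofReal (lam k)).sum := by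
      intro w
      rw [ENNReal.ofReal_add hc0.le (List.sum_nonneg (by simpa using fun k _ => hlam0 k))]
      congr 1
      induction w with
      | nil => simp
      | cons k w ih =>
        simp only [List.map_cons, List.sum_cons, ← ih]
        rw [ENNReal.ofReal_add (hlam0 k) (List.sum_nonneg (by simpa using fun k _ => hlam0 k))]
    simp only [h1, mul_add, ENNReal.tsum_add, ENNReal.tsum_mul_right, PMF.tsum_coe, one_mul]
    rw [tsum_mul_sum_map]
    have h2 : ∑ k, m j k * ENNReal.ofReal (lam k) =
        m j i * ENNReal.ofReal c + ∑ k, m j k * (if k = i then 0 else v k) := by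
      have : ∀ k, m j k * ENNReal.ofReal (lam k) = (if k = i then m j k * ENNReal.ofReal c else 0)
          + m j k * (if k = i then 0 else v k) := by
        intro k
        simp only [hlam]
        split_ifs
        · simp
        · rw [ENNReal.ofReal_toReal (hvt k), zero_add]
      simp only [this, Finset.sum_add_distrib]
      simp
    set R := ∑ k, m j k * (if k = i then 0 else v k) with hR
    have hRv : v j = 1 + R := hv j
    have hRt : R ≠ ∞ := fun h => hvt j (by rw [hRv, h]; simp)
    have hR' : (v j).toReal = 1 + R.toReal := by
      rw [hRv, ENNReal.toReal_add ENNReal.one_ne_top hRt, ENNReal.toReal_one]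
    rw [h2, ← ENNReal.ofReal_toReal (hm j i), ← ENNReal.ofReal_toReal hRt,
      ← ENNReal.ofReal_mul ENNReal.toReal_nonneg,
      ← ENNReal.ofReal_add (by positivity) ENNReal.toReal_nonneg,
      ← ENNReal.ofReal_add hc0.le (by positivity)]
    refine ENNReal.ofReal_le_ofReal ?_
    rw [hR']
    linarith [hcm j]
  choose δ₀ hδ₀ hδ using fun j => exists_tsum_exp_le (ζ j) hX0 hκ
    (by linarith [hv1 j] : 0 ≤ (v j).toReal - 1 / 2) one_half_pos (hXexp j) (hmean j)
  have hne : Nonempty (Fin K) := ⟨i⟩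
  obtain ⟨j₀, hj₀⟩ := Finite.exists_min δ₀
  have hδj : ∀ j, ∑' w, ζ j w * ENNReal.ofReal (Real.exp (δ₀ j₀ * X w)) ≤
      ENNReal.ofReal (Real.exp (δ₀ j₀ * (v j).toReal)) := by
    intro j
    simpa using hδ j (δ₀ j₀) (hδ₀ j₀) (hj₀ j)
  set δ := δ₀ j₀ with hδdef
  have hδpos : 0 < δ := hδ₀ j₀
  set g : Fin K → ℝ≥0∞ := fun k => ENNReal.ofReal (Real.exp (δ * lam k)) with hg
  have hgX : ∀ j, ENNReal.ofReal (Real.exp (δ * c)) * ∑' w, ζ j w * (w.map g).prod ≤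
      ENNReal.ofReal (Real.exp (δ * (v j).toReal)) := by
    intro j
    refine le_trans (le_of_eq ?_) (hδj j)
    rw [← ENNReal.tsum_mul_left]
    refine tsum_congr fun w => ?_
    simp only [hg, hX, mul_add, Real.exp_add]
    rw [ENNReal.ofReal_mul (Real.exp_pos _).le, ← List.sum_map_mul_left, ofReal_exp_sum]
    ring
  have hf : ∀ j, ∫⁻ t, ENNReal.ofReal (Real.exp (δ * c * prunedSize i t)) ∂(treeLaw ζ j) ≤ g j := by
    refine lintegral_treeLaw_le_of_supersolution ζ _ (fun _ => ENNReal.ofReal (Real.exp (δ * c))) g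
      fun j => ?_
    by_cases hj : j = i
    · left
      intro l
      simp [hj, prunedSize_node_self, hg, hlam]
    · right
      refine ⟨fun l => ?_, ?_⟩
      · rw [prunedSize_node_of_ne i hj, ← ofReal_exp_sum, ← ENNReal.ofReal_mul (Real.exp_pos _).le,
          ← Real.exp_add, List.sum_map_mul_left]
        refine le_of_eq ?_
        congr 2
        rw [Nat.cast_add, Nat.cast_one, Nat.cast_list_sum, List.map_map, mul_add, mul_one]
        rfl
      · refine (hgX j).trans_eq ?_
        simp [hg, hlam, hj]
  refine ⟨δ * c, by positivity, fun j => ?_⟩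
  refine ne_top_of_le_ne_top (ENNReal.ofReal_ne_top (r := Real.exp (δ * (v j).toReal)))
    (le_trans ?_ (hgX j))
  rw [lintegral_treeLaw, ← ENNReal.tsum_mul_left]
  refine ENNReal.tsum_le_tsum fun w => ?_
  have h1 : ∀ l, ENNReal.ofReal (Real.exp (δ * c * (1 + prunedBelow i (.node j l)))) =
      ENNReal.ofReal (Real.exp (δ * c)) *
        (l.map fun t => ENNReal.ofReal (Real.exp (δ * c * prunedSize i t))).prod := by
    intro l
    rw [← ofReal_exp_sum, ← ENNReal.ofReal_mul (Real.exp_pos _).le, ← Real.exp_add,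
      List.sum_map_mul_left]
    congr 2
    simp only [prunedBelow, PTree.children_node]
    rw [Nat.cast_list_sum, List.map_map, mul_add, mul_one]
    rfl
  simp only [h1]
  rw [lintegral_const_mul _ .of_discrete, lintegral_listLaw_prod, mul_left_comm]
  gcongr
  exact List.prod_le_prod' (by simpa using fun k _ => hf k)

end ExponentialMoments

/-! ### Means and variances -/

section MeanVariance

variable {K : ℕ} (ζ : Fin K → PMF (List (Fin K)))

theorem hasMoment_one (hm : ∀ j k, meanMatrix (unordered ζ) j k ≠ ∞) :
    HasMoment (unordered ζ) 1 := by
  intro j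
  rw [tsum_mul_unordered ζ j fun z => ((∑ j, z j : ℕ) : ℝ≥0∞) ^ 1]
  simp only [sum_typeCount, pow_one, tsum_mul_length]
  exact (ENNReal.sum_ne_top.2 fun k _ => hm j k).lt_top

/-- The quadratic form of the second factorial moments of the numbers of letters of a word. -/
theorem sum_typeCount_factorial_add (w : List (Fin K)) (h : Fin K → ℝ≥0∞) :
    ∑ k, ∑ l, ((typeCount w k * (typeCount w l - if k = l then 1 else 0) : ℕ) : ℝ≥0∞) *
      (h k * h l) + (w.map fun k => h k ^ 2).sum = (w.map h).sum ^ 2 := by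
  rw [← sum_typeCount_mul, ← sum_typeCount_mul, sq, Finset.sum_mul_sum, ← Finset.sum_add_distrib]
  refine Finset.sum_congr rfl fun k _ => ?_
  have h1 : (typeCount w k : ℝ≥0∞) * h k ^ 2 =
      ∑ l, if k = l then (typeCount w k : ℝ≥0∞) * (h k * h l) else 0 := by
    simp [sq]
  rw [h1, ← Finset.sum_add_distrib]
  refine Finset.sum_congr rfl fun l _ => ?_
  split_ifs with hkl
  · subst hkl
    rw [← add_mul, ← Nat.cast_add]
    have : typeCount w k * (typeCount w k - 1) + typeCount w k = typeCount w k * typeCount w k := by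
      rcases typeCount w k with _ | n <;> simp; ring
    rw [this]
    push_cast
    ring
  · simp only [Nat.sub_zero, add_zero]
    push_cast
    ring

/-- Second factorial moments of the offspring distribution, in terms of words. -/
theorem tsum_mul_factorial (j : Fin K) (h : Fin K → ℝ≥0∞) :
    ∑' w, ζ j w * ∑ k, ∑ l,
      ((typeCount w k * (typeCount w l - if k = l then 1 else 0) : ℕ) : ℝ≥0∞) * (h k * h l) =
    ∑ k, ∑ l, secondDeriv (unordered ζ) j k l * (h k * h l) := by
  rw [← tsum_mul_unordered ζ j fun z => ∑ k, ∑ l,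
    ((z k * (z l - if k = l then 1 else 0) : ℕ) : ℝ≥0∞) * (h k * h l)]
  simp only [Finset.sum_mul, secondDeriv, ← ENNReal.tsum_mul_right]
  rw [Summable.tsum_finsetSum fun _ _ => ENNReal.summable]
  refine Finset.sum_congr rfl fun k _ => ?_
  rw [Summable.tsum_finsetSum fun _ _ => ENNReal.summable]
  exact Finset.sum_congr rfl fun l _ => tsum_congr fun z => by ring

/-- Finite second derivatives of the generating functions mean finite second moments. -/
theorem hasMoment_two (hm : ∀ j k, meanMatrix (unordered ζ) j k ≠ ∞)
    (hv : HasFiniteVariance (unordered ζ)) : HasMoment (unordered ζ) 2 := by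
  intro j
  rw [tsum_mul_unordered ζ j fun z => ((∑ j, z j : ℕ) : ℝ≥0∞) ^ 2]
  have h1 : ∀ w : List (Fin K), ((∑ k, typeCount w k : ℕ) : ℝ≥0∞) ^ 2 = ∑ k, ∑ l,
      ((typeCount w k * (typeCount w l - if k = l then 1 else 0) : ℕ) : ℝ≥0∞) * (1 * 1) +
        w.length := by
    intro w
    have := sum_typeCount_factorial_add w fun _ => 1
    simp only [one_pow, List.map_const', List.sum_replicate, nsmul_eq_mul, mul_one] at this ⊢
    rw [this, sum_typeCount]
  simp only [h1, mul_add, ENNReal.tsum_add]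
  rw [tsum_mul_factorial ζ j fun _ => 1, tsum_mul_length]
  refine (ENNReal.add_ne_top.2 ⟨ENNReal.sum_ne_top.2 fun k _ => ENNReal.sum_ne_top.2 fun l _ =>
    ENNReal.mul_ne_top (hv j k l) (by simp), ENNReal.sum_ne_top.2 fun k _ => hm j k⟩).lt_top

/-- The second moment of a sum over a list of independent trees: the sum of the second moments, plus
the cross terms, counted with the second factorial moments of the word. -/
theorem lintegral_listLaw_sum_sq (hP : ∀ j, IsProbabilityMeasure (treeLaw ζ j))
    {f : PTree (Fin K) → ℝ≥0∞} (hf : ∀ j, ∫⁻ t, f t ∂(treeLaw ζ j) ≠ ∞) (w : List (Fin K)) :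
    ∫⁻ l, (l.map f).sum ^ 2 ∂(listLaw ζ w) = (w.map fun j => ∫⁻ t, f t ^ 2 ∂(treeLaw ζ j)).sum +
      ∑ k, ∑ l, ((typeCount w k * (typeCount w l - if k = l then 1 else 0) : ℕ) : ℝ≥0∞) *
        ((∫⁻ t, f t ∂(treeLaw ζ k)) * ∫⁻ t, f t ∂(treeLaw ζ l)) := by
  have hL : ∀ w, listLaw ζ w Set.univ = 1 := fun w => by
    rw [listLaw_univ]; simp [measure_univ]
  set h : Fin K → ℝ≥0∞ := fun j => ∫⁻ t, f t ∂(treeLaw ζ j) with hh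
  set e : Fin K → ℝ≥0∞ := fun j => ∫⁻ t, f t ^ 2 ∂(treeLaw ζ j) with he
  have hfin : (w.map fun k => h k ^ 2).sum ≠ ∞ := by
    rw [← sum_typeCount_mul]
    exact ENNReal.sum_ne_top.2 fun k _ => ENNReal.mul_ne_top (by simp) (ENNReal.pow_ne_top (hf k))
  rw [← ENNReal.add_left_inj hfin, add_assoc, sum_typeCount_factorial_add w h]
  clear hfin
  induction w with
  | nil => simp
  | cons j w ih =>
    rw [lintegral_listLaw_cons]
    simp only [List.map_cons, List.sum_cons]
    have h1 : ∀ t, ∫⁻ l, (f t + (l.map f).sum) ^ 2 ∂(listLaw ζ w) =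
        f t ^ 2 + 2 * (w.map h).sum * f t + ∫⁻ l, (l.map f).sum ^ 2 ∂(listLaw ζ w) := by
      intro t
      simp only [add_sq]
      rw [lintegral_add_left .of_discrete, lintegral_add_left .of_discrete, lintegral_const, hL,
        mul_one, lintegral_const_mul _ .of_discrete, lintegral_listLaw_sum ζ hP]
      ring
    simp only [h1]
    rw [lintegral_add_left .of_discrete, lintegral_add_left .of_discrete, lintegral_const,
      measure_univ, mul_one, lintegral_const_mul _ .of_discrete]
    calc _ = e j + 2 * (w.map h).sum * h j + h j ^ 2 +
          (∫⁻ l, (l.map f).sum ^ 2 ∂(listLaw ζ w) + (w.map fun k => h k ^ 2).sum) := by ring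
      _ = _ := by rw [ih]; ring

variable (i : Fin K)

theorem lintegral_reducedRootCount (hP : ∀ j, IsProbabilityMeasure (treeLaw ζ j)) (j : Fin K) :
    ∫⁻ t, (reducedRootCount i t : ℝ≥0∞) ∂(treeLaw ζ j) =
      ∑ k, meanMatrix (unordered ζ) j k * ∫⁻ t, (rootCount i t : ℝ≥0∞) ∂(treeLaw ζ k) := by
  rw [lintegral_treeLaw, ← tsum_mul_sum_map]
  simp only [reducedRootCount_node, cast_sum_map, lintegral_listLaw_sum ζ hP]

theorem lintegral_deletedBelow (hP : ∀ j, IsProbabilityMeasure (treeLaw ζ j)) (j : Fin K) :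
    ∫⁻ t, (deletedBelow i t : ℝ≥0∞) ∂(treeLaw ζ j) =
      ∑ k, meanMatrix (unordered ζ) j k * ∫⁻ t, (floorTree i t : ℝ≥0∞) ∂(treeLaw ζ k) := by
  rw [lintegral_treeLaw, ← tsum_mul_sum_map]
  simp only [deletedBelow_node, cast_sum_map, lintegral_listLaw_sum ζ hP]

theorem lintegral_reducedRootCount_sq (hP : ∀ j, IsProbabilityMeasure (treeLaw ζ j))
    (hfin : ∀ k, ∫⁻ t, (rootCount i t : ℝ≥0∞) ∂(treeLaw ζ k) ≠ ∞) (j : Fin K) :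
    ∫⁻ t, (reducedRootCount i t : ℝ≥0∞) ^ 2 ∂(treeLaw ζ j) =
      ∑ k, meanMatrix (unordered ζ) j k * ∫⁻ t, (rootCount i t : ℝ≥0∞) ^ 2 ∂(treeLaw ζ k) +
      ∑ k, ∑ l, secondDeriv (unordered ζ) j k l * ((∫⁻ t, (rootCount i t : ℝ≥0∞) ∂(treeLaw ζ k)) *
        ∫⁻ t, (rootCount i t : ℝ≥0∞) ∂(treeLaw ζ l)) := by
  rw [lintegral_treeLaw, ← tsum_mul_sum_map, ← tsum_mul_factorial, ← ENNReal.tsum_add]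
  simp only [reducedRootCount_node, cast_sum_map, lintegral_listLaw_sum_sq ζ hP hfin, mul_add]

/-- Functionals of trees which only depend on the list of the children of the root, for roots of
type `j`. -/
theorem lintegral_treeLaw_congr {j : Fin K} {f g : PTree (Fin K) → ℝ≥0∞}
    (h : ∀ l, f (.node j l) = g (.node j l)) :
    ∫⁻ t, f t ∂(treeLaw ζ j) = ∫⁻ t, g t ∂(treeLaw ζ j) := by
  simp only [lintegral_treeLaw, h]

theorem rootCount_node_eq_reducedRootCount {j : Fin K} (h : j ≠ i) (l : List (PTree (Fin K))) :
    rootCount i (.node j l) = reducedRootCount i (.node j l) := by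
  rw [rootCount_node_of_ne i h, reducedRootCount_node]

theorem lintegral_rootCount_pow_self (hP : ∀ j, IsProbabilityMeasure (treeLaw ζ j)) (p : ℕ) :
    ∫⁻ t, (rootCount i t : ℝ≥0∞) ^ p ∂(treeLaw ζ i) = 1 := by
  rw [lintegral_treeLaw_congr ζ (g := fun _ => 1) (by simp [rootCount_node_self])]
  simp

/-- Pairing with a left eigenvector `A`: if `y = M x + s` and if `x` and `y` agree outside of `i`,
then `A i * y i = A i * x i + ∑ j, A j * s j`. -/
theorem mul_eq_of_leftEigenvector {m : Matrix (Fin K) (Fin K) ℝ≥0∞} {A : Fin K → ℝ≥0∞}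
    (hA : ∀ k, ∑ j, A j * m j k = A k) (hAt : ∀ j, A j ≠ ∞) {x y s : Fin K → ℝ≥0∞}
    (hx : ∀ j, x j ≠ ∞) (hy : ∀ j, y j = ∑ k, m j k * x k + s j) (hxy : ∀ j, j ≠ i → y j = x j) :
    A i * y i = A i * x i + ∑ j, A j * s j := by
  have h1 : ∑ j, A j * y j = ∑ j, A j * x j + ∑ j, A j * s j := by
    rw [← sum_mul_mulVec hA x, ← Finset.sum_add_distrib]
    exact Finset.sum_congr rfl fun j _ => by rw [hy j, mul_add]
  rw [← Finset.add_sum_erase _ _ (Finset.mem_univ i),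
    ← Finset.add_sum_erase _ (fun j => A j * x j) (Finset.mem_univ i)] at h1
  have h2 : ∑ j ∈ Finset.univ.erase i, A j * y j = ∑ j ∈ Finset.univ.erase i, A j * x j :=
    Finset.sum_congr rfl fun j hj => by rw [hxy j (Finset.ne_of_mem_erase hj)]
  have h3 : ∑ j ∈ Finset.univ.erase i, A j * x j ≠ ∞ :=
    ENNReal.sum_ne_top.2 fun j _ => ENNReal.mul_ne_top (hAt j) (hx j)
  rw [h2, add_right_comm] at h1
  exact (ENNReal.add_left_inj h3).1 h1

/-- The reduced offspring distribution is critical. -/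
theorem lintegral_reducedRootCount_self (hP : ∀ j, IsProbabilityMeasure (treeLaw ζ j))
    {A : Fin K → ℝ≥0∞} (hA : ∀ k, ∑ j, A j * meanMatrix (unordered ζ) j k = A k)
    (hA0 : ∀ j, A j ≠ 0) (hAt : ∀ j, A j ≠ ∞)
    (hfin : ∀ k, ∫⁻ t, (rootCount i t : ℝ≥0∞) ∂(treeLaw ζ k) ≠ ∞) :
    ∫⁻ t, (reducedRootCount i t : ℝ≥0∞) ∂(treeLaw ζ i) = 1 := by
  have h := mul_eq_of_leftEigenvector i hA hAt (s := fun _ => 0) hfin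
    (fun j => by rw [lintegral_reducedRootCount ζ i hP j, add_zero])
    (fun j hj => (lintegral_treeLaw_congr ζ fun l => by
      rw [rootCount_node_eq_reducedRootCount i hj]).symm)
  have h1 := lintegral_rootCount_pow_self ζ i hP 1
  simp only [pow_one] at h1
  simp only [mul_zero, Finset.sum_const_zero, add_zero] at h
  rw [h1] at h
  exact (ENNReal.mul_right_inj (hA0 i) (hAt i)).1 h

/-- The mean number of vertices deleted below a vertex of type `i`. -/
theorem mul_lintegral_deletedBelow_add (hP : ∀ j, IsProbabilityMeasure (treeLaw ζ j))
    {A : Fin K → ℝ≥0∞} (hA : ∀ k, ∑ j, A j * meanMatrix (unordered ζ) j k = A k)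
    (hAt : ∀ j, A j ≠ ∞) (hA1 : ∑ j, A j = 1)
    (hfin : ∀ k, ∫⁻ t, (floorTree i t : ℝ≥0∞) ∂(treeLaw ζ k) ≠ ∞) :
    A i * (∫⁻ t, (deletedBelow i t : ℝ≥0∞) ∂(treeLaw ζ i)) + A i = 1 := by
  have hself : ∫⁻ t, (floorTree i t : ℝ≥0∞) ∂(treeLaw ζ i) = 0 := by
    rw [lintegral_treeLaw_congr ζ (g := fun _ => 0) (by simp [floorTree_node_self])]
    simp
  have h := mul_eq_of_leftEigenvector i hA hAt (s := fun _ => 1)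
    (y := fun j => ∫⁻ t, (deletedBelow i t : ℝ≥0∞) ∂(treeLaw ζ j) + 1) hfin
    (fun j => by simp only [lintegral_deletedBelow ζ i hP j])
    (fun j hj => by
      rw [lintegral_treeLaw_congr ζ (f := fun t => (floorTree i t : ℝ≥0∞))
        (g := fun t => (deletedBelow i t : ℝ≥0∞) + 1)
        fun l => by simp [floorTree_node_of_ne i hj, deletedBelow_node, add_comm]]
      rw [lintegral_add_left .of_discrete]
      simp)
  simp only [hself, mul_zero, mul_one, zero_add, hA1, mul_add] at h
  exact h

/-- The second moment of the reduced offspring distribution. -/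
theorem mul_lintegral_reducedRootCount_sq (hP : ∀ j, IsProbabilityMeasure (treeLaw ζ j))
    {A : Fin K → ℝ≥0∞} (hA : ∀ k, ∑ j, A j * meanMatrix (unordered ζ) j k = A k)
    (hAt : ∀ j, A j ≠ ∞)
    (hfin : ∀ k, ∫⁻ t, (rootCount i t : ℝ≥0∞) ∂(treeLaw ζ k) ≠ ∞)
    (hfin2 : ∀ k, ∫⁻ t, (rootCount i t : ℝ≥0∞) ^ 2 ∂(treeLaw ζ k) ≠ ∞) :
    A i * (∫⁻ t, (reducedRootCount i t : ℝ≥0∞) ^ 2 ∂(treeLaw ζ i)) = A i +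
      ∑ j, A j * ∑ k, ∑ l, secondDeriv (unordered ζ) j k l *
        ((∫⁻ t, (rootCount i t : ℝ≥0∞) ∂(treeLaw ζ k)) *
          ∫⁻ t, (rootCount i t : ℝ≥0∞) ∂(treeLaw ζ l)) := by
  have h := mul_eq_of_leftEigenvector i hA hAt hfin2
    (lintegral_reducedRootCount_sq ζ i hP hfin)
    (fun j hj => (lintegral_treeLaw_congr ζ fun l => by
      rw [rootCount_node_eq_reducedRootCount i hj]).symm)
  rwa [lintegral_rootCount_pow_self ζ i hP 2, mul_one] at h

/-- The mean number of first type-`i` vertices is the right eigenvector, normalized by its `i`-th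
coordinate. -/
theorem lintegral_rootCount_eq (hP : ∀ j, IsProbabilityMeasure (treeLaw ζ j))
    (hcrit : IsCritical (unordered ζ))
    {A : Fin K → ℝ≥0∞} (hA : ∀ k, ∑ j, A j * meanMatrix (unordered ζ) j k = A k)
    (hA0 : ∀ j, A j ≠ 0) (hAt : ∀ j, A j ≠ ∞) {b : Fin K → ℝ}
    (hb : Matrix.mulVec (realMeanMatrix (unordered ζ)) b = b) (hbi : b i ≠ 0)
    (hM : ∀ i j, ∃ n : ℕ, 1 ≤ n ∧ 0 < (realMeanMatrix (unordered ζ) ^ n) i j)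
    (hfin : ∀ k, ∫⁻ t, (rootCount i t : ℝ≥0∞) ∂(treeLaw ζ k) ≠ ∞) (j : Fin K) :
    (∫⁻ t, (rootCount i t : ℝ≥0∞) ∂(treeLaw ζ j)).toReal = b j / b i := by
  set h : Fin K → ℝ≥0∞ := fun k => ∫⁻ t, (rootCount i t : ℝ≥0∞) ∂(treeLaw ζ k) with hh
  have hself : h i = 1 := by
    have h1 := lintegral_rootCount_pow_self ζ i hP 1
    simpa only [pow_one] using h1
  have heq : ∀ j, h j = ∑ k, meanMatrix (unordered ζ) j k * h k := by
    intro j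
    rw [← lintegral_reducedRootCount ζ i hP j]
    by_cases hj : j = i
    · rw [hj, lintegral_reducedRootCount_self ζ i hP hA hA0 hAt hfin, hself]
    · exact lintegral_treeLaw_congr ζ fun l => by rw [rootCount_node_eq_reducedRootCount i hj]
  set d : Fin K → ℝ := (fun j => (h j).toReal) - (b i)⁻¹ • b with hd
  have hdM : Matrix.mulVec (realMeanMatrix (unordered ζ)) d = d := by
    rw [hd, Matrix.mulVec_sub, Matrix.mulVec_smul, hb]
    congr 1
    ext j
    conv_rhs => rw [heq j]
    rw [ENNReal.toReal_sum fun k _ => ENNReal.mul_ne_top (hcrit.1 j k) (hfin k)]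
    simp [Matrix.mulVec, dotProduct, realMeanMatrix, ENNReal.toReal_mul, hh]
  have hdi : d i = 0 := by simp [hd, hself, hbi]
  have hd0 : d = 0 := by
    by_contra hne
    rcases pos_or_neg_of_mulVec_eq (fun i j => by simp [realMeanMatrix]) hM
      (fun r hr => eventually_pow_le_of_spectralRadius_le_one _ hcrit.2.le hr) hne hdM with h | h
    · exact (h i).ne' hdi
    · exact (h i).ne hdi
  have := congrFun hd0 j
  simp only [hd, Pi.sub_apply, Pi.smul_apply, smul_eq_mul, Pi.zero_apply] at this
  rw [div_eq_inv_mul]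
  linarith

end MeanVariance

/-! ### The joint law of the reduced forest and of the numbers of deleted vertices -/

section LabelledWeight

variable {β : Type}

/-- The number of vertices of a tree. -/
def PTree.size (t : PTree β) : ℕ := t.fringe.length

theorem PTree.size_node (x : β) (l : List (PTree β)) :
    (PTree.node x l).size = 1 + (l.map PTree.size).sum := by
  simp only [PTree.size, PTree.fringe_node, List.length_cons, List.length_flatMap, add_comm]
  rfl

/-- The weight of a labelled tree in which the pairs formed by the label and the number of children
of the vertices are independent with mass function `θ`. -/
noncomputable def labelledWeight (θ : β → ℕ → ℝ≥0∞) (s : PTree β) : ℝ≥0∞ :=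
  (s.fringe.map fun u => θ u.label u.children.length).prod

theorem labelledWeight_node (θ : β → ℕ → ℝ≥0∞) (x : β) (l : List (PTree β)) :
    labelledWeight θ (.node x l) = θ x l.length * (l.map (labelledWeight θ)).prod := by
  simp only [labelledWeight, PTree.fringe_node, List.map_cons, List.prod_cons, PTree.label_node,
    PTree.children_node, List.map_flatMap]
  congr 1
  induction l with
  | nil => simp
  | cons t l ih => simp [ih, labelledWeight]

end LabelledWeight

section ReducedLaw

variable {K : ℕ} (ζ : Fin K → PMF (List (Fin K))) (i : Fin K) {β : Type} (g : ℕ → β)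

/-- The reduced forest of a tree, each vertex being labelled by a function `g` of the number of
vertices deleted below it. -/
def markedReduction (t : PTree (Fin K)) : List (PTree β) :=
  (reduceTree i t).map (PTree.relabel fun s => g (deletedBelow i s))

theorem markedReduction_node_self (l : List (PTree (Fin K))) :
    markedReduction i g (.node i l) =
      [.node (g (l.map (floorTree i)).sum) (l.flatMap (markedReduction i g))] := by
  simp only [markedReduction, reduceTree_node_self, List.map_cons, List.map_nil, PTree.relabel_node,
    deletedBelow_node, reduceList_eq, List.map_flatMap]
  rfl

theorem markedReduction_node_of_ne {j : Fin K} (h : j ≠ i) (l : List (PTree (Fin K))) :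
    markedReduction i g (.node j l) = l.flatMap (markedReduction i g) := by
  simp only [markedReduction, reduceTree_node_of_ne i h, reduceList_eq, List.map_flatMap]
  rfl

/-- The joint mass function, under `P^{(i)}`, of the mark of the root and of its number of children
in the reduced tree. -/
noncomputable def markedOffspring (x : β) (c : ℕ) : ℝ≥0∞ :=
  treeLaw ζ i {t | g (deletedBelow i t) = x ∧ reducedRootCount i t = c}

theorem treeLaw_apply (j : Fin K) (S : Set (PTree (Fin K))) :
    treeLaw ζ j S = ∑' w, ζ j w * listLaw ζ w {l | PTree.node j l ∈ S} := by
  rw [← lintegral_indicator_one MeasurableSet.of_discrete, lintegral_treeLaw]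
  refine tsum_congr fun w => ?_
  rw [← lintegral_indicator_one MeasurableSet.of_discrete]
  rfl

/-- Convolution formula: an event for a nonempty list of trees which is a finite disjoint union of
rectangles in terms of a function of its first tree and a function of the others. -/
theorem listLaw_cons_apply {ι X Y : Type} (j : Fin K) (w : List (Fin K))
    (S : Set (List (PTree (Fin K)))) (φ : PTree (Fin K) → X) (ψ : List (PTree (Fin K)) → Y)
    (I : Finset ι) (x : ι → X) (y : ι → Y)
    (hS : ∀ t l, t :: l ∈ S ↔ ∃ p ∈ I, φ t = x p ∧ ψ l = y p)
    (hinj : ∀ p ∈ I, ∀ q ∈ I, x p = x q → y p = y q → p = q) :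
    listLaw ζ (j :: w) S = ∑ p ∈ I, treeLaw ζ j {t | φ t = x p} * listLaw ζ w {l | ψ l = y p} := by
  classical
  rw [← lintegral_indicator_one MeasurableSet.of_discrete, lintegral_listLaw_cons]
  have h1 : ∀ t l, S.indicator (1 : List (PTree (Fin K)) → ℝ≥0∞) (t :: l) =
      ∑ p ∈ I, {t | φ t = x p}.indicator (1 : PTree (Fin K) → ℝ≥0∞) t *
        {l | ψ l = y p}.indicator (1 : List (PTree (Fin K)) → ℝ≥0∞) l := by
    intro t l
    by_cases h : t :: l ∈ S
    · obtain ⟨p, hp, h1, h2⟩ := (hS t l).1 h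
      rw [Finset.sum_eq_single_of_mem p hp]
      · simp [Set.indicator, h, h1, h2]
      · intro q hq hqp
        by_cases h3 : φ t = x q <;> by_cases h4 : ψ l = y q
        · exact absurd (hinj q hq p hp (h3.symm.trans h1) (h4.symm.trans h2)) hqp
        all_goals simp [Set.indicator, h3, h4]
    · rw [Finset.sum_eq_zero]
      · simp [Set.indicator, h]
      · intro p hp
        by_cases h3 : φ t = x p <;> by_cases h4 : ψ l = y p
        · exact absurd ((hS t l).2 ⟨p, hp, h3, h4⟩) h
        all_goals simp [Set.indicator, h3, h4]
  simp only [h1]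
  simp_rw [lintegral_finsetSum _ fun _ _ => Measurable.of_discrete,
    lintegral_const_mul _ Measurable.of_discrete]
  refine Finset.sum_congr rfl fun p _ => ?_
  rw [lintegral_mul_const _ Measurable.of_discrete,
    lintegral_indicator_one MeasurableSet.of_discrete,
    lintegral_indicator_one MeasurableSet.of_discrete]

/-- The joint law of the number of vertices in the floor of a list of trees and of its marked
reduction, decomposed according to the contribution of the first tree. -/
theorem listLaw_cons_markedReduction (j : Fin K) (w : List (Fin K)) (m : ℕ)
    (L : List (PTree β)) :
    listLaw ζ (j :: w) {l | (l.map (floorTree i)).sum = m ∧ l.flatMap (markedReduction i g) = L} =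
      ∑ p ∈ Finset.HasAntidiagonal.antidiagonal m ×ˢ Finset.range (L.length + 1),
        treeLaw ζ j {t | floorTree i t = p.1.1 ∧ markedReduction i g t = L.take p.2} *
        listLaw ζ w {l | (l.map (floorTree i)).sum = p.1.2 ∧
          l.flatMap (markedReduction i g) = L.drop p.2} := by
  have := listLaw_cons_apply ζ j w
    {l | (l.map (floorTree i)).sum = m ∧ l.flatMap (markedReduction i g) = L}
    (fun t => (floorTree i t, markedReduction i g t))
    (fun l => ((l.map (floorTree i)).sum, l.flatMap (markedReduction i g)))
    (Finset.HasAntidiagonal.antidiagonal m ×ˢ Finset.range (L.length + 1))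
    (fun p => (p.1.1, L.take p.2)) (fun p => (p.1.2, L.drop p.2)) ?_ ?_
  · simpa only [Prod.mk.injEq] using this
  · intro t l
    simp only [Set.mem_ofPred_eq, List.map_cons, List.sum_cons, List.flatMap_cons, Prod.mk.injEq,
      Finset.mem_product, Finset.HasAntidiagonal.mem_antidiagonal, Finset.mem_range]
    constructor
    · rintro ⟨h1, rfl⟩
      exact ⟨((floorTree i t, (l.map (floorTree i)).sum), (markedReduction i g t).length),
        ⟨h1, by simp⟩, ⟨rfl, by simp⟩, rfl, by simp⟩
    · rintro ⟨p, ⟨h1, h2⟩, ⟨h3, h4⟩, h5, h6⟩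
      exact ⟨by rw [h3, h5, h1], by rw [h4, h6, List.take_append_drop]⟩
  · rintro ⟨⟨a, b⟩, c⟩ hp ⟨⟨a', b'⟩, c'⟩ hq h1 h2
    simp only [Prod.mk.injEq, Finset.mem_product, Finset.mem_range] at *
    refine ⟨⟨h1.1, h2.1⟩, ?_⟩
    have := congrArg List.length h1.2
    simp only [List.length_take] at this
    omega

/-- The joint law of the numbers of vertices in the floor of a list of trees and of its first
type-`i` vertices, decomposed according to the contribution of the first tree. -/
theorem listLaw_cons_rootCount (j : Fin K) (w : List (Fin K)) (m n : ℕ) :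
    listLaw ζ (j :: w) {l | (l.map (floorTree i)).sum = m ∧ (l.map (rootCount i)).sum = n} =
      ∑ p ∈ Finset.HasAntidiagonal.antidiagonal m ×ˢ Finset.range (n + 1),
        treeLaw ζ j {t | floorTree i t = p.1.1 ∧ rootCount i t = p.2} *
        listLaw ζ w {l | (l.map (floorTree i)).sum = p.1.2 ∧
          (l.map (rootCount i)).sum = n - p.2} := by
  have := listLaw_cons_apply ζ j w
    {l | (l.map (floorTree i)).sum = m ∧ (l.map (rootCount i)).sum = n}
    (fun t => (floorTree i t, rootCount i t))
    (fun l => ((l.map (floorTree i)).sum, (l.map (rootCount i)).sum))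
    (Finset.HasAntidiagonal.antidiagonal m ×ˢ Finset.range (n + 1))
    (fun p => (p.1.1, p.2)) (fun p => (p.1.2, n - p.2)) ?_ ?_
  · simpa only [Prod.mk.injEq] using this
  · intro t l
    simp only [Set.mem_ofPred_eq, List.map_cons, List.sum_cons, Prod.mk.injEq,
      Finset.mem_product, Finset.HasAntidiagonal.mem_antidiagonal, Finset.mem_range]
    constructor
    · rintro ⟨h1, h2⟩
      exact ⟨((floorTree i t, (l.map (floorTree i)).sum), rootCount i t),
        ⟨h1, by omega⟩, ⟨rfl, rfl⟩, rfl, by simp only; omega⟩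
    · rintro ⟨p, ⟨h1, h2⟩, ⟨h3, h4⟩, h5, h6⟩
      exact ⟨by rw [h3, h5, h1], by omega⟩
  · rintro ⟨⟨a, b⟩, c⟩ hp ⟨⟨a', b'⟩, c'⟩ hq h1 h2
    simp only [Prod.mk.injEq, Finset.mem_product, Finset.mem_range] at *
    exact ⟨⟨h1.1, h2.1⟩, h1.2⟩

theorem treeLaw_eq_zero {j : Fin K} {S : Set (PTree (Fin K))} (h : ∀ l, PTree.node j l ∉ S) :
    treeLaw ζ j S = 0 := by
  rw [treeLaw_apply, ENNReal.tsum_eq_zero]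
  intro w
  have : {l | PTree.node j l ∈ S} = ∅ := Set.eq_empty_of_forall_notMem h
  rw [this, measure_empty, mul_zero]

/-- Given the number of vertices in the floor and the number of components of the reduced forest,
the components are independent marked Galton-Watson trees.  The proof is by induction on the total
size of the components, then on the number of vertices in the floor, then on the length of the
word: exploring the root of a tree decreases the first quantity if it has type `i`, and the second
one otherwise. -/
theorem listLaw_markedReduction (hP : ∀ j, IsProbabilityMeasure (treeLaw ζ j)) (w : List (Fin K))
    (m : ℕ) (L : List (PTree β)) :
    listLaw ζ w {l | (l.map (floorTree i)).sum = m ∧ l.flatMap (markedReduction i g) = L} =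
      listLaw ζ w {l | (l.map (floorTree i)).sum = m ∧ (l.map (rootCount i)).sum = L.length} *
        (L.map (labelledWeight (markedOffspring ζ i g))).prod := by
  set G := labelledWeight (markedOffspring ζ i g) with hG
  obtain ⟨s, hs⟩ : ∃ s, (L.map PTree.size).sum < s := ⟨_, Nat.lt_succ_self _⟩
  induction s generalizing w m L with
  | zero => omega
  | succ s ihs =>
    induction m using Nat.strong_induction_on generalizing w L with
    | _ m ihm =>
    have htree : ∀ j, ∀ n ≤ m, ∀ L' : List (PTree β), (L'.map PTree.size).sum < s + 1 →
        treeLaw ζ j {t | floorTree i t = n ∧ markedReduction i g t = L'} =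
        treeLaw ζ j {t | floorTree i t = n ∧ rootCount i t = L'.length} * (L'.map G).prod := by
      intro j n hn L' hL'
      by_cases hj : j = i
      · subst hj
        rcases Nat.eq_zero_or_pos n with rfl | hn0
        · rcases L' with _ | ⟨⟨x, l'⟩, _ | ⟨t', L'⟩⟩
          · rw [treeLaw_eq_zero, treeLaw_eq_zero, zero_mul]
            · intro l
              simp [rootCount_node_self]
            · intro l
              simp [markedReduction_node_self]
          · have h1 : treeLaw ζ j {t | floorTree j t = 0 ∧
                rootCount j t = [PTree.node x l'].length} = 1 := by
              rw [treeLaw_apply, ← PMF.tsum_coe (ζ j)]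
              refine tsum_congr fun w => ?_
              have : {l | PTree.node j l ∈ {t | floorTree j t = 0 ∧
                  rootCount j t = [PTree.node x l'].length}} = Set.univ := by
                ext l
                simp [floorTree_node_self, rootCount_node_self]
              rw [this, listLaw_univ]
              simp [measure_univ]
            rw [h1, one_mul, List.map_cons, List.map_nil, List.prod_singleton, hG,
              labelledWeight_node, ← hG, markedOffspring, treeLaw_apply, treeLaw_apply,
              ← ENNReal.tsum_mul_right]
            refine tsum_congr fun w => ?_
            rw [mul_assoc]
            congr 1
            have hdis : ∀ T : List (PTree (Fin K)) → Prop,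
                listLaw ζ w {l | g (l.map (floorTree j)).sum = x ∧ T l} =
                ∑' n : {n // g n = x}, listLaw ζ w {l | (l.map (floorTree j)).sum = n ∧ T l} := by
              intro T
              rw [← measure_iUnion _ fun _ => MeasurableSet.of_discrete]
              · congr 1
                ext l
                simp
              · intro a b hab
                rw [Function.onFun, Set.disjoint_left]
                rintro l ⟨h1, -⟩ ⟨h2, -⟩
                exact hab (Subtype.ext (h1.symm.trans h2))
            have e1 : {l | PTree.node j l ∈ {t | floorTree j t = 0 ∧
                markedReduction j g t = [PTree.node x l']}} =
                {l | g (l.map (floorTree j)).sum = x ∧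
                  l.flatMap (markedReduction j g) = l'} := by
              ext l
              simp [floorTree_node_self, markedReduction_node_self]
            have e2 : {l | PTree.node j l ∈ {t | g (deletedBelow j t) = x ∧
                reducedRootCount j t = l'.length}} =
                {l | g (l.map (floorTree j)).sum = x ∧ (l.map (rootCount j)).sum = l'.length} := by
              ext l
              simp [deletedBelow_node, reducedRootCount_node]
            rw [e1, e2, hdis, hdis, ← ENNReal.tsum_mul_right]
            refine tsum_congr fun n => ihs w n l' ?_
            simp only [List.map_cons, List.map_nil, List.sum_singleton, PTree.size_node] at hL'
            omega
          · rw [treeLaw_eq_zero, treeLaw_eq_zero, zero_mul]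
            · intro l
              simp [rootCount_node_self]
            · intro l
              simp [markedReduction_node_self]
        · rw [treeLaw_eq_zero, treeLaw_eq_zero, zero_mul]
          · intro l
            simp [floorTree_node_self, hn0.ne]
          · intro l
            simp [floorTree_node_self, hn0.ne]
      · rcases n with _ | n
        · rw [treeLaw_eq_zero, treeLaw_eq_zero, zero_mul]
          · intro l
            simp [floorTree_node_of_ne i hj]
          · intro l
            simp [floorTree_node_of_ne i hj]
        · rw [treeLaw_apply, treeLaw_apply, ← ENNReal.tsum_mul_right]
          refine tsum_congr fun w => ?_
          rw [mul_assoc]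
          congr 1
          have := ihm n (by omega) w L' hL'
          convert this using 3
          · ext l
            simp [floorTree_node_of_ne i hj, markedReduction_node_of_ne i g hj, add_comm 1]
          · ext l
            simp [floorTree_node_of_ne i hj, rootCount_node_of_ne i hj, add_comm 1]
    suffices ∀ n ≤ m, ∀ L' : List (PTree β), (L'.map PTree.size).sum < s + 1 →
        listLaw ζ w {l | (l.map (floorTree i)).sum = n ∧ l.flatMap (markedReduction i g) = L'} =
        listLaw ζ w {l | (l.map (floorTree i)).sum = n ∧
          (l.map (rootCount i)).sum = L'.length} * (L'.map G).prod from this m le_rfl L hs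
    clear hs
    induction w with
    | nil =>
      intro n _ L' _
      rw [listLaw]
      rcases L' with _ | ⟨t, L'⟩ <;> simp [Set.indicator]
    | cons j w ihw =>
      intro n hn L' hL'
      rw [listLaw_cons_markedReduction, listLaw_cons_rootCount, Finset.sum_mul]
      refine Finset.sum_congr rfl fun p hp => ?_
      simp only [Finset.mem_product, Finset.HasAntidiagonal.mem_antidiagonal,
        Finset.mem_range] at hp
      have hsum : ((L'.take p.2).map PTree.size).sum + ((L'.drop p.2).map PTree.size).sum =
          (L'.map PTree.size).sum := by
        rw [← List.sum_append, ← List.map_append, List.take_append_drop]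
      have hprod : ((L'.take p.2).map G).prod * ((L'.drop p.2).map G).prod = (L'.map G).prod := by
        rw [← List.prod_append, ← List.map_append, List.take_append_drop]
      rw [htree j p.1.1 (by omega) _ (by omega), ihw p.1.2 (by omega) _ (by omega), ← hprod,
        List.length_take, List.length_drop, min_eq_left (by omega)]
      ring

theorem treeLaw_markedReduction (hP : ∀ j, IsProbabilityMeasure (treeLaw ζ j)) (j : Fin K)
    (m : ℕ) (L : List (PTree β)) :
    treeLaw ζ j {t | floorTree i t = m ∧ markedReduction i g t = L} =
      treeLaw ζ j {t | floorTree i t = m ∧ rootCount i t = L.length} *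
        (L.map (labelledWeight (markedOffspring ζ i g))).prod := by
  have h1 : ∀ S : Set (List (PTree (Fin K))), listLaw ζ [j] S = treeLaw ζ j {t | [t] ∈ S} := by
    intro S
    rw [← lintegral_indicator_one MeasurableSet.of_discrete, lintegral_listLaw_cons,
      ← lintegral_indicator_one MeasurableSet.of_discrete]
    simp only [lintegral_listLaw_nil]
    rfl
  have h2 := listLaw_markedReduction ζ i g hP [j] m L
  simpa [h1] using h2

end ReducedLaw

/-! ### Concatenation of lists -/

section Concat

variable {α β : Type}

theorem flatMap_range_prefix (L : ℕ → List α) {N M : ℕ} (h : N ≤ M) :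
    (List.range N).flatMap L <+: (List.range M).flatMap L := by
  obtain ⟨d, rfl⟩ := Nat.exists_eq_add_of_le h
  rw [List.range_add, List.flatMap_append]
  exact List.prefix_append _ _

theorem concat_eq_of_lt (L : ℕ → List α) {N k : ℕ} (h : k < ((List.range N).flatMap L).length) :
    concat L k = ((List.range N).flatMap L)[k]? := by
  have h1 : k <
      ((List.range (sInf {N | k < ((List.range N).flatMap L).length})).flatMap L).length :=
    Nat.sInf_mem (s := {N | k < ((List.range N).flatMap L).length}) ⟨N, h⟩
  have h2 : sInf {N | k < ((List.range N).flatMap L).length} ≤ N := Nat.sInf_le h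
  obtain ⟨l, hl⟩ := flatMap_range_prefix L h2
  rw [concat, ← hl, List.getElem?_append_left h1]

theorem concat_eq_some_iff (L : ℕ → List α) (k : ℕ) (x : α) :
    concat L k = some x ↔ ∃ N, ((List.range N).flatMap L)[k]? = some x := by
  constructor
  · exact fun h => ⟨_, h⟩
  · rintro ⟨N, hN⟩
    rw [concat_eq_of_lt L (List.getElem?_eq_some_iff.1 hN).1, hN]

theorem concat_map (L : ℕ → List α) (g : α → β) (k : ℕ) :
    concat (fun n => (L n).map g) k = (concat L k).map g := by
  ext x
  rw [Option.map_eq_some_iff, concat_eq_some_iff]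
  simp only [← List.map_flatMap, List.getElem?_map, Option.map_eq_some_iff, concat_eq_some_iff]
  constructor
  · rintro ⟨N, y, h1, h2⟩
    exact ⟨y, ⟨N, h1⟩, h2⟩
  · rintro ⟨y, ⟨N, h1⟩, h2⟩
    exact ⟨N, y, h1, h2⟩

/-- The list of the values of `s` at the `c n` integers following the first `c 0 + ⋯ + c (n - 1)`
ones: the `n`-th chunk of the sequence `s` cut into pieces of lengths `c 0, c 1, …`. -/
def chunk (c : ℕ → ℕ) (s : ℕ → α) (n : ℕ) : List α :=
  (List.range (c n)).map fun k => s (∑ m ∈ Finset.range n, c m + k)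

theorem flatMap_chunk (c : ℕ → ℕ) (s : ℕ → α) (N : ℕ) :
    (List.range N).flatMap (chunk c s) = (List.range (∑ m ∈ Finset.range N, c m)).map s := by
  induction N with
  | zero => simp
  | succ N ih =>
    rw [List.range_succ, List.flatMap_append, ih, Finset.sum_range_succ, List.range_add,
      List.map_append]
    simp [chunk]

theorem chunk_eq_iff (c : ℕ → ℕ) (s : ℕ → α) (L : ℕ → List α) (N : ℕ) :
    (∀ n < N, chunk c s n = L n) ↔ (∀ n < N, c n = (L n).length) ∧
      (List.range ((List.range N).flatMap L).length).map s = (List.range N).flatMap L := by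
  induction N with
  | zero => simp
  | succ N ih =>
    rw [Nat.forall_lt_succ_right, Nat.forall_lt_succ_right, ih]
    have hflat : (List.range (N + 1)).flatMap L = (List.range N).flatMap L ++ L N := by
      rw [List.range_succ, List.flatMap_append]; simp
    rw [hflat, List.length_append, List.range_add, List.map_append]
    have hlen : ((List.range N).flatMap L).length = ∑ m ∈ Finset.range N, (L m).length := by
      clear hflat ih
      induction N with
      | zero => simp
      | succ N ih =>
        rw [List.range_succ, List.flatMap_append, List.length_append, ih,
          Finset.sum_range_succ]
        simp
    constructor
    · rintro ⟨⟨h1, h2⟩, h3⟩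
      have h4 : c N = (L N).length := by rw [← h3]; simp [chunk]
      refine ⟨⟨h1, h4⟩, ?_⟩
      rw [h2, ← h4]
      congr 1
      rw [List.map_map, ← h3, chunk, hlen,
        Finset.sum_congr rfl fun n hn => h1 n (Finset.mem_range.1 hn)]
      rfl
    · rintro ⟨⟨h1, h4⟩, h5⟩
      obtain ⟨h2, h6⟩ := List.append_inj h5 (by simp)
      refine ⟨⟨h1, h2⟩, ?_⟩
      rw [← h6, List.map_map, chunk, h4, hlen,
        Finset.sum_congr rfl fun n hn => h1 n (Finset.mem_range.1 hn)]
      rfl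

/-- The chunks of a sequence, put together again, give back the sequence, provided that infinitely
many of them are nonempty. -/
theorem concat_chunk (c : ℕ → ℕ) (s : ℕ → α) (hc : ∀ N, ∃ n, N ≤ n ∧ 1 ≤ c n) (k : ℕ) :
    concat (chunk c s) k = some (s k) := by
  have h : ∀ k, ∃ N, k ≤ ∑ m ∈ Finset.range N, c m := by
    intro k
    induction k with
    | zero => exact ⟨0, by simp⟩
    | succ k ih =>
      obtain ⟨N, hN⟩ := ih
      obtain ⟨n, hn, hcn⟩ := hc N
      refine ⟨n + 1, ?_⟩
      rw [Finset.sum_range_succ]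
      have : ∑ m ∈ Finset.range N, c m ≤ ∑ m ∈ Finset.range n, c m :=
        Finset.sum_le_sum_of_subset (Finset.range_mono hn)
      omega
  obtain ⟨N, hN⟩ := h (k + 1)
  rw [concat_eq_some_iff]
  exact ⟨N, by rw [flatMap_chunk, List.getElem?_map, List.getElem?_range hN]; rfl⟩

end Concat

/-! ### Laws of sequences -/

section Sequences

variable {E : Type} [MeasurableSpace E] [MeasurableSingletonClass E]

theorem infinitePi_prefix (μ : ℕ → Measure E) [∀ n, IsProbabilityMeasure (μ n)] (N : ℕ)
    (y : ℕ → E) :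
    Measure.infinitePi μ {f | ∀ n < N, f n = y n} = ∏ n ∈ Finset.range N, μ n {y n} := by
  rw [← Measure.infinitePi_pi μ fun n _ => MeasurableSet.singleton (y n)]
  congr 1
  ext f
  simp [Set.mem_pi]

theorem infinitePi_list (μ : Measure E) [IsProbabilityMeasure μ] (P : List E) :
    Measure.infinitePi (fun _ : ℕ => μ) {s | (List.range P.length).map s = P} =
      (P.map fun x => μ {x}).prod := by
  obtain ⟨e⟩ := μ.nonempty_of_neZero
  have h1 := infinitePi_prefix (fun _ : ℕ => μ) P.length fun n => P.getD n e
  have h2 : ∀ P : List E, ∏ n ∈ Finset.range P.length, μ {P.getD n e} =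
      (P.map fun x => μ {x}).prod := by
    intro P
    induction P with
    | nil => simp
    | cons x P ih =>
      rw [List.length_cons, Finset.prod_range_succ', List.map_cons, List.prod_cons, ← ih]
      simp [mul_comm]
  rw [← h2, ← h1]
  congr 1
  ext s
  simp only [Set.mem_ofPred_eq]
  rw [List.ext_getElem_iff]
  simp only [List.length_map, List.length_range, true_and, List.getElem_map, List.getElem_range]
  exact forall_congr' fun n => ⟨fun h hn => by rw [h hn hn, List.getD_eq_getElem _ _ hn],
    fun h hn _ => by rw [h hn, List.getD_eq_getElem _ _ hn]⟩

variable [Countable E]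

/-- Events which depend only on finitely many coordinates are measurable. -/
theorem measurableSet_of_firstCoordinates (N : ℕ) {S : Set (ℕ → E)}
    (hS : ∀ f f' : ℕ → E, (∀ n < N, f n = f' n) → f ∈ S → f' ∈ S) : MeasurableSet S := by
  have h : S = (fun (f : ℕ → E) (k : Fin N) => f k) ⁻¹' ((fun f k => f k) '' S) := by
    ext f
    refine ⟨fun h => ⟨f, h, rfl⟩, ?_⟩
    rintro ⟨f', h1, h2⟩
    exact hS f' f (fun n hn => congrFun h2 ⟨n, hn⟩) h1
  rw [h]
  exact (measurable_pi_lambda _ fun k => measurable_pi_apply _) (Set.to_countable _).measurableSet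

theorem measurableSet_prefix (N : ℕ) (y : ℕ → E) :
    MeasurableSet {f : ℕ → E | ∀ n < N, f n = y n} :=
  measurableSet_of_firstCoordinates N fun f f' hf h n hn => by rw [← hf n hn, h n hn]

theorem measurable_concat {α : Type} [Countable α] [MeasurableSpace (Option α)]
    (φ : E → List α) (k : ℕ) : Measurable fun f : ℕ → E => concat (fun n => φ (f n)) k := by
  have hN : ∀ N (v : Option α),
      MeasurableSet {f : ℕ → E | ((List.range N).flatMap fun n => φ (f n))[k]? = v} := by
    intro N v
    refine measurableSet_of_firstCoordinates N fun f f' hff' hf => ?_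
    rw [Set.mem_ofPred_eq] at hf ⊢
    rw [← hf]
    congr 1
    exact List.flatMap_congr fun n hn => by rw [hff' n (List.mem_range.1 hn)]
  have hsome : ∀ x, MeasurableSet {f : ℕ → E | concat (fun n => φ (f n)) k = some x} := by
    intro x
    simp only [concat_eq_some_iff, Set.ofPred_exists]
    exact MeasurableSet.iUnion fun N => hN N _
  refine measurable_to_countable' ?_
  rintro (_ | x)
  · have : (fun f : ℕ → E => concat (fun n => φ (f n)) k) ⁻¹' {none} =
        (⋃ x, {f : ℕ → E | concat (fun n => φ (f n)) k = some x})ᶜ := by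
      ext f
      rcases h : concat (fun n => φ (f n)) k with _ | x <;> simp [h]
    rw [this]
    exact (MeasurableSet.iUnion hsome).compl
  · exact hsome x

/-- A law on sequences in a countable set is determined by the probabilities of the finite
initial segments. -/
theorem eq_infinitePi_of_prefix (μ : ℕ → Measure E) [∀ n, IsProbabilityMeasure (μ n)]
    (ν : Measure (ℕ → E))
    (h : ∀ N (y : ℕ → E), ν {f | ∀ n < N, f n = y n} = ∏ n ∈ Finset.range N, μ n {y n}) :
    ν = Measure.infinitePi μ := by
  have hne : Nonempty E := (μ 0).nonempty_of_neZero
  have h' : ∀ N (z : Fin N → E), ν.map (fun f (k : Fin N) => f k) {z} =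
      Measure.pi (fun k : Fin N => μ k) {z} := by
    intro N z
    obtain ⟨e⟩ := hne
    rw [Measure.pi_singleton, Measure.map_apply
      (measurable_pi_lambda _ fun k => measurable_pi_apply _) (MeasurableSet.singleton z)]
    have h1 := h N fun n => if hn : n < N then z ⟨n, hn⟩ else e
    rw [Finset.prod_range] at h1
    convert h1 using 2
    · ext f
      simp only [Set.mem_preimage, Set.mem_singleton_iff, Set.mem_ofPred_eq, funext_iff]
      exact ⟨fun h n hn => by rw [dif_pos hn, ← h], fun h k => by rw [h k k.2, dif_pos k.2]⟩
    · simp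
  refine Measure.eq_infinitePi μ fun s t ht => ?_
  obtain ⟨N, hN⟩ : ∃ N, ∀ n ∈ s, n < N :=
    ⟨s.sup id + 1, fun n hn => Nat.lt_succ_of_le (Finset.le_sup (f := id) hn)⟩
  classical
  have h1 : ν.map (fun f (k : Fin N) => f k) = Measure.pi (fun k : Fin N => μ k) :=
    Measure.ext_of_singleton (h' N)
  have h2 : Set.pi s t = (fun f (k : Fin N) => f k) ⁻¹'
      (Set.univ.pi fun k : Fin N => if (k : ℕ) ∈ s then t k else Set.univ) := by
    ext f
    simp only [Set.mem_pi, Finset.mem_coe, Set.mem_preimage, Set.mem_univ, true_imp_iff]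
    constructor
    · intro hf k
      split_ifs with hk
      · exact hf k hk
      · trivial
    · intro hf n hn
      have := hf ⟨n, hN n hn⟩
      simpa [hn] using this
  rw [h2, ← Measure.map_apply (f := fun (f : ℕ → E) (k : Fin N) => f k)
    (measurable_pi_lambda _ fun k => measurable_pi_apply _)
    (MeasurableSet.univ_pi fun k => by split_ifs; exacts [ht k, MeasurableSet.univ]), h1,
    Measure.pi_pi, ← Finset.prod_range fun n => μ n (if n ∈ s then t n else Set.univ)]
  rw [← Finset.prod_subset (s₁ := s) fun n hn => Finset.mem_range.2 (hN n hn)]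
  · exact Finset.prod_congr rfl fun n hn => by rw [if_pos hn]
  · intro n _ hn
    rw [if_neg hn, measure_univ]

end Sequences

/-! ### Cutting a sequence of independent trees into chunks of random lengths -/

section Chunks

variable {β : Type} [Countable β]

theorem measurable_map_range_add (C c : ℕ) :
    Measurable fun s : ℕ → PTree β => (List.range c).map fun k => s (C + k) := by
  refine measurable_to_countable' fun L => ?_
  refine measurableSet_of_firstCoordinates (C + c) fun s s' hs h => ?_
  rw [Set.mem_preimage, Set.mem_singleton_iff] at h ⊢
  rw [← h]
  exact List.map_congr_left fun k hk => by rw [hs _ (by have := List.mem_range.1 hk; omega)]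

theorem measurable_chunk :
    Measurable fun q : (ℕ → ℕ × ℕ) × (ℕ → PTree β) => fun n =>
      ((q.1 n).1, chunk (fun n => (q.1 n).2) q.2 n) := by
  refine measurable_pi_lambda _ fun n => ?_
  refine Measurable.prodMk (by fun_prop) ?_
  have h1 : Measurable fun p : (ℕ × ℕ) × (ℕ → PTree β) =>
      (List.range p.1.2).map fun k => p.2 (p.1.1 + k) :=
    measurable_from_prod_countable_right fun p => measurable_map_range_add p.1 p.2
  have h2 : Measurable fun q : (ℕ → ℕ × ℕ) × (ℕ → PTree β) =>
      ((∑ m ∈ Finset.range n, (q.1 m).2, (q.1 n).2), q.2) := by fun_prop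
  exact h1.comp h2

/-- If the lists of a sequence are, given their lengths and some integer-valued marks, made of
independent trees with law `G`, then the sequence has the law of the chunks, with the prescribed
lengths, of a sequence of independent trees with law `G` which is independent of the lengths and
of the marks. -/
theorem map_chunk_eq_infinitePi (G : Measure (PTree β)) [IsProbabilityMeasure G]
    (κ : ℕ → Measure (ℕ × ℕ)) [∀ n, IsProbabilityMeasure (κ n)]
    (ρ : ℕ → Measure (ℕ × List (PTree β))) [∀ n, IsProbabilityMeasure (ρ n)]
    (h : ∀ n m L, ρ n {(m, L)} = κ n {(m, L.length)} * (L.map fun s => G {s}).prod) :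
    ((Measure.infinitePi κ).prod (Measure.infinitePi fun _ : ℕ => G)).map
      (fun q n => ((q.1 n).1, chunk (fun n => (q.1 n).2) q.2 n)) = Measure.infinitePi ρ := by
  refine eq_infinitePi_of_prefix ρ _ fun N y => ?_
  rw [Measure.map_apply measurable_chunk (measurableSet_prefix N y)]
  set P := (List.range N).flatMap fun n => (y n).2 with hP
  have hset : (fun (q : (ℕ → ℕ × ℕ) × (ℕ → PTree β)) n =>
      ((q.1 n).1, chunk (fun n => (q.1 n).2) q.2 n)) ⁻¹' {f | ∀ n < N, f n = y n} =
      {k | ∀ n < N, k n = ((y n).1, (y n).2.length)} ×ˢ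
        {s | (List.range P.length).map s = P} := by
    ext ⟨k, s⟩
    have h1 := chunk_eq_iff (fun n => (k n).2) s (fun n => (y n).2) N
    simp only [Set.mem_preimage, Set.mem_ofPred_eq, Set.mem_prod, Prod.ext_iff]
    constructor
    · intro h
      obtain ⟨h2, h3⟩ := h1.1 fun n hn => (h n hn).2
      exact ⟨fun n hn => ⟨(h n hn).1, h2 n hn⟩, h3⟩
    · rintro ⟨h2, h3⟩ n hn
      exact ⟨(h2 n hn).1, h1.2 ⟨fun n hn => (h2 n hn).2, h3⟩ n hn⟩
  rw [hset, Measure.prod_prod, infinitePi_prefix, infinitePi_list]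
  rw [Finset.prod_congr rfl fun n _ => h n (y n).1 (y n).2]
  rw [Finset.prod_mul_distrib]
  congr 1
  have hprod : ∀ N, (((List.range N).flatMap fun n => (y n).2).map fun s => G {s}).prod =
      ∏ n ∈ Finset.range N, ((y n).2.map fun s => G {s}).prod := by
    intro N
    induction N with
    | zero => simp
    | succ N ih =>
      rw [List.range_succ, List.flatMap_append, List.map_append, List.prod_append,
        Finset.prod_range_succ, ih]
      simp
  exact hprod N

end Chunks

/-! ### Marks in depth-first order -/

section DepthFirst

variable {β : Type}

/-- Grafting: the forest whose first component has a root with mark `p.1` and the first `p.2` trees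
of the forest `s` as subtrees at its children, and whose other components are the other trees of
`s`. -/
def graft (p : β × ℕ) (s : ℕ → PTree β) : ℕ → PTree β
  | 0 => .node p.1 ((List.range p.2).map s)
  | n + 1 => s (p.2 + n)

theorem PTree.labels_ne_nil (t : PTree β) : t.labels ≠ [] := by
  cases t
  simp [PTree.labels_node]

theorem le_length_flatMap_labels (s : ℕ → PTree β) (N : ℕ) :
    N ≤ ((List.range N).flatMap fun n => (s n).labels).length := by
  induction N with
  | zero => simp
  | succ N ih =>
    rw [List.range_succ, List.flatMap_append, List.length_append]
    have := List.length_pos_iff.2 (s N).labels_ne_nil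
    simp only [List.flatMap_cons, List.flatMap_nil, List.append_nil]
    omega

theorem flatMap_labels_graft (p : β × ℕ) (s : ℕ → PTree β) (M : ℕ) :
    ((List.range (M + 1)).flatMap fun n => (graft p s n).labels) =
      p.1 :: (List.range (p.2 + M)).flatMap fun n => (s n).labels := by
  rw [List.range_succ_eq_map, List.flatMap_cons, List.flatMap_map, List.range_add,
    List.flatMap_append, List.flatMap_map]
  simp only [graft, PTree.labels_node, List.flatMap_map, List.cons_append]

theorem concat_labels_graft_zero (p : β × ℕ) (s : ℕ → PTree β) :
    concat (fun n => (graft p s n).labels) 0 = some p.1 := by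
  rw [concat_eq_some_iff]
  exact ⟨0 + 1, by rw [flatMap_labels_graft]; rfl⟩

theorem concat_labels_graft_succ (p : β × ℕ) (s : ℕ → PTree β) (n : ℕ) :
    concat (fun n => (graft p s n).labels) (n + 1) = concat (fun n => (s n).labels) n := by
  have h1 : n < ((List.range (p.2 + (n + 1))).flatMap fun n => (s n).labels).length :=
    lt_of_lt_of_le (by omega) (le_length_flatMap_labels s (p.2 + (n + 1)))
  rw [concat_eq_of_lt _ h1, concat_eq_of_lt _ (N := n + 1 + 1), flatMap_labels_graft,
    List.getElem?_cons_succ]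
  rw [flatMap_labels_graft, List.length_cons]
  omega

variable [Countable β] [MeasurableSpace β] [DiscreteMeasurableSpace β]

theorem measurable_graft :
    Measurable fun q : (β × ℕ) × (ℕ → PTree β) => graft q.1 q.2 := by
  refine measurable_from_prod_countable_right fun p => ?_
  refine measurable_pi_lambda _ fun n => ?_
  rcases n with _ | n
  · have := (Measurable.of_discrete (f := PTree.node p.1)).comp (measurable_map_range_add 0 p.2)
    simp only [zero_add] at this
    exact this
  · exact measurable_pi_apply (p.2 + n)

variable (Θ : Measure (β × ℕ)) [IsProbabilityMeasure Θ] (G : Measure (PTree β))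
  [IsProbabilityMeasure G]

/-- The law of a Galton-Watson forest is invariant under grafting with an independent mark and
number of children. -/
theorem map_graft_eq
    (hG : ∀ x l, G {PTree.node x l} = Θ {(x, l.length)} * (l.map fun s => G {s}).prod) :
    (Θ.prod (Measure.infinitePi fun _ : ℕ => G)).map (fun q => graft q.1 q.2) =
      Measure.infinitePi fun _ : ℕ => G := by
  refine eq_infinitePi_of_prefix _ _ fun N y => ?_
  rw [Measure.map_apply measurable_graft (measurableSet_prefix N y)]
  rcases N with _ | N
  · simp
  obtain ⟨x, l, hxl⟩ : ∃ x l, y 0 = PTree.node x l := ⟨_, _, (y 0).node_label_children.symm⟩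
  set P := l ++ (List.range N).map fun n => y (n + 1) with hP
  have hset : (fun q : (β × ℕ) × (ℕ → PTree β) => graft q.1 q.2) ⁻¹' {f | ∀ n < N + 1, f n = y n} =
      {(x, l.length)} ×ˢ {s | (List.range P.length).map s = P} := by
    ext ⟨⟨x', c⟩, s⟩
    have h1 : (List.range P.length).map s = P ↔ (List.range l.length).map s = l ∧
        (List.range N).map (fun n => s (l.length + n)) = (List.range N).map fun n => y (n + 1) := by
      rw [hP, List.length_append, List.range_add, List.map_append, List.map_map]
      constructor
      · intro h
        simpa using List.append_inj h (by simp)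
      · rintro ⟨h2, h3⟩
        simp only [h2, List.length_map, List.length_range]
        rw [← h3]
        rfl
    have h2 : (List.range N).map (fun n => s (l.length + n)) =
        (List.range N).map (fun n => y (n + 1)) ↔ ∀ n < N, s (l.length + n) = y (n + 1) := by
      rw [List.map_inj_left]
      simp
    simp only [Set.mem_preimage, Set.mem_ofPred_eq, Set.mem_prod, Set.mem_singleton_iff, h1, h2,
      Prod.mk.injEq]
    constructor
    · intro h
      have h0 := h 0 (by omega)
      simp only [graft, hxl, PTree.node.injEq] at h0
      have hc : c = l.length := by rw [← h0.2]; simp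
      subst hc
      exact ⟨⟨h0.1, rfl⟩, h0.2, fun n hn => h (n + 1) (by omega)⟩
    · rintro ⟨⟨rfl, rfl⟩, h3, h4⟩ n hn
      rcases n with _ | n
      · simp only [graft, h3, hxl]
      · exact h4 n (by omega)
  rw [hset, Measure.prod_prod, infinitePi_list, Finset.prod_range_succ', hxl, hG, hP,
    List.map_append, List.prod_append, ← mul_assoc, mul_comm]
  congr 1
  clear hset hP P
  induction N with
  | zero => simp
  | succ N ih => rw [List.range_succ, Finset.prod_range_succ, ← ih]; simp

/-- The marks of a Galton-Watson forest, read in depth-first order, are independent and identically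
distributed. -/
theorem infinitePi_concat_labels
    (hG : ∀ x l, G {PTree.node x l} = Θ {(x, l.length)} * (l.map fun s => G {s}).prod)
    (N : ℕ) (y : ℕ → β) :
    Measure.infinitePi (fun _ : ℕ => G)
        {s | ∀ n < N, concat (fun n => (s n).labels) n = some (y n)} =
      ∏ n ∈ Finset.range N, Θ.map Prod.fst {y n} := by
  let _ : MeasurableSpace (Option β) := ⊤
  have hmeas : ∀ (N : ℕ) (y : ℕ → β), MeasurableSet
      {s : ℕ → PTree β | ∀ n < N, concat (fun n => (s n).labels) n = some (y n)} := by
    intro N y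
    simp only [Set.ofPred_forall]
    exact MeasurableSet.iInter fun n => MeasurableSet.iInter fun _ =>
      measurable_concat PTree.labels n (MeasurableSpace.measurableSet_top (s := {some (y n)}))
  induction N generalizing y with
  | zero => simp
  | succ N ih =>
    rw [← map_graft_eq Θ G hG, Measure.map_apply measurable_graft (hmeas _ y)]
    have hset : (fun q : (β × ℕ) × (ℕ → PTree β) => graft q.1 q.2) ⁻¹'
        {s | ∀ n < N + 1, concat (fun n => (s n).labels) n = some (y n)} =
        (Prod.fst ⁻¹' {y 0}) ×ˢ
          {s | ∀ n < N, concat (fun n => (s n).labels) n = some (y (n + 1))} := by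
      ext ⟨p, s⟩
      simp only [Set.mem_preimage, Set.mem_ofPred_eq, Set.mem_prod, Set.mem_singleton_iff]
      rw [Nat.forall_lt_succ_left]
      simp only [concat_labels_graft_zero, concat_labels_graft_succ, Option.some.injEq]
    rw [hset, Measure.prod_prod, ih, Finset.prod_range_succ', mul_comm,
      Measure.map_apply measurable_fst (MeasurableSet.singleton _)]

end DepthFirst

/-! ### The reduced forest is a Galton-Watson forest -/

section ReducedForest

variable {K : ℕ} (ζ : Fin K → PMF (List (Fin K))) (i : Fin K)

theorem treeLaw_congr_set {j : Fin K} {S T : Set (PTree (Fin K))}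
    (h : ∀ l, PTree.node j l ∈ S ↔ PTree.node j l ∈ T) : treeLaw ζ j S = treeLaw ζ j T := by
  simp only [treeLaw_apply, h]

section Marked

variable {β : Type} (g : ℕ → β)

/-- The law of the marked reduced tree under `P^{(i)}`. -/
noncomputable def reducedTreeLaw : Measure (PTree β) :=
  (treeLaw ζ i).map fun t =>
    .node (g (deletedBelow i t)) (t.children.flatMap (markedReduction i g))

theorem reducedTreeLaw_singleton (hP : ∀ j, IsProbabilityMeasure (treeLaw ζ j)) (s : PTree β) :
    reducedTreeLaw ζ i g {s} = labelledWeight (markedOffspring ζ i g) s := by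
  rw [reducedTreeLaw, Measure.map_apply .of_discrete MeasurableSet.of_discrete]
  have h1 := treeLaw_markedReduction ζ i g hP i 0 [s]
  have h2 : treeLaw ζ i {t | floorTree i t = 0 ∧ rootCount i t = [s].length} = 1 := by
    rw [treeLaw_congr_set ζ (T := Set.univ)
      fun l => by simp [floorTree_node_self, rootCount_node_self], measure_univ]
  rw [h2, one_mul, List.map_cons, List.map_nil, List.prod_singleton] at h1
  rw [← h1]
  refine treeLaw_congr_set ζ fun l => ?_
  simp [floorTree_node_self, markedReduction_node_self, deletedBelow_node]

/-- The sequence of the reduced trees of a forest: the reduced forest, with marks. -/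
noncomputable def markedForest (f : ℕ → PTree (Fin K)) : ℕ → Option (PTree β) :=
  concat fun n => markedReduction i g (f n)

theorem measurable_markedForest [Countable β] : Measurable (markedForest i g) :=
  measurable_pi_lambda _ fun k => measurable_concat (markedReduction i g) k

/-- Almost surely, infinitely many components of the forest contain a vertex of type `i`. -/
theorem ae_frequently_rootCount (κ : Fin K → Measure (ℕ × ℕ)) [∀ j, IsProbabilityMeasure (κ j)]
    (hpos : ∀ j, κ j {p | p.2 = 0} < 1) (x : ℕ → Fin K) :
    ∀ᵐ k ∂(Measure.infinitePi fun n => κ (x n)), ∀ N, ∃ n, N ≤ n ∧ 1 ≤ (k n).2 := by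
  rw [ae_all_iff]
  intro N
  rw [ae_iff]
  have hne : Nonempty (Fin K) := ⟨x 0⟩
  obtain ⟨j₀, hj₀⟩ := Finite.exists_max fun j => κ j {p | p.2 = 0}
  have hle : ∀ M : ℕ, Measure.infinitePi (fun n => κ (x n))
      {k | ¬ ∃ n, N ≤ n ∧ 1 ≤ (k n).2} ≤ κ j₀ {p | p.2 = 0} ^ M := by
    intro M
    calc _ ≤ Measure.infinitePi (fun n => κ (x n))
          (Set.pi (Finset.Ico N (N + M)) fun _ => {p : ℕ × ℕ | p.2 = 0}) := by
          refine measure_mono fun k hk n hn => ?_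
          rw [Set.mem_ofPred_eq, not_exists] at hk
          have := hk n
          rw [Finset.mem_coe, Finset.mem_Ico] at hn
          rw [Set.mem_ofPred_eq]
          by_contra h
          exact this ⟨hn.1, Nat.one_le_iff_ne_zero.2 h⟩
      _ = ∏ n ∈ Finset.Ico N (N + M), κ (x n) {p | p.2 = 0} :=
          Measure.infinitePi_pi _ fun _ _ => MeasurableSet.of_discrete
      _ ≤ ∏ n ∈ Finset.Ico N (N + M), κ j₀ {p | p.2 = 0} :=
          Finset.prod_le_prod' fun n _ => hj₀ (x n)
      _ = _ := by simp
  have hlim := ENNReal.tendsto_pow_atTop_nhds_zero_of_lt_one (hpos j₀)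
  exact le_antisymm (ge_of_tendsto' hlim hle) zero_le

/-- The floors of the components are independent of the marked reduced forest, which is made of
independent Galton-Watson trees. -/
theorem map_floor_markedForest [Countable β] [∀ j, IsProbabilityMeasure (treeLaw ζ j)]
    (hpos : ∀ j, treeLaw ζ j {t | rootCount i t = 0} < 1) (x : ℕ → Fin K) :
    (Measure.infinitePi fun n => treeLaw ζ (x n)).map
        (fun f => ((fun n => floorTree i (f n)), markedForest i g f)) =
      (Measure.infinitePi fun n => (treeLaw ζ (x n)).map (floorTree i)).prod
        ((Measure.infinitePi fun _ : ℕ => reducedTreeLaw ζ i g).map fun s n => some (s n)) := by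
  have hP : ∀ j, IsProbabilityMeasure (treeLaw ζ j) := inferInstance
  have hG : IsProbabilityMeasure (reducedTreeLaw ζ i g) :=
    Measure.isProbabilityMeasure_map (Measurable.of_discrete.aemeasurable)
  set κ : Fin K → Measure (ℕ × ℕ) := fun j =>
    (treeLaw ζ j).map fun t => (floorTree i t, rootCount i t) with hκ
  set ρ : Fin K → Measure (ℕ × List (PTree β)) := fun j =>
    (treeLaw ζ j).map fun t => (floorTree i t, markedReduction i g t) with hρ
  have hκP : ∀ j, IsProbabilityMeasure (κ j) := fun j =>
    Measure.isProbabilityMeasure_map (Measurable.of_discrete.aemeasurable)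
  have hρP : ∀ j, IsProbabilityMeasure (ρ j) := fun j =>
    Measure.isProbabilityMeasure_map (Measurable.of_discrete.aemeasurable)
  have hκρ : ∀ j m L, ρ j {(m, L)} =
      κ j {(m, L.length)} * (L.map fun s => reducedTreeLaw ζ i g {s}).prod := by
    intro j m L
    simp only [reducedTreeLaw_singleton ζ i g hP]
    rw [hρ, hκ]
    dsimp only
    rw [Measure.map_apply .of_discrete MeasurableSet.of_discrete,
      Measure.map_apply .of_discrete MeasurableSet.of_discrete]
    convert treeLaw_markedReduction ζ i g hP j m L using 3 <;> (ext t; simp)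
  have hchunk := map_chunk_eq_infinitePi (reducedTreeLaw ζ i g) (fun n => κ (x n))
    (fun n => ρ (x n)) fun n => hκρ (x n)
  have hρpi : (Measure.infinitePi fun n => treeLaw ζ (x n)).map
      (fun f n => (floorTree i (f n), markedReduction i g (f n))) =
      Measure.infinitePi fun n => ρ (x n) :=
    Measure.infinitePi_map_pi (fun n => treeLaw ζ (x n))
      (f := fun _ t => (floorTree i t, markedReduction i g t)) fun n => Measurable.of_discrete
  have hκpi : (Measure.infinitePi fun n => κ (x n)).map (fun k n => (k n).1) =
      Measure.infinitePi fun n => (treeLaw ζ (x n)).map (floorTree i) := by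
    rw [Measure.infinitePi_map_pi (fun n => κ (x n)) (f := fun _ => Prod.fst)
      fun n => Measurable.of_discrete]
    congr 1
    ext1 n
    rw [hκ]
    dsimp only
    rw [Measure.map_map .of_discrete .of_discrete]
    rfl
  -- The floors and the concatenation of the reduced trees, as functions of the sequence of pairs.
  have hZ : Measurable fun y : ℕ → ℕ × List (PTree β) =>
      ((fun n => (y n).1), fun k => concat (fun n => (y n).2) k) :=
    Measurable.prodMk (measurable_pi_lambda _ fun n => by fun_prop)
      (measurable_pi_lambda _ fun k => measurable_concat Prod.snd k)
  have hsome : Measurable fun (s : ℕ → PTree β) (n : ℕ) => some (s n) :=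
    measurable_pi_lambda _ fun n => Measurable.of_discrete.comp (measurable_pi_apply n)
  have h1 : (Measure.infinitePi fun n => treeLaw ζ (x n)).map
        (fun f => ((fun n => floorTree i (f n)), markedForest i g f)) =
      (Measure.infinitePi fun n => ρ (x n)).map fun y =>
        ((fun n => (y n).1), fun k => concat (fun n => (y n).2) k) := by
    have hR : Measurable fun (f : ℕ → PTree (Fin K)) (n : ℕ) =>
        (floorTree i (f n), markedReduction i g (f n)) :=
      measurable_pi_lambda _ fun n =>
        (Measurable.of_discrete (f := fun t => (floorTree i t, markedReduction i g t))).comp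
          (measurable_pi_apply n)
    rw [← hρpi, Measure.map_map hZ hR]
    rfl
  rw [h1, ← hchunk, Measure.map_map hZ measurable_chunk, ← hκpi,
    Measure.map_prod_map _ _ (measurable_pi_lambda _ fun n => by fun_prop) hsome]
  refine Measure.map_congr ?_
  have hae : ∀ᵐ k ∂(Measure.infinitePi fun n => κ (x n)), ∀ N, ∃ n, N ≤ n ∧ 1 ≤ (k n).2 := by
    refine ae_frequently_rootCount κ (fun j => ?_) x
    rw [hκ]
    dsimp only
    rw [Measure.map_apply .of_discrete MeasurableSet.of_discrete]
    exact hpos j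
  have hae' := (Measure.quasiMeasurePreserving_fst (μ := Measure.infinitePi fun n => κ (x n))
    (ν := Measure.infinitePi fun _ : ℕ => reducedTreeLaw ζ i g)).ae hae
  filter_upwards [hae'] with q hq
  refine Prod.ext rfl (funext fun k => ?_)
  exact concat_chunk (fun n => (q.1 n).2) q.2 hq k

variable [Countable β] [MeasurableSpace β] [DiscreteMeasurableSpace β]

/-- The joint law, under `P^{(i)}`, of the mark of the root and of its number of children in the
reduced tree. -/
noncomputable def markedOffspringLaw : Measure (β × ℕ) :=
  (treeLaw ζ i).map fun t => (g (deletedBelow i t), reducedRootCount i t)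

theorem markedOffspringLaw_singleton (x : β) (c : ℕ) :
    markedOffspringLaw ζ i g {(x, c)} = markedOffspring ζ i g x c := by
  rw [markedOffspringLaw, Measure.map_apply .of_discrete MeasurableSet.of_discrete, markedOffspring]
  congr 1
  ext t
  simp

theorem reducedTreeLaw_node (hP : ∀ j, IsProbabilityMeasure (treeLaw ζ j)) (x : β)
    (l : List (PTree β)) :
    reducedTreeLaw ζ i g {PTree.node x l} =
      markedOffspringLaw ζ i g {(x, l.length)} *
        (l.map fun s => reducedTreeLaw ζ i g {s}).prod := by
  simp only [reducedTreeLaw_singleton ζ i g hP, markedOffspringLaw_singleton, labelledWeight_node]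

end Marked

theorem reduction_eq (f : ℕ → PTree (Fin K)) :
    reduction i f = markedForest i (fun _ => (0 : Fin 1)) f := by
  funext k
  rw [reduction, labelledReduction, ← concat_map]
  rfl

/-- The marks of a marked forest, in depth-first order (by convention `0` after the last one). -/
noncomputable def marksInOrder (u : ℕ → Option (PTree ℕ)) (n : ℕ) : ℕ :=
  (concat (fun k => (u k).elim [] PTree.labels) n).elim 0 id

/-- The numbers of deleted vertices are the marks, in depth-first order, of the forest marked by
these numbers. -/
theorem deletedCount_eq (n : ℕ) (f : ℕ → PTree (Fin K)) :
    deletedCount i n f = marksInOrder (markedForest i id f) n := by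
  have h1 : ∀ k, ((labelledReduction i f k).elim [] PTree.labels).map (deletedBelow i) =
      (markedForest i id f k).elim [] PTree.labels := by
    intro k
    have : markedForest i id f k =
        (labelledReduction i f k).map (PTree.relabel (deletedBelow i)) := by
      rw [labelledReduction, ← concat_map]
      rfl
    rw [this]
    rcases labelledReduction i f k with _ | t
    · rfl
    · simp [PTree.labels_relabel]
  rw [deletedCount, forestLabels, marksInOrder]
  simp only [← h1]
  rw [concat_map]
  rcases concat (fun k => (labelledReduction i f k).elim [] PTree.labels) n with _ | t <;> rfl

theorem measurable_marksInOrder : Measurable marksInOrder := by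
  refine measurable_pi_lambda _ fun n => ?_
  let _ : MeasurableSpace (Option ℕ) := ⊤
  exact (measurable_from_top (f := fun o : Option ℕ => o.elim 0 id)).comp
    (measurable_concat (E := Option (PTree ℕ)) (fun o => o.elim [] PTree.labels) n)

theorem marksInOrder_some (s : ℕ → PTree ℕ) (n m : ℕ) :
    marksInOrder (fun k => some (s k)) n = m ↔ concat (fun k => (s k).labels) n = some m := by
  simp only [marksInOrder, Option.elim_some]
  have h := concat_eq_of_lt (fun k => (s k).labels) (le_length_flatMap_labels s (n + 1))
  rw [h, List.getElem?_eq_getElem (le_length_flatMap_labels s (n + 1))]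
  simp

/-- The numbers of vertices in the floors of the components are independent of the numbers of
vertices deleted below the vertices of the reduced forest, and the latter are independent and
identically distributed. -/
theorem map_floorCount_deletedCount [∀ j, IsProbabilityMeasure (treeLaw ζ j)]
    (hpos : ∀ j, treeLaw ζ j {t | rootCount i t = 0} < 1) (x : ℕ → Fin K) :
    (Measure.infinitePi fun n => treeLaw ζ (x n)).map
        (fun f => ((fun n => floorCount i n f), fun n => deletedCount i n f)) =
      (Measure.infinitePi fun n => (treeLaw ζ (x n)).map (floorTree i)).prod
        (Measure.infinitePi fun _ : ℕ => (treeLaw ζ i).map (deletedBelow i)) := by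
  have hP : ∀ j, IsProbabilityMeasure (treeLaw ζ j) := inferInstance
  have hG : IsProbabilityMeasure (reducedTreeLaw ζ i (id : ℕ → ℕ)) :=
    Measure.isProbabilityMeasure_map (Measurable.of_discrete.aemeasurable)
  have hΘ : IsProbabilityMeasure (markedOffspringLaw ζ i (id : ℕ → ℕ)) :=
    Measure.isProbabilityMeasure_map (Measurable.of_discrete.aemeasurable)
  have hD : IsProbabilityMeasure ((treeLaw ζ i).map (deletedBelow i)) :=
    Measure.isProbabilityMeasure_map (Measurable.of_discrete.aemeasurable)
  have hF : ∀ n, IsProbabilityMeasure ((treeLaw ζ (x n)).map (floorTree i)) := fun n =>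
    Measure.isProbabilityMeasure_map (Measurable.of_discrete.aemeasurable)
  have hfst : (markedOffspringLaw ζ i (id : ℕ → ℕ)).map Prod.fst =
      (treeLaw ζ i).map (deletedBelow i) := by
    rw [markedOffspringLaw, Measure.map_map .of_discrete .of_discrete]
    rfl
  have hsome : Measurable fun (s : ℕ → PTree ℕ) (n : ℕ) => some (s n) :=
    measurable_pi_lambda _ fun n => Measurable.of_discrete.comp (measurable_pi_apply n)
  have hmarks : ((Measure.infinitePi fun _ : ℕ => reducedTreeLaw ζ i (id : ℕ → ℕ)).map
      fun s n => some (s n)).map marksInOrder =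
      Measure.infinitePi fun _ : ℕ => (treeLaw ζ i).map (deletedBelow i) := by
    refine eq_infinitePi_of_prefix _ _ fun N y => ?_
    rw [Measure.map_map measurable_marksInOrder hsome,
      Measure.map_apply (measurable_marksInOrder.comp hsome) (measurableSet_prefix N y), ← hfst,
      ← infinitePi_concat_labels _ _ (reducedTreeLaw_node ζ i id hP)]
    congr 1
    ext s
    simp only [Set.mem_preimage, Set.mem_ofPred_eq, Function.comp_apply, marksInOrder_some]
  have h1 : (fun f : ℕ → PTree (Fin K) =>
      ((fun n => floorCount i n f), fun n => deletedCount i n f)) =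
      Prod.map id marksInOrder ∘ fun f => ((fun n => floorTree i (f n)), markedForest i id f) := by
    funext f
    refine Prod.ext rfl (funext fun n => deletedCount_eq i n f)
  have hmeas : Measurable fun f : ℕ → PTree (Fin K) =>
      ((fun n => floorTree i (f n)), markedForest i (id : ℕ → ℕ) f) :=
    Measurable.prodMk (measurable_pi_lambda _ fun n =>
      Measurable.of_discrete.comp (measurable_pi_apply n)) (measurable_markedForest i id)
  rw [h1, ← Measure.map_map (measurable_id.prodMap measurable_marksInOrder) hmeas,
    map_floor_markedForest ζ i id hpos x]
  have hS : IsProbabilityMeasure ((Measure.infinitePi fun _ : ℕ =>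
    reducedTreeLaw ζ i (id : ℕ → ℕ)).map fun s n => some (s n)) :=
    Measure.isProbabilityMeasure_map hsome.aemeasurable
  rw [← Measure.map_prod_map _ _ measurable_id measurable_marksInOrder, Measure.map_id, hmarks]

end ReducedForest

/-! ### Real and extended nonnegative matrices and vectors -/

section Conversion

variable {K : ℕ}

theorem map_toReal_pow {m : Matrix (Fin K) (Fin K) ℝ≥0∞} (hm : ∀ j k, m j k ≠ ∞) (n : ℕ) :
    (∀ j k, (m ^ n) j k ≠ ∞) ∧ (m.map ENNReal.toReal) ^ n = (m ^ n).map ENNReal.toReal := by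
  induction n with
  | zero =>
    refine ⟨fun j k => ?_, ?_⟩
    · rw [pow_zero, Matrix.one_apply]
      split_ifs <;> simp
    · simp only [pow_zero]
      ext j k
      rw [Matrix.map_apply, Matrix.one_apply, Matrix.one_apply]
      split_ifs <;> simp
  | succ n ih =>
    refine ⟨fun j k => ?_, ?_⟩
    · rw [pow_succ, Matrix.mul_apply]
      exact ENNReal.sum_ne_top.2 fun l _ => ENNReal.mul_ne_top (ih.1 j l) (hm l k)
    · ext j k
      rw [pow_succ, ih.2, pow_succ, Matrix.mul_apply, Matrix.map_apply, Matrix.mul_apply,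
        ENNReal.toReal_sum fun l _ => ENNReal.mul_ne_top (ih.1 j l) (hm l k)]
      simp only [Matrix.map_apply, ENNReal.toReal_mul]

theorem realMeanMatrix_irreducible {μ : Fin K → PMF (Fin K → ℕ)} (h : IsIrreducible μ)
    (hm : ∀ j k, meanMatrix μ j k ≠ ∞) (j k : Fin K) :
    ∃ n : ℕ, 1 ≤ n ∧ 0 < (realMeanMatrix μ ^ n) j k := by
  obtain ⟨n, hn, hpos⟩ := h j k
  refine ⟨n, hn, ?_⟩
  rw [realMeanMatrix, (map_toReal_pow hm n).2, Matrix.map_apply]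
  exact ENNReal.toReal_pos hpos.ne' ((map_toReal_pow hm n).1 j k)

theorem sum_ofReal_mul_meanMatrix {μ : Fin K → PMF (Fin K → ℕ)}
    (hm : ∀ j k, meanMatrix μ j k ≠ ∞) {a : Fin K → ℝ} (ha0 : ∀ j, 0 ≤ a j)
    (ha : Matrix.vecMul a (realMeanMatrix μ) = a) (k : Fin K) :
    ∑ j, ENNReal.ofReal (a j) * meanMatrix μ j k = ENNReal.ofReal (a k) := by
  have h := congrFun ha k
  rw [Matrix.vecMul, dotProduct] at h
  have hr : ∀ j, realMeanMatrix μ j k = (meanMatrix μ j k).toReal := fun _ => rfl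
  simp only [hr] at h
  rw [← h, ENNReal.ofReal_sum_of_nonneg fun j _ => mul_nonneg (ha0 j) ENNReal.toReal_nonneg]
  refine Finset.sum_congr rfl fun j _ => ?_
  rw [ENNReal.ofReal_mul (ha0 j), ENNReal.ofReal_toReal (hm j k)]

end Conversion

/-! ### Moments of integer-valued random variables -/

section MomentTransfer

variable {Ω : Type} [MeasurableSpace Ω] {P : Measure Ω} {X : Ω → ℕ}

theorem memLp_two_of_finiteMoment (hX : Measurable X) (h : FiniteMoment X P 2) :
    MemLp (fun ω => (X ω : ℝ)) 2 P := by
  refine ⟨(measurable_of_countable (fun n : ℕ => (n : ℝ))).comp hX |>.aestronglyMeasurable, ?_⟩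
  rw [eLpNorm_lt_top_iff_lintegral_rpow_enorm_lt_top two_ne_zero ENNReal.ofNat_ne_top]
  refine lt_of_le_of_lt (lintegral_mono fun ω => ?_) h
  simp

theorem integral_natCast (hX : Measurable X) :
    ∫ ω, (X ω : ℝ) ∂P = (∫⁻ ω, (X ω : ℝ≥0∞) ∂P).toReal := by
  rw [integral_eq_lintegral_of_nonneg_ae (.of_forall fun ω => Nat.cast_nonneg _)
    ((measurable_of_countable (fun n : ℕ => (n : ℝ))).comp hX).aestronglyMeasurable]
  simp

variable {Ω' : Type} [MeasurableSpace Ω'] {P' : Measure Ω'} {Y : Ω' → ℕ}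

theorem lintegral_comp_eq_of_map_eq (hX : Measurable X) (hY : Measurable Y)
    (h : P.map X = P'.map Y) (f : ℕ → ℝ≥0∞) : ∫⁻ ω, f (X ω) ∂P = ∫⁻ ω, f (Y ω) ∂P' := by
  rw [← lintegral_map (measurable_of_countable f) hX, h,
    lintegral_map (measurable_of_countable f) hY]

/-- Transfer of moments: `X` has the law of a variable `Y` dominated by `1 + Z`. -/
theorem finiteMoment_of_map_eq (hX : Measurable X) (hY : Measurable Y) (h : P.map X = P'.map Y)
    {p : ℕ} {Z : Ω' → ℕ} (hYZ : ∀ ω, Y ω ≤ 1 + Z ω)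
    (hZ : ∫⁻ ω, (1 + Z ω : ℝ≥0∞) ^ p ∂P' ≠ ∞) : FiniteMoment X P p := by
  rw [FiniteMoment, lintegral_comp_eq_of_map_eq hX hY h fun n => (n : ℝ≥0∞) ^ p]
  refine lt_of_le_of_lt (lintegral_mono fun ω => ?_) hZ.lt_top
  exact pow_le_pow_left' (by exact_mod_cast hYZ ω) p

theorem finiteExpMoment_of_map_eq (hX : Measurable X) (hY : Measurable Y) (h : P.map X = P'.map Y)
    {ε : ℝ} (hε : 0 < ε) {Z : Ω' → ℕ} (hYZ : ∀ ω, Y ω ≤ 1 + Z ω)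
    (hZ : ∫⁻ ω, ENNReal.ofReal (Real.exp (ε * (1 + Z ω))) ∂P' ≠ ∞) : FiniteExpMoment X P := by
  refine ⟨ε, hε, ?_⟩
  rw [lintegral_comp_eq_of_map_eq hX hY h fun n => ENNReal.ofReal (Real.exp (ε * (n : ℝ)))]
  refine lt_of_le_of_lt (lintegral_mono fun ω => ENNReal.ofReal_le_ofReal
    (Real.exp_le_exp.2 (mul_le_mul_of_nonneg_left ?_ hε.le))) hZ.lt_top
  exact_mod_cast hYZ ω

end MomentTransfer

/-! ### Independence from the joint law -/

section Independence

variable {Ω : Type} [MeasurableSpace Ω] {P : Measure Ω} {X Y : ℕ → Ω → ℕ} {α β : ℕ → Measure ℕ}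
  [∀ n, IsProbabilityMeasure (α n)] [∀ n, IsProbabilityMeasure (β n)]

/-- The marginal laws of two sequences whose joint law is a product of product measures. -/
theorem map_eq_of_map_prod_eq (hX : ∀ n, Measurable (X n)) (hY : ∀ n, Measurable (Y n))
    (h : P.map (fun ω => ((fun n => X n ω), fun n => Y n ω)) =
      (Measure.infinitePi α).prod (Measure.infinitePi β)) (n : ℕ) :
    P.map (X n) = α n ∧ P.map (Y n) = β n := by
  have hm : Measurable fun ω => ((fun n => X n ω), fun n => Y n ω) :=
    (measurable_pi_lambda _ hX).prodMk (measurable_pi_lambda _ hY)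
  constructor
  · have h1 : P.map (X n) = ((P.map (fun ω => ((fun n => X n ω), fun n => Y n ω))).map
        Prod.fst).map (fun y => y n) := by
      rw [Measure.map_map measurable_fst hm,
        Measure.map_map (measurable_pi_apply n) (measurable_fst.comp hm)]
      rfl
    rw [h1, h, Measure.map_fst_prod, measure_univ, one_smul]
    exact (measurePreserving_eval_infinitePi α n).map_eq
  · have h1 : P.map (Y n) = ((P.map (fun ω => ((fun n => X n ω), fun n => Y n ω))).map
        Prod.snd).map (fun y => y n) := by
      rw [Measure.map_map measurable_snd hm,
        Measure.map_map (measurable_pi_apply n) (measurable_snd.comp hm)]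
      rfl
    rw [h1, h, Measure.map_snd_prod, measure_univ, one_smul]
    exact (measurePreserving_eval_infinitePi β n).map_eq

/-- Two sequences whose joint law is a product of product measures form together an independent
family. -/
theorem iIndepFun_of_map_prod_eq (hX : ∀ n, Measurable (X n)) (hY : ∀ n, Measurable (Y n))
    (h : P.map (fun ω => ((fun n => X n ω), fun n => Y n ω)) =
      (Measure.infinitePi α).prod (Measure.infinitePi β)) :
    iIndepFun (fun s : ℕ ⊕ ℕ => Sum.elim Y X s) P := by
  have hm : Measurable fun ω => ((fun n => X n ω), fun n => Y n ω) :=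
    (measurable_pi_lambda _ hX).prodMk (measurable_pi_lambda _ hY)
  have hmarg := map_eq_of_map_prod_eq hX hY h
  rw [iIndepFun_iff_measure_inter_preimage_eq_mul]
  intro S A hA
  have hset : (⋂ s ∈ S, Sum.elim Y X s ⁻¹' A s) =
      (fun ω => ((fun n => X n ω), fun n => Y n ω)) ⁻¹'
        ((Set.pi S.toRight fun n => A (.inr n)) ×ˢ Set.pi S.toLeft fun n => A (.inl n)) := by
    ext ω
    simp only [Set.mem_iInter, Set.mem_preimage, Set.mem_prod, Set.mem_pi, Finset.mem_coe,
      Finset.mem_toLeft, Finset.mem_toRight, Sum.forall, Sum.elim_inl, Sum.elim_inr]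
    exact and_comm
  rw [hset, ← Measure.map_apply hm ((MeasurableSet.pi S.toRight.countable_toSet
    fun _ _ => MeasurableSet.of_discrete).prod (MeasurableSet.pi S.toLeft.countable_toSet
    fun _ _ => MeasurableSet.of_discrete)), h, Measure.prod_prod,
    Measure.infinitePi_pi _ fun _ _ => MeasurableSet.of_discrete,
    Measure.infinitePi_pi _ fun _ _ => MeasurableSet.of_discrete]
  conv_rhs => rw [← Finset.toLeft_disjSum_toRight (u := S), Finset.prod_disjSum]
  rw [mul_comm]
  congr 1
  · refine Finset.prod_congr rfl fun n _ => ?_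
    rw [Sum.elim_inl, ← (hmarg n).2, Measure.map_apply (hY n) MeasurableSet.of_discrete]
  · refine Finset.prod_congr rfl fun n _ => ?_
    rw [Sum.elim_inr, ← (hmarg n).1, Measure.map_apply (hX n) MeasurableSet.of_discrete]

end Independence

/-! ### Monotype Galton-Watson forests -/

section Monotype

variable (ν : PMF ℕ)

theorem monotypeOffspring_apply (k : Fin 1) (w : List (Fin 1)) :
    monotypeOffspring ν k w = ν w.length := by
  rw [monotypeOffspring, PMF.map_apply, tsum_eq_single w.length]
  · rw [if_pos]
    exact List.eq_replicate_iff.2 ⟨rfl, fun _ _ => Subsingleton.elim _ _⟩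
  · intro n hn
    rw [if_neg]
    rintro rfl
    simp at hn

theorem treeLaw_monotypeOffspring_singleton (s : PTree (Fin 1)) :
    treeLaw (monotypeOffspring ν) 0 {s} = labelledWeight (fun _ c => ν c) s := by
  rw [treeLaw_singleton, if_pos (Subsingleton.elim _ _), gwWeight, labelledWeight]
  simp only [monotypeOffspring_apply, List.length_map]

theorem tsum_mul_unordered_monotypeOffspring (k : Fin 1) (F : (Fin 1 → ℕ) → ℝ≥0∞) :
    ∑' z, F z * unordered (monotypeOffspring ν) k z = ∑' n, ν n * F fun _ => n := by
  rw [unordered, tsum_mul_map]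
  simp only [monotypeOffspring]
  simp_rw [mul_comm _ (F (typeCount _))]
  rw [tsum_mul_map ν (fun n => List.replicate n 0) fun w => F (typeCount w)]
  refine tsum_congr fun n => ?_
  congr 2
  funext l
  rw [typeCount, Subsingleton.elim l 0, List.count_replicate_self]

theorem isCritical_monotypeOffspring (h : ∑' n, ν n * (n : ℝ≥0∞) = 1) :
    IsCritical (unordered (monotypeOffspring ν)) := by
  have hone : ∀ k l, meanMatrix (unordered (monotypeOffspring ν)) k l = 1 := fun k l => by
    rw [meanMatrix, Matrix.of_apply,
      tsum_mul_unordered_monotypeOffspring ν k fun z => (z l : ℝ≥0∞), h]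
  refine ⟨fun k l => by simp [hone], ?_⟩
  have h1 : (realMeanMatrix (unordered (monotypeOffspring ν))).map (algebraMap ℝ ℂ) = 1 := by
    ext k l
    rw [Subsingleton.elim k l]
    simp [realMeanMatrix, hone]
  rw [h1, spectralRadius, spectrum.one_eq]
  simp

theorem hasFiniteVariance_monotypeOffspring (h : ∑' n, ν n * (n : ℝ≥0∞) ^ 2 ≠ ∞) :
    HasFiniteVariance (unordered (monotypeOffspring ν)) := by
  intro k l l'
  rw [secondDeriv, tsum_mul_unordered_monotypeOffspring ν k
    fun z => ((z l * (z l' - if l = l' then 1 else 0) : ℕ) : ℝ≥0∞)]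
  refine ne_top_of_le_ne_top h (ENNReal.tsum_le_tsum fun n => ?_)
  gcongr
  rw [← Nat.cast_pow, Nat.cast_le, sq]
  exact Nat.mul_le_mul_left n (Nat.sub_le _ _)

theorem toMeasure_lintegral_eq_tsum (f : ℕ → ℝ≥0∞) : ∫⁻ n, f n ∂ν.toMeasure = ∑' n, ν n * f n := by
  rw [lintegral_countable']
  refine tsum_congr fun n => ?_
  rw [PMF.toMeasure_apply_singleton _ _ MeasurableSet.of_discrete, mul_comm]

end Monotype

/-! ### The law of the forest -/

section Forest

variable {K : ℕ} (ζ : Fin K → PMF (List (Fin K)))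

theorem forestLaw_eq [h : ∀ j, IsProbabilityMeasure (treeLaw ζ j)] (x : ℕ → Fin K) :
    forestLaw ζ x = Measure.infinitePi fun n => treeLaw ζ (x n) :=
  dif_pos fun n => h (x n)

variable (i : Fin K)

/-- A vertex of type `i` appears with positive probability. -/
theorem treeLaw_rootCount_eq_zero_lt_one {j : Fin K} [IsProbabilityMeasure (treeLaw ζ j)]
    (h : ∫⁻ t, (rootCount i t : ℝ≥0∞) ∂(treeLaw ζ j) ≠ 0) :
    treeLaw ζ j {t | rootCount i t = 0} < 1 := by
  refine lt_of_le_of_ne prob_le_one fun h1 => h ?_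
  rw [lintegral_eq_zero_iff .of_discrete]
  have h2 : ∀ᵐ t ∂(treeLaw ζ j), rootCount i t = 0 := (prob_compl_eq_zero_iff .of_discrete).2 h1
  filter_upwards [h2] with t ht
  simp [ht]

theorem measurable_deletedCount (n : ℕ) : Measurable (deletedCount i n) := by
  have h : deletedCount i n = fun f => marksInOrder (markedForest i id f) n :=
    funext (deletedCount_eq i n)
  rw [h]
  exact (measurable_pi_apply n).comp (measurable_marksInOrder.comp (measurable_markedForest i id))

theorem measurable_floorCount (n : ℕ) : Measurable (floorCount i n) :=
  Measurable.of_discrete.comp (measurable_pi_apply n)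

/-- The reduced forest is a Galton-Watson forest. -/
theorem map_reduction_forestLaw [hP : ∀ j, IsProbabilityMeasure (treeLaw ζ j)]
    (hpos : ∀ j, treeLaw ζ j {t | rootCount i t = 0} < 1) (x : ℕ → Fin K) {ν : PMF ℕ}
    (hν : ν.toMeasure = reducedOffspring ζ i i) :
    (forestLaw ζ x).map (reduction i) = monotypeForestLaw ν := by
  set g : ℕ → Fin 1 := fun _ => 0 with hg
  have hG : IsProbabilityMeasure (reducedTreeLaw ζ i g) :=
    Measure.isProbabilityMeasure_map (Measurable.of_discrete.aemeasurable)
  have hF : ∀ n, IsProbabilityMeasure ((treeLaw ζ (x n)).map (floorTree i)) := fun n =>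
    Measure.isProbabilityMeasure_map (Measurable.of_discrete.aemeasurable)
  have hsome : Measurable fun (s : ℕ → PTree (Fin 1)) (n : ℕ) => some (s n) :=
    measurable_pi_lambda _ fun n => Measurable.of_discrete.comp (measurable_pi_apply n)
  have hθ : markedOffspring ζ i g = fun _ c => ν c := by
    funext y c
    rw [← PMF.toMeasure_apply_singleton ν c MeasurableSet.of_discrete, hν, reducedOffspring,
      Measure.map_apply .of_discrete MeasurableSet.of_discrete, markedOffspring]
    congr 1
    ext t
    simp [Subsingleton.elim y (g (deletedBelow i t))]
  have htree : treeLaw (monotypeOffspring ν) 0 = reducedTreeLaw ζ i g := by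
    refine Measure.ext_of_singleton fun s => ?_
    rw [treeLaw_monotypeOffspring_singleton, reducedTreeLaw_singleton ζ i g hP, hθ]
  have hν1 : ∀ k, IsProbabilityMeasure (treeLaw (monotypeOffspring ν) k) := fun k => by
    rw [Subsingleton.elim k 0, htree]
    exact hG
  have hred : reduction i = markedForest i g := funext (reduction_eq i)
  have hfloor : Measurable fun (f : ℕ → PTree (Fin K)) (n : ℕ) => floorTree i (f n) :=
    measurable_pi_lambda _ (measurable_floorCount i)
  have hcomp : markedForest i g = Prod.snd ∘ fun f : ℕ → PTree (Fin K) =>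
    ((fun n => floorTree i (f n)), markedForest i g f) := rfl
  rw [hred, forestLaw_eq, hcomp,
    ← Measure.map_map measurable_snd (hfloor.prodMk (measurable_markedForest i g)),
    map_floor_markedForest ζ i g hpos x, Measure.map_snd_prod, measure_univ, one_smul,
    monotypeForestLaw, forestLaw_eq]
  simp only [htree]

/-- The variance of the number of children of the root of the reduced tree. -/
theorem variance_reducedOffspring [hP : ∀ j, IsProbabilityMeasure (treeLaw ζ j)]
    {a b : Fin K → ℝ} (ha : ∀ j, 0 < a j) (hb : ∀ j, 0 < b j)
    (hA : ∀ k, ∑ j, ENNReal.ofReal (a j) * meanMatrix (unordered ζ) j k = ENNReal.ofReal (a k))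
    (hQ : HasFiniteVariance (unordered ζ))
    (hmean : ∫⁻ t, (reducedRootCount i t : ℝ≥0∞) ∂(treeLaw ζ i) = 1)
    (hroot : ∀ j, (∫⁻ t, (rootCount i t : ℝ≥0∞) ∂(treeLaw ζ j)).toReal = b j / b i)
    (hfin : ∀ k, ∫⁻ t, (rootCount i t : ℝ≥0∞) ∂(treeLaw ζ k) ≠ ∞)
    (hfin2 : ∀ k, ∫⁻ t, (rootCount i t : ℝ≥0∞) ^ 2 ∂(treeLaw ζ k) ≠ ∞)
    (hred : MemLp (fun z : ℕ => (z : ℝ)) 2 (reducedOffspring ζ i i)) :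
    variance (fun z : ℕ => (z : ℝ)) (reducedOffspring ζ i i) =
      sigma (unordered ζ) a b ^ 2 / (a i * b i ^ 2) := by
  have hprob : IsProbabilityMeasure (reducedOffspring ζ i i) :=
    Measure.isProbabilityMeasure_map (Measurable.of_discrete.aemeasurable)
  have hmul := congrArg ENNReal.toReal (mul_lintegral_reducedRootCount_sq ζ i hP hA
    (fun _ => ENNReal.ofReal_ne_top) hfin hfin2)
  have hterm : ∀ j k l, secondDeriv (unordered ζ) j k l *
      ((∫⁻ t, (rootCount i t : ℝ≥0∞) ∂(treeLaw ζ k)) *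
        ∫⁻ t, (rootCount i t : ℝ≥0∞) ∂(treeLaw ζ l)) ≠ ∞ := fun j k l =>
    ENNReal.mul_ne_top (hQ j k l) (ENNReal.mul_ne_top (hfin k) (hfin l))
  have hsum : ∀ j, ∑ k, ∑ l, secondDeriv (unordered ζ) j k l *
      ((∫⁻ t, (rootCount i t : ℝ≥0∞) ∂(treeLaw ζ k)) *
        ∫⁻ t, (rootCount i t : ℝ≥0∞) ∂(treeLaw ζ l)) ≠ ∞ := fun j =>
    ENNReal.sum_ne_top.2 fun k _ => ENNReal.sum_ne_top.2 fun l _ => hterm j k l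
  rw [ENNReal.toReal_add ENNReal.ofReal_ne_top (ENNReal.sum_ne_top.2 fun j _ =>
      ENNReal.mul_ne_top ENNReal.ofReal_ne_top (hsum j)),
    ENNReal.toReal_sum fun j _ => ENNReal.mul_ne_top ENNReal.ofReal_ne_top (hsum j),
    ENNReal.toReal_mul, ENNReal.toReal_ofReal (ha i).le] at hmul
  have hquad : ∀ j, (ENNReal.ofReal (a j) * ∑ k, ∑ l, secondDeriv (unordered ζ) j k l *
      ((∫⁻ t, (rootCount i t : ℝ≥0∞) ∂(treeLaw ζ k)) *
        ∫⁻ t, (rootCount i t : ℝ≥0∞) ∂(treeLaw ζ l))).toReal =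
      a j * quadForm (unordered ζ) j b / b i ^ 2 := by
    intro j
    rw [ENNReal.toReal_mul, ENNReal.toReal_ofReal (ha j).le,
      ENNReal.toReal_sum fun k _ => ENNReal.sum_ne_top.2 fun l _ => hterm j k l, quadForm,
      mul_div_assoc, Finset.sum_div]
    congr 1
    refine Finset.sum_congr rfl fun k _ => ?_
    rw [ENNReal.toReal_sum fun l _ => hterm j k l, Finset.sum_div]
    refine Finset.sum_congr rfl fun l _ => ?_
    rw [ENNReal.toReal_mul, ENNReal.toReal_mul, hroot, hroot]
    have := (hb i).ne'
    field_simp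
  simp only [hquad] at hmul
  rw [← Finset.sum_div] at hmul
  have hsigma : sigma (unordered ζ) a b ^ 2 = ∑ j, a j * quadForm (unordered ζ) j b := by
    refine Real.sq_sqrt (Finset.sum_nonneg fun j _ => mul_nonneg (ha j).le ?_)
    exact Finset.sum_nonneg fun k _ => Finset.sum_nonneg fun l _ =>
      mul_nonneg (mul_nonneg ENNReal.toReal_nonneg (hb k).le) (hb l).le
  have hE1 : ∫ z, ((z : ℕ) : ℝ) ∂(reducedOffspring ζ i i) = 1 := by
    rw [integral_natCast (X := fun z : ℕ => z) .of_discrete, reducedOffspring,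
      lintegral_map .of_discrete .of_discrete, hmean, ENNReal.toReal_one]
  have hE2 : ∫ z, ((z : ℕ) : ℝ) ^ 2 ∂(reducedOffspring ζ i i) =
      (∫⁻ t, (reducedRootCount i t : ℝ≥0∞) ^ 2 ∂(treeLaw ζ i)).toReal := by
    have h := integral_natCast (P := reducedOffspring ζ i i) (X := fun z : ℕ => z ^ 2) .of_discrete
    simp only [Nat.cast_pow] at h
    rw [h, reducedOffspring, lintegral_map .of_discrete .of_discrete]
  have hvar : variance (fun z : ℕ => (z : ℝ)) (reducedOffspring ζ i i) =
      (∫⁻ t, (reducedRootCount i t : ℝ≥0∞) ^ 2 ∂(treeLaw ζ i)).toReal - 1 := by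
    rw [variance_eq_sub hred, hE1, one_pow, ← hE2]
    rfl
  rw [hvar, hsigma, eq_div_iff (mul_pos (ha i) (pow_pos (hb i) 2)).ne']
  have hbi := (hb i).ne'
  field_simp at hmul
  linear_combination hmul

end Forest

end MultitypeGW

theorem proposition3 {K : ℕ} (ζ : Fin K → PMF (List (Fin K)))
    (hH : BasicAssumption (unordered ζ))
    (a b : Fin K → ℝ)
    (ha : Matrix.vecMul a (realMeanMatrix (unordered ζ)) = a)
    (hb : Matrix.mulVec (realMeanMatrix (unordered ζ)) b = b)
    (ha1 : ∑ j, a j = 1) (hab : ∑ j, a j * b j = 1)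
    (i : Fin K) (x : ℕ → Fin K) :
    -- the Galton-Watson laws are well defined
    ((∀ j, IsProbabilityMeasure (treeLaw ζ j)) ∧ IsProbabilityMeasure (forestLaw ζ x)) ∧
    -- (i) the reduced forest is a critical monotype Galton-Watson forest
    ((∃ ν : PMF ℕ, ν.toMeasure = reducedOffspring ζ i i ∧
        (forestLaw ζ x).map (reduction i) = monotypeForestLaw ν ∧
        IsCritical (unordered (monotypeOffspring ν)) ∧
        HasFiniteVariance (unordered (monotypeOffspring ν))) ∧
      ∫⁻ z, (z : ℝ≥0∞) ∂(reducedOffspring ζ i i) = 1 ∧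
      MemLp (fun z : ℕ => (z : ℝ)) 2 (reducedOffspring ζ i i) ∧
      variance (fun z : ℕ => (z : ℝ)) (reducedOffspring ζ i i) =
        sigma (unordered ζ) a b ^ 2 / (a i * b i ^ 2)) ∧
    -- (ii) the numbers of deleted vertices
    (iIndepFun (fun s : ℕ ⊕ ℕ => Sum.elim (deletedCount i) (floorCount i) s) (forestLaw ζ x) ∧
      (∀ n, IdentDistrib (deletedCount i n) (deletedCount i 0) (forestLaw ζ x) (forestLaw ζ x)) ∧
      (∀ n, MemLp (fun f => (deletedCount i n f : ℝ)) 2 (forestLaw ζ x)) ∧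
      (∀ n, ∫ f, (deletedCount i n f : ℝ) ∂(forestLaw ζ x) = 1 / a i - 1) ∧
      (∀ n, MemLp (fun f => (floorCount i n f : ℝ)) 2 (forestLaw ζ x)) ∧
      (∀ j, MemLp (fun z : ℕ => (z : ℝ)) 2 (reducedOffspring ζ i j))) ∧
    -- (iii) integer moments and exponential moments are inherited
    ((∀ p : ℕ, 1 ≤ p → HasMoment (unordered ζ) p →
        (∀ j, FiniteMoment (fun z : ℕ => z) (reducedOffspring ζ i j) p) ∧
        (∀ n, FiniteMoment (deletedCount i n) (forestLaw ζ x) p) ∧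
        (∀ n, FiniteMoment (floorCount i n) (forestLaw ζ x) p)) ∧
      (HasExpMoment (unordered ζ) →
        (∀ j, FiniteExpMoment (fun z : ℕ => z) (reducedOffspring ζ i j)) ∧
        (∀ n, FiniteExpMoment (deletedCount i n) (forestLaw ζ x)) ∧
        (∀ n, FiniteExpMoment (floorCount i n) (forestLaw ζ x)))) := by
  have hm := hH.critical.1
  have hM := realMeanMatrix_irreducible hH.irreducible hm
  obtain ⟨ha0, hb0⟩ := eigenvectors_pos
    (fun j k => (ENNReal.toReal_nonneg : 0 ≤ realMeanMatrix (unordered ζ) j k)) hM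
    hH.critical.2.le ha hb ha1 hab
  have hA := sum_ofReal_mul_meanMatrix hm (fun j => (ha0 j).le) ha
  have hA0 : ∀ j, ENNReal.ofReal (a j) ≠ 0 := fun j => (ENNReal.ofReal_pos.2 (ha0 j)).ne'
  have hAt : ∀ j, ENNReal.ofReal (a j) ≠ ∞ := fun j => ENNReal.ofReal_ne_top
  have hA1 : ∑ j, ENNReal.ofReal (a j) = 1 := by
    rw [← ENNReal.ofReal_sum_of_nonneg fun j _ => (ha0 j).le, ha1, ENNReal.ofReal_one]
  have hP : ∀ j, IsProbabilityMeasure (treeLaw ζ j) :=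
    isProbabilityMeasure_treeLaw ζ hH.irreducible hH.nondegenerate hA hA0 hAt
  -- The finite Green function killed at `i`, which controls all the moments of the pruned trees.
  obtain ⟨v, hvt, hv⟩ := exists_killed_supersolution hH.irreducible hm hA hA0 hA1 i
  have hmom : ∀ {p}, HasMoment (unordered ζ) p → ∀ j,
      ∫⁻ t, (1 + prunedBelow i t : ℝ≥0∞) ^ p ∂(treeLaw ζ j) ≠ ∞ := fun h j =>
    lintegral_one_add_prunedBelow_pow_ne_top ζ hP hm i hvt hv h j
  have hmom1 := hmom (hasMoment_one ζ hm)
  have hmom2 := hmom (hasMoment_two ζ hm hH.finiteVariance)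
  have hroot1 : ∀ k, ∫⁻ t, (rootCount i t : ℝ≥0∞) ∂(treeLaw ζ k) ≠ ∞ := fun k =>
    ne_top_of_le_ne_top (hmom1 k) (lintegral_mono fun t =>
      (by exact_mod_cast rootCount_le i t : (_ : ℝ≥0∞) ≤ _).trans (pow_one _).ge)
  have hroot2 : ∀ k, ∫⁻ t, (rootCount i t : ℝ≥0∞) ^ 2 ∂(treeLaw ζ k) ≠ ∞ := fun k =>
    ne_top_of_le_ne_top (hmom2 k) (lintegral_mono fun t =>
      pow_le_pow_left' (by exact_mod_cast rootCount_le i t) 2)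
  have hfloor1 : ∀ k, ∫⁻ t, (floorTree i t : ℝ≥0∞) ∂(treeLaw ζ k) ≠ ∞ := fun k =>
    ne_top_of_le_ne_top (hmom1 k) (lintegral_mono fun t =>
      (by exact_mod_cast floorTree_le i t : (_ : ℝ≥0∞) ≤ _).trans (pow_one _).ge)
  have hroot := lintegral_rootCount_eq ζ i hP hH.critical hA hA0 hAt hb (hb0 i).ne' hM hroot1
  -- The mean `b j / b i` of the number of first type-`i` vertices is positive.
  have hpos : ∀ j, treeLaw ζ j {t | rootCount i t = 0} < 1 := fun j =>
    treeLaw_rootCount_eq_zero_lt_one ζ i fun h0 => by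
      have h1 := hroot j
      rw [h0, ENNReal.toReal_zero] at h1
      exact (div_pos (hb0 j) (hb0 i)).ne h1
  have hmean := lintegral_reducedRootCount_self ζ i hP hA hA0 hAt hroot1
  have hF := forestLaw_eq ζ x
  have hFP : IsProbabilityMeasure (forestLaw ζ x) := by rw [hF]; infer_instance
  have hD : IsProbabilityMeasure ((treeLaw ζ i).map (deletedBelow i)) :=
    Measure.isProbabilityMeasure_map (Measurable.of_discrete.aemeasurable)
  have hR : IsProbabilityMeasure (reducedOffspring ζ i i) :=
    Measure.isProbabilityMeasure_map (Measurable.of_discrete.aemeasurable)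
  have hFl : ∀ n, IsProbabilityMeasure ((treeLaw ζ (x n)).map (floorTree i)) := fun n =>
    Measure.isProbabilityMeasure_map (Measurable.of_discrete.aemeasurable)
  have hjoint := map_floorCount_deletedCount ζ i hpos x
  rw [← hF] at hjoint
  have hmarg := map_eq_of_map_prod_eq (measurable_floorCount i) (measurable_deletedCount i) hjoint
  have hred : ∀ j, (reducedOffspring ζ i j).map (fun z : ℕ => z) =
      (treeLaw ζ j).map (reducedRootCount i) := fun j => Measure.map_id
  have hredM : ∀ {p}, HasMoment (unordered ζ) p → ∀ j,
      FiniteMoment (fun z : ℕ => z) (reducedOffspring ζ i j) p := fun h j =>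
    finiteMoment_of_map_eq .of_discrete .of_discrete (hred j) (Z := prunedBelow i)
      (fun t => (reducedRootCount_le i t).trans (Nat.le_add_left _ _)) (hmom h j)
  have hdelM : ∀ {p}, HasMoment (unordered ζ) p → ∀ n,
      FiniteMoment (deletedCount i n) (forestLaw ζ x) p := fun h n =>
    finiteMoment_of_map_eq (measurable_deletedCount i n) .of_discrete (hmarg n).2
      (Z := prunedBelow i) (fun t => (deletedBelow_le i t).trans (Nat.le_add_left _ _)) (hmom h i)
  have hfloorM : ∀ {p}, HasMoment (unordered ζ) p → ∀ n,
      FiniteMoment (floorCount i n) (forestLaw ζ x) p := fun h n =>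
    finiteMoment_of_map_eq (measurable_floorCount i n) .of_discrete (hmarg n).1
      (Z := prunedBelow i) (floorTree_le i) (hmom h (x n))
  have htwo := hasMoment_two ζ hm hH.finiteVariance
  have hredL : ∀ j, MemLp (fun z : ℕ => (z : ℝ)) 2 (reducedOffspring ζ i j) := fun j =>
    memLp_two_of_finiteMoment .of_discrete (hredM htwo j)
  have hν := (reducedOffspring ζ i i).toPMF_toMeasure
  have hmean' : ∫⁻ z, (z : ℝ≥0∞) ∂(reducedOffspring ζ i i) = 1 := by
    rw [reducedOffspring, lintegral_map .of_discrete .of_discrete]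
    exact hmean
  refine ⟨⟨hP, hFP⟩, ⟨⟨(reducedOffspring ζ i i).toPMF, hν, ?_, ?_, ?_⟩, hmean', hredL i, ?_⟩,
    ⟨?_, ?_, ?_, ?_, ?_, hredL⟩, fun p _ hp => ⟨hredM hp, hdelM hp, hfloorM hp⟩, fun hexp => ?_⟩
  · exact map_reduction_forestLaw ζ i hpos x hν
  · refine isCritical_monotypeOffspring _ ?_
    rw [← toMeasure_lintegral_eq_tsum, hν, hmean']
  · refine hasFiniteVariance_monotypeOffspring _ ?_
    rw [← toMeasure_lintegral_eq_tsum _ fun n => (n : ℝ≥0∞) ^ 2, hν]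
    exact (hredM htwo i).ne
  · exact variance_reducedOffspring ζ i ha0 hb0 hA hH.finiteVariance hmean hroot hroot1 hroot2
      (hredL i)
  · exact iIndepFun_of_map_prod_eq (measurable_floorCount i) (measurable_deletedCount i) hjoint
  · exact fun n => ⟨(measurable_deletedCount i n).aemeasurable,
      (measurable_deletedCount i 0).aemeasurable, by rw [(hmarg n).2, (hmarg 0).2]⟩
  · exact fun n => memLp_two_of_finiteMoment (measurable_deletedCount i n) (hdelM htwo n)
  · intro n
    have h := congrArg ENNReal.toReal (mul_lintegral_deletedBelow_add ζ i hP hA hAt hA1 hfloor1)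
    have hdel : ∫⁻ t, (deletedBelow i t : ℝ≥0∞) ∂(treeLaw ζ i) ≠ ∞ :=
      ne_top_of_le_ne_top (hmom1 i) (lintegral_mono fun t =>
        (by exact_mod_cast (deletedBelow_le i t).trans (Nat.le_add_left _ 1) :
          (_ : ℝ≥0∞) ≤ _).trans (pow_one _).ge)
    rw [ENNReal.toReal_add (ENNReal.mul_ne_top (hAt i) hdel) (hAt i), ENNReal.toReal_mul,
      ENNReal.toReal_ofReal (ha0 i).le, ENNReal.toReal_one] at h
    rw [integral_natCast (measurable_deletedCount i n),
      lintegral_comp_eq_of_map_eq (measurable_deletedCount i n) .of_discrete (hmarg n).2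
        fun n => (n : ℝ≥0∞)]
    have hai := (ha0 i).ne'
    field_simp
    linear_combination h
  · exact fun n => memLp_two_of_finiteMoment (measurable_floorCount i n) (hfloorM htwo n)
  · obtain ⟨ε, hε, hexp'⟩ := exists_lintegral_exp_prunedBelow_ne_top ζ hm i hvt hv hexp
    exact ⟨fun j => finiteExpMoment_of_map_eq .of_discrete .of_discrete (hred j) hε
        (fun t => (reducedRootCount_le i t).trans (Nat.le_add_left _ _)) (hexp' j),
      fun n => finiteExpMoment_of_map_eq (measurable_deletedCount i n) .of_discrete (hmarg n).2 hε
        (fun t => (deletedBelow_le i t).trans (Nat.le_add_left _ _)) (hexp' i),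
      fun n => finiteExpMoment_of_map_eq (measurable_floorCount i n) .of_discrete (hmarg n).1 hε
        (floorTree_le i) (hexp' (x n))⟩
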